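/- Let $(Z_n)_{n\in\mathbb Z}$ be i.i.d. non-degenerate real random variables with law $F_Z$, let $1/2<\alpha<1$, and let $(a_n)_{n\ge 0}$ be real coefficients such that $a_n\sim n^{-\alpha}$ as $n\to\infty$ and $(a_n)$ is eventually monotone. Let $\sigma_Z^2=\int z^2\,F_Z(dz)$ with $\sigma_Z>0$, and let $\kappa$ be the smallest integer $>\frac{4\alpha-1}{2-2\alpha}$. Assume that 1. $\int_{\mathbb R} e^{tz}\,F_Z(dz)<\infty$ for all $t\in\mathbb R$; 2. for some $\theta_0>0$, $\displaystyle\sup_{|\theta|\le\theta_0}\int_{-\infty}^\infty t^2\left|\int_{-\infty}^\infty e^{(it+\theta)z}\,F_Z(dz)\right|dt<\infty$; 3. $E Z_0^i=E G^i$ for $1\le i\le\kappa$, where $G\sim N(0,\sigma_Z^2)$ (in particular $EZ_0=0$, as $\kappa\ge 2$). Then the series $X_n=\sum_{i=0}^\infty a_iZ_{n-i}$, $n\ge0$, converge almost surely. For $\varepsilon>0$, $n\ge1$ and $j\ge0$ put $$E_j(n,\varepsilon)=\Bigl\{\frac1n\sum_{i=j}^{n+j-1}X_i\ge\varepsilon\Bigr\},\qquad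 I_n(\varepsilon)=\inf\{j\ge1: E_j(n,\varepsilon)\text{ does not occur}\}.$$ Let $\beta=\frac{4-4\alpha}{3-2\alpha}$, $H=\frac32-\alpha$ and $C_\alpha=\frac{\mathrm B(1-\alpha,2\alpha-1)}{(1-\alpha)(3-2\alpha)}$, where $\mathrm B$ is the Beta function. Let $(B_H(t))_{t\ge0}$ be a standard fractional Brownian motion with Hurst index $H$ (a zero mean Gaussian process with continuous paths and $E\,B_H(s)B_H(t)=\frac12(s^{2H}+t^{2H}-|s-t|^{2H})$), let $T_0$ be a standard exponential random variable independent of $B_H$, and let $$\tau_\varepsilon=\inf\Bigl\{t\ge0:\ \sigma_Z B_H(t)\le(2C_\alpha)^{-1/2}\,\varepsilon\,t^{2H}-(C_\alpha/2)^{1/2}\,\sigma_Z^2\,\varepsilon^{-1}\,T_0\Bigr\}.$$ Then for every $\varepsilon>0$ we have $P(E_0(n,\varepsilon))>0$ for all large $n$, $\tau_\varepsilon$ is an almost surely finite and strictly positive random variable, and $$P\bigl(n^{-\beta}I_n(\varepsilon)\in\cdot\,\big|\,E_0(n,\varepsilon)\bigr)\Rightarrow P(\tau_\varepsilon\in\cdot)\qquad(n\to\infty).$$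 -/

import Mathlib

open MeasureTheory ProbabilityTheory Filter Asymptotics
open scoped Topology NNReal ENNReal BoundedContinuousFunction

namespace LongMemory

/-- The infinite moving average `X_n = ∑_{i ≥ 0} a_i Z_{n-i}`, `n ≥ 0`. In the long memory regime
the series converges almost surely but not absolutely, so it is the limit of its partial sums
(and not an unconditional sum). -/
noncomputable def movingAverage {Ω : Type*} (a : ℕ → ℝ) (Z : ℤ → Ω → ℝ) (n : ℕ) (ω : Ω) : ℝ :=
  limUnder atTop fun N : ℕ => ∑ i ∈ Finset.range N, a i * Z ((n : ℤ) - (i : ℤ)) ω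

/-- The event `E_j(n, ε) = {(1/n) ∑_{i=j}^{n+j-1} X_i ≥ ε}`. -/
def largeDevEvent {Ω : Type*} (X : ℕ → Ω → ℝ) (j n : ℕ) (ε : ℝ) : Set Ω :=
  {ω | ε ≤ (1 / (n : ℝ)) * ∑ i ∈ Finset.Ico j (n + j), X i ω}

/-- `I_n(ε) = inf {j ≥ 1 : E_j(n, ε) does not occur}`, with `inf ∅ = ∞`. -/
noncomputable def firstNonOccurrence {Ω : Type*} (X : ℕ → Ω → ℝ) (n : ℕ) (ε : ℝ) (ω : Ω) : ℕ∞ :=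
  ⨅ (j : ℕ) (_ : 1 ≤ j) (_ : ω ∉ largeDevEvent X j n ε), (j : ℕ∞)

/-- `n^{-β} I_n(ε)` as a random variable with values in `[0, ∞]`. -/
noncomputable def scaledFirstNonOccurrence {Ω : Type*} (X : ℕ → Ω → ℝ) (β : ℝ) (n : ℕ) (ε : ℝ)
    (ω : Ω) : ℝ≥0∞ :=
  ENNReal.ofReal ((n : ℝ) ^ (-β)) * (firstNonOccurrence X n ε ω : ℝ≥0∞)

/-- Finite exponential moments: `∫ e^{tz} F(dz) < ∞` for all real `t`. -/
def HasExponentialMoments (F : Measure ℝ) : Prop :=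
  ∀ t : ℝ, Integrable (fun z : ℝ => Real.exp (t * z)) F

/-- `a_n ∼ n^{-α}`, and the sequence is eventually monotone. -/
def IsPowerType (a : ℕ → ℝ) (α : ℝ) : Prop :=
  a ~[atTop] (fun n : ℕ => (n : ℝ) ^ (-α)) ∧
    ∃ N : ℕ, MonotoneOn a (Set.Ici N) ∨ AntitoneOn a (Set.Ici N)

/-- For some `θ₀ > 0`, `sup_{|θ| ≤ θ₀} ∫ t² |∫ e^{(it+θ)z} F(dz)| dt < ∞`. -/
def SmoothTiltedCharFun (F : Measure ℝ) : Prop :=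
  ∃ θ₀ : ℝ, 0 < θ₀ ∧
    (⨆ θ ∈ Set.Icc (-θ₀) θ₀, ∫⁻ t : ℝ, ENNReal.ofReal
      (t ^ 2 * ‖∫ z : ℝ, Complex.exp ((Complex.I * (t : ℂ) + (θ : ℂ)) * (z : ℂ)) ∂F‖)) < ∞

/-- `σ_Z² = ∫ z² F(dz)`. -/
noncomputable def noiseVariance (F : Measure ℝ) : ℝ := ∫ z, z ^ 2 ∂F

/-- `κ`, the smallest integer `> (4α - 1)/(2 - 2α)` (this quotient is `> 1` if `1/2 < α < 1`). -/
noncomputable def kappa (α : ℝ) : ℕ := sInf {k : ℕ | (4 * α - 1) / (2 - 2 * α) < (k : ℝ)}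

/-- `E Z^i = E G^i` for `1 ≤ i ≤ κ`, where `Z` has law `F` and `G ∼ N(0, σ_Z²)`. -/
def MatchesGaussianMoments (F : Measure ℝ) (κ : ℕ) : Prop :=
  ∀ i : ℕ, 1 ≤ i → i ≤ κ →
    ∫ z, z ^ i ∂F = ∫ g, g ^ i ∂(gaussianReal 0 (noiseVariance F).toNNReal)

/-- `β = (4 - 4α)/(3 - 2α)`. -/
noncomputable def scalingExponent (α : ℝ) : ℝ := (4 - 4 * α) / (3 - 2 * α)

/-- `H = 3/2 - α`. -/
noncomputable def hurstIndex (α : ℝ) : ℝ := 3 / 2 - α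

/-- `C_α = B(1 - α, 2α - 1) / ((1 - α)(3 - 2α))`, with `B` the Beta function. -/
noncomputable def constC (α : ℝ) : ℝ :=
  ProbabilityTheory.beta (1 - α) (2 * α - 1) / ((1 - α) * (3 - 2 * α))

/-- `B` is a standard fractional Brownian motion with Hurst index `H`: a zero mean Gaussian process
with almost surely continuous paths and `E B(s)B(t) = (s^{2H} + t^{2H} - |s - t|^{2H}) / 2`. -/
structure IsFractionalBrownianMotion {Ω : Type*} [MeasurableSpace Ω] (H : ℝ) (B : ℝ≥0 → Ω → ℝ)
    (Q : Measure Ω) : Prop where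
  gaussian : IsGaussianProcess B Q
  mean_zero : ∀ t, ∫ ω, B t ω ∂Q = 0
  covariance : ∀ s t : ℝ≥0, ∫ ω, B s ω * B t ω ∂Q =
    ((s : ℝ) ^ (2 * H) + (t : ℝ) ^ (2 * H) - |(s : ℝ) - (t : ℝ)| ^ (2 * H)) / 2
  continuous_paths : ∀ᵐ ω ∂Q, Continuous fun t => B t ω

/-- With `C = C_α`, `H = 3/2 - α` and `σ² = σ_Z²`:
`τ_ε = inf {t ≥ 0 : B(t) ≤ (2C)^{-1/2} σ⁻¹ ε t^{2H} - (C/2)^{1/2} σ ε⁻¹ T₀}`, with values in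
`[0, ∞]` (`inf ∅ = ∞`). -/
noncomputable def hittingTime {Ω : Type*} (α σsq ε : ℝ) (B : ℝ≥0 → Ω → ℝ) (T₀ : Ω → ℝ) (ω : Ω) :
    ℝ≥0∞ :=
  ⨅ (t : ℝ≥0) (_ : B t ω ≤
      (2 * constC α) ^ (-(1 / 2) : ℝ) * (√σsq)⁻¹ * ε * (t : ℝ) ^ (2 * hurstIndex α)
        - (constC α / 2) ^ (1 / 2 : ℝ) * √σsq * ε⁻¹ * T₀ ω), (t : ℝ≥0∞)

/-- Weak convergence `μ_n ⇒ ν` of measures. -/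
def WeaklyConverges {E : Type*} [TopologicalSpace E] [MeasurableSpace E]
    (μ : ℕ → Measure E) (ν : Measure E) : Prop :=
  ∀ f : E →ᵇ ℝ, Tendsto (fun n => ∫ x, f x ∂(μ n)) atTop (𝓝 (∫ x, f x ∂ν))

end LongMemory

/-! Write S_j = X_j + ⋯ + X_{n+j-1}, let V_n be the squared ℓ² norm of the coefficients of S_0 with
respect to the noise, so that S_0 has variance σ²V_n, and put θ_n = nε/(σ²V_n). Then E_j is the
event Y_j ≥ 0 for Y_j = θ_n(S_j - nε) (`walk`). Long memory gives V_n ∼ C_α n^{3-2α}, so θ_n has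
order n^{-(2-2α)}, and the squared norm N² of the coefficients of θ_n S_0 has order n^{2α-1}.

Suppose first that the noise is Gaussian. The density e^{Y_0} turns the law of Y_0 into a multiple
of a centered Gaussian law of variance σ²N² → ∞, which is flat at bounded distance from 0. Hence,
given Y_0 ≥ 0, the variable Y_0 is asymptotically standard exponential; this is T_0. On the scale j
≈ n^β t the increments D_j = Y_j - Y_0 have tilted variance tending to 2γt^{2H}, with γ =
ε²/(σ²C_α). By stationarity θ_n S_j and θ_n S_0 have the same norm, so the inner product of D_j with
the tilt is -‖D_j‖²/2 (`inner_tiltCoeff_incrCoeff`) and the tilted mean of D_j tends to -γt^{2H}.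
The correlation of D_j with Y_0 is lost in the limit because N → ∞. Conditionally on E_0 the walk
therefore converges to T_0 + √(2γ)B(t) - γt^{2H}, and τ_ε is the first time at which this process is
≤ 0 (`hittingTime_eq`).

For general noise the transforms of linear functionals are products over the noise variables.
Agreement of κ moments makes the relative error of the Gaussian approximation small as soon as the
sum of |coefficient|^{κ+1} is (`norm_integral_cexp_sub_le`); this sum is at most b_n^{κ-1}N², where
b_n of order n^{-(1-α)} bounds the coefficients, and the choice of κ sends it to 0. To pass from
transforms to probabilities, P is weighted by e^{Y_0}/(1 + Y_0²), suitably normalized. As 1/(1+y²)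
is the Fourier transform of a multiple of e^{-|t|}, the characteristic functions under this weight
are integrals of the transforms against e^{-|t-ξ|}. Frequencies with |t|b_n ≤ ρ obey a Gaussian
bound, the others are exponentially small, and Laplace's method gives the limit
(`tendsto_integral_tiltDensity`). Lévy's theorem then yields convergence in law, and the bounded
factor e^{-|y|}(1+y²) cancels the weight on Y_0 ≥ 0 (`tendsto_cond_walk`).

It remains to control all indices j ≤ n^β t at once. Finitely many times suffice for an upper bound
of the tail probability. The lower bound uses a margin δ on a grid and a dyadic chaining estimate
between grid points, available because the increments have second moments of order |t-s|^{3-2α} with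
3 - 2α > 1 (`exists_tendsto_osc`). The two bounds agree because T_0 is independent of B and has no
atoms (`ae_exists_le_iff`). Convergence of all tails gives weak convergence on [0, ∞]
(`weaklyConverges_of_tendsto_Ioi`). -/

namespace LongMemory

/-! ### The noise distribution -/

section Noise

variable {F : Measure ℝ}

lemma exp_abs_mul_le (t z : ℝ) :
    Real.exp (t * |z|) ≤ Real.exp (t * z) + Real.exp (-t * z) := by
  rcases abs_cases z with ⟨h, -⟩ | ⟨h, -⟩ <;> rw [h]
  · linarith [Real.exp_pos (-t * z)]
  · rw [mul_neg, ← neg_mul]; linarith [Real.exp_pos (t * z)]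

lemma HasExponentialMoments.integrable_exp_mul_abs (h : HasExponentialMoments F) (t : ℝ) :
    Integrable (fun z : ℝ => Real.exp (t * |z|)) F := by
  refine ((h t).add (h (-t))).mono' (by fun_prop) (ae_of_all _ fun z => ?_)
  rw [Real.norm_of_nonneg (Real.exp_pos _).le]
  exact exp_abs_mul_le t z

lemma HasExponentialMoments.integrable_abs_pow_mul_exp (h : HasExponentialMoments F) (n : ℕ) :
    Integrable (fun z : ℝ => |z| ^ n * Real.exp |z|) F := by
  refine ((h.integrable_exp_mul_abs 2).const_mul (n.factorial : ℝ)).mono' (by fun_prop)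
    (ae_of_all _ fun z => ?_)
  rw [Real.norm_of_nonneg (by positivity), two_mul, Real.exp_add, ← mul_assoc]
  gcongr
  have := Real.pow_div_factorial_le_exp _ (abs_nonneg z) n
  rwa [div_le_iff₀' (by positivity)] at this

lemma HasExponentialMoments.integrable_pow (h : HasExponentialMoments F) (n : ℕ) :
    Integrable (fun z : ℝ => z ^ n) F := by
  refine (h.integrable_abs_pow_mul_exp n).mono' (by fun_prop) (ae_of_all _ fun z => ?_)
  rw [norm_pow, Real.norm_eq_abs]
  exact le_mul_of_one_le_right (by positivity) (Real.one_le_exp (abs_nonneg z))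

lemma HasExponentialMoments.integrable_cexp (h : HasExponentialMoments F) (w : ℂ) :
    Integrable (fun z : ℝ => Complex.exp (w * z)) F := by
  refine (h w.re).mono' (by fun_prop) (ae_of_all _ fun z => ?_)
  rw [Complex.norm_exp]
  simp

lemma hasExponentialMoments_gaussianReal (v : ℝ≥0) : HasExponentialMoments (gaussianReal 0 v) :=
  fun t => integrable_exp_mul_gaussianReal t

/-- Taylor's formula for the complex moment generating function at the origin. -/
lemma HasExponentialMoments.norm_complexMGF_sub_sum_le (h : HasExponentialMoments F)
    (n : ℕ) {w : ℂ} (hw : ‖w‖ ≤ 1) :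
    ‖complexMGF id F w
        - ∑ m ∈ Finset.range n, w ^ m / m.factorial * ((∫ z, z ^ m ∂F : ℝ) : ℂ)‖
      ≤ ‖w‖ ^ n * ∫ z, |z| ^ n * Real.exp |z| ∂F := by
  have hterm : ∀ m, ∫ z : ℝ, (w * z) ^ m / m.factorial ∂F
      = w ^ m / m.factorial * ((∫ z, z ^ m ∂F : ℝ) : ℂ) := by
    intro m
    rw [← integral_complex_ofReal, ← integral_const_mul]
    congr with z
    push_cast
    ring
  have hint : ∀ m, Integrable (fun z : ℝ => (w * z) ^ m / m.factorial) F := by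
    intro m
    have := ((h.integrable_pow m).ofReal (𝕜 := ℂ)).const_mul (w ^ m / m.factorial)
    refine this.congr (ae_of_all _ fun z => ?_)
    push_cast
    simp only [Complex.coe_algebraMap]
    ring
  have hE : complexMGF id F w = ∫ z : ℝ, Complex.exp (w * z) ∂F := rfl
  rw [hE]
  simp_rw [← hterm]
  rw [← integral_finsetSum _ fun m _ => hint m,
    ← integral_sub (h.integrable_cexp w) (integrable_finsetSum _ fun m _ => hint m),
    ← integral_const_mul]
  refine norm_integral_le_of_norm_le ((h.integrable_abs_pow_mul_exp n).const_mul _)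
    (ae_of_all _ fun z => (Complex.norm_exp_sub_sum_le_norm_mul_exp _ n).trans ?_)
  rw [norm_mul, Complex.norm_real, Real.norm_eq_abs, mul_pow, mul_assoc]
  gcongr
  exact mul_le_of_le_one_left (abs_nonneg z) hw

lemma noiseVariance_nonneg (F : Measure ℝ) : 0 ≤ noiseVariance F :=
  integral_nonneg fun z => sq_nonneg z

/-- If the first moments of `F` are Gaussian, its moment generating function is close to the
Gaussian one near the origin. -/
theorem MatchesGaussianMoments.exists_complexMGF_bound [IsProbabilityMeasure F]
    (h : HasExponentialMoments F) {κ : ℕ} (hm : MatchesGaussianMoments F κ) :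
    ∃ C : ℝ, 0 ≤ C ∧ ∀ w : ℂ, ‖w‖ ≤ 1 →
      ‖complexMGF id F w * Complex.exp (-(noiseVariance F * w ^ 2 / 2)) - 1‖
        ≤ C * ‖w‖ ^ (κ + 1) := by
  set v := (noiseVariance F).toNNReal with hv
  have hvr : ((v : ℝ) : ℂ) = (noiseVariance F : ℂ) := by
    rw [hv, Real.coe_toNNReal _ (noiseVariance_nonneg F)]
  have hG := hasExponentialMoments_gaussianReal v
  set A := ∫ z, |z| ^ (κ + 1) * Real.exp |z| ∂F
  set A' := ∫ z, |z| ^ (κ + 1) * Real.exp |z| ∂(gaussianReal 0 v)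
  have hA : 0 ≤ A := integral_nonneg fun z => by positivity
  have hA' : 0 ≤ A' := integral_nonneg fun z => by positivity
  refine ⟨(A + A') * Real.exp (noiseVariance F), by positivity, fun w hw => ?_⟩
  have hmoments : ∀ m ∈ Finset.range (κ + 1), w ^ m / m.factorial * ((∫ z, z ^ m ∂F : ℝ) : ℂ)
      = w ^ m / m.factorial * ((∫ z, z ^ m ∂(gaussianReal 0 v) : ℝ) : ℂ) := by
    intro m hmem
    rcases Nat.eq_zero_or_pos m with rfl | hpos
    · simp
    · rw [hm m hpos (Nat.lt_succ_iff.mp (Finset.mem_range.mp hmem))]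
  have h1 := h.norm_complexMGF_sub_sum_le (κ + 1) hw
  have h2 := hG.norm_complexMGF_sub_sum_le (κ + 1) hw
  rw [Finset.sum_congr rfl hmoments] at h1
  have h3 : ‖complexMGF id F w - complexMGF id (gaussianReal 0 v) w‖
      ≤ ‖w‖ ^ (κ + 1) * (A + A') := by
    rw [mul_add]
    refine le_trans ?_ (add_le_add h1 h2)
    rw [← norm_neg (complexMGF id (gaussianReal 0 v) w - _)]
    refine le_trans (le_of_eq ?_) (norm_add_le _ _)
    congr 1
    ring
  have h4 : complexMGF id (gaussianReal 0 v) w = Complex.exp (noiseVariance F * w ^ 2 / 2) := by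
    rw [complexMGF_id_gaussianReal]
    congr 1
    rw [← hvr]
    simp
  have h5 : complexMGF id F w * Complex.exp (-(noiseVariance F * w ^ 2 / 2)) - 1
      = (complexMGF id F w - complexMGF id (gaussianReal 0 v) w)
        * Complex.exp (-(noiseVariance F * w ^ 2 / 2)) := by
    rw [sub_mul, h4, ← Complex.exp_add, add_neg_cancel, Complex.exp_zero]
  have h6 : ‖Complex.exp (-(noiseVariance F * w ^ 2 / 2))‖ ≤ Real.exp (noiseVariance F) := by
    refine (Complex.norm_exp_le_exp_norm _).trans (Real.exp_le_exp.mpr ?_)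
    rw [norm_neg, norm_div, norm_mul, norm_pow, Complex.norm_real,
      Real.norm_of_nonneg (noiseVariance_nonneg F)]
    have : ‖w‖ ^ 2 ≤ 1 := pow_le_one₀ (norm_nonneg _) hw
    have := noiseVariance_nonneg F
    simp only [Complex.norm_ofNat]
    nlinarith
  rw [h5, norm_mul]
  calc _ ≤ ‖w‖ ^ (κ + 1) * (A + A') * Real.exp (noiseVariance F) := by gcongr
    _ = _ := by ring

lemma HasExponentialMoments.noiseVariance_pos [IsProbabilityMeasure F]
    (h : HasExponentialMoments F) (hF : ∀ c, F ≠ Measure.dirac c) : 0 < noiseVariance F := by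
  refine (noiseVariance_nonneg F).lt_of_ne fun h0 => hF 0 ?_
  have h1 : (fun z : ℝ => z ^ 2) =ᵐ[F] 0 :=
    (integral_eq_zero_iff_of_nonneg (fun z => sq_nonneg z) (h.integrable_pow 2)).mp h0.symm
  have h2 : (id : ℝ → ℝ) =ᵐ[F] fun _ => 0 := by
    filter_upwards [h1] with z hz
    simpa using hz
  rw [← Measure.map_id (μ := F), Measure.map_congr h2, Measure.map_const]
  simp

lemma MatchesGaussianMoments.integral_eq_zero {κ : ℕ} (hm : MatchesGaussianMoments F κ)
    (hκ : 1 ≤ κ) : ∫ z, z ∂F = 0 := by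
  have := hm 1 le_rfl hκ
  simpa using this

lemma div_lt_kappa (α : ℝ) : (4 * α - 1) / (2 - 2 * α) < (kappa α : ℝ) :=
  Nat.sInf_mem (s := {k : ℕ | (4 * α - 1) / (2 - 2 * α) < (k : ℝ)})
    ((exists_nat_gt ((4 * α - 1) / (2 - 2 * α))).imp fun _ hk => hk)

lemma two_le_kappa {α : ℝ} (h₀ : 1 / 2 < α) (h₁ : α < 1) : 2 ≤ kappa α := by
  have h := div_lt_kappa α
  have h2 : 1 < (4 * α - 1) / (2 - 2 * α) := by
    rw [lt_div_iff₀ (by linarith)]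
    linarith
  exact_mod_cast h2.trans h

/-- The definition gives κ(1-α) > 2α - 1/2 > α. In the equivalent form (1-α)(κ-1) > 2α - 1 this says
that the errors of the Gaussian approximation, of order n^{(2α-1)-(1-α)(κ-1)}, vanish. -/
lemma lt_kappa_mul {α : ℝ} (h₀ : 1 / 2 < α) (h₁ : α < 1) : α < (kappa α : ℝ) * (1 - α) := by
  have h := div_lt_kappa α
  rw [div_lt_iff₀ (by linarith)] at h
  linarith

end Noise

/-! ### Sums of regularly varying sequences -/

lemma tendsto_rpow_succ_sub_div {p : ℝ} :
    Tendsto (fun k : ℕ => (((k : ℝ) + 1) ^ (p + 1) - (k : ℝ) ^ (p + 1)) / (k : ℝ) ^ p) atTop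
      (𝓝 (p + 1)) := by
  have h1 : HasDerivAt (fun x : ℝ => x ^ (p + 1)) (p + 1) 1 := by
    simpa using Real.hasDerivAt_rpow_const (x := 1) (p := p + 1) (Or.inl one_ne_zero)
  have h2 := h1.tendsto_slope_zero
  have h3 : Tendsto (fun k : ℕ => ((k : ℝ))⁻¹) atTop (𝓝[≠] 0) := by
    refine tendsto_nhdsWithin_iff.mpr ⟨tendsto_inv_atTop_nhds_zero_nat, ?_⟩
    filter_upwards [eventually_gt_atTop 0] with k hk
    simpa using hk.ne'
  refine (h2.comp h3).congr' ?_
  filter_upwards [eventually_gt_atTop 0] with k hk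
  have hk' : (0 : ℝ) < k := by exact_mod_cast hk
  have h4 : (k : ℝ) + 1 = k * (1 + (k : ℝ)⁻¹) := by field_simp
  simp only [Function.comp, inv_inv, smul_eq_mul, Real.one_rpow]
  rw [h4, Real.mul_rpow hk'.le (by positivity), Real.rpow_add hk', Real.rpow_one]
  have : (k : ℝ) ^ p ≠ 0 := (Real.rpow_pos_of_pos hk' p).ne'
  field_simp

/-- Karamata's theorem for sums of sequences which are asymptotically powers. -/
theorem tendsto_sum_range_div_rpow {f : ℕ → ℝ} {c p : ℝ} (hp : -1 < p)
    (hf : Tendsto (fun k : ℕ => f k / (k : ℝ) ^ p) atTop (𝓝 c)) :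
    Tendsto (fun n : ℕ => (∑ k ∈ Finset.range n, f k) / (n : ℝ) ^ (p + 1)) atTop
      (𝓝 (c / (p + 1))) := by
  have hp1 : 0 < p + 1 := by linarith
  -- The comparison sequence g has telescoping partial sums n^{p+1} and is asymptotic to (p+1)k^p.
  -- Hence f - (c/(p+1)) g is o(g), and this passes to partial sums because those of g diverge.
  set g : ℕ → ℝ := fun k => ((k : ℝ) + 1) ^ (p + 1) - (k : ℝ) ^ (p + 1) with hg
  have hg0 : 0 ≤ g := fun k => sub_nonneg.mpr
    (Real.rpow_le_rpow (Nat.cast_nonneg k) (by linarith) hp1.le)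
  have hsum : ∀ n : ℕ, ∑ k ∈ Finset.range n, g k = (n : ℝ) ^ (p + 1) := by
    intro n
    have := Finset.sum_range_sub (fun k : ℕ => (k : ℝ) ^ (p + 1)) n
    simpa [hg, Real.zero_rpow hp1.ne'] using this
  have hlim : Tendsto (fun k : ℕ => (f k - c / (p + 1) * g k) / g k) atTop (𝓝 0) := by
    have h1 := (hf.div tendsto_rpow_succ_sub_div hp1.ne').sub_const (c / (p + 1))
    rw [sub_self] at h1
    refine h1.congr' ?_
    filter_upwards [eventually_gt_atTop 0] with k hk
    have hk' : (0 : ℝ) < k := by exact_mod_cast hk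
    have h2 : (k : ℝ) ^ p ≠ 0 := (Real.rpow_pos_of_pos hk' p).ne'
    have h3 : 0 < g k := sub_pos.mpr
      (Real.rpow_lt_rpow (Nat.cast_nonneg k) (by linarith) hp1)
    have h3' : ((k : ℝ) + 1) ^ (p + 1) - (k : ℝ) ^ (p + 1) ≠ 0 := h3.ne'
    simp only [Pi.div_apply, hg]
    field_simp
  have hlo : (fun k => f k - c / (p + 1) * g k) =o[atTop] g := by
    refine (isLittleO_iff_tendsto' ?_).mpr hlim
    filter_upwards with k hk
    have h3 : 0 < g k := sub_pos.mpr
      (Real.rpow_lt_rpow (Nat.cast_nonneg k) (by linarith) hp1)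
    exact absurd hk h3.ne'
  have htop : Tendsto (fun n => ∑ i ∈ Finset.range n, g i) atTop atTop := by
    simp_rw [hsum]
    exact (tendsto_rpow_atTop hp1).comp tendsto_natCast_atTop_atTop
  have h1 := (hlo.sum_range hg0 htop).tendsto_div_nhds_zero
  simp_rw [hsum, Finset.sum_sub_distrib, ← Finset.mul_sum, hsum] at h1
  have h2 := h1.add_const (c / (p + 1))
  rw [zero_add] at h2
  refine h2.congr' ?_
  filter_upwards [eventually_gt_atTop 0] with n hn
  have hn' : (0 : ℝ) < n := by exact_mod_cast hn
  have h2 : (n : ℝ) ^ (p + 1) ≠ 0 := (Real.rpow_pos_of_pos hn' _).ne'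
  field_simp
  ring

/-! ### A Beta integral -/

lemma lintegral_rpow_mul_exp_neg_mul {a r : ℝ} (ha : 0 < a) (hr : 0 < r) :
    ∫⁻ t in Set.Ioi (0 : ℝ), ENNReal.ofReal (t ^ (a - 1) * Real.exp (-(r * t)))
      = ENNReal.ofReal ((1 / r) ^ a * Real.Gamma a) := by
  have h := Real.integral_rpow_mul_exp_neg_mul_Ioi ha hr
  have hpos : 0 < (1 / r) ^ a * Real.Gamma a :=
    mul_pos (Real.rpow_pos_of_pos (by positivity) _) (Real.Gamma_pos_of_pos ha)
  -- Integrability follows from the value: a non-integrable function would have integral 0, while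
  -- the Gamma value is positive.
  have hint : IntegrableOn (fun t : ℝ => t ^ (a - 1) * Real.exp (-(r * t))) (Set.Ioi 0) := by
    by_contra hcon
    rw [integral_undef hcon] at h
    exact hpos.ne h
  rw [← h, ofReal_integral_eq_lintegral_ofReal hint]
  filter_upwards [ae_restrict_mem measurableSet_Ioi] with t ht
  exact mul_nonneg (Real.rpow_nonneg (le_of_lt ht) _) (Real.exp_pos _).le

/-- Replace Γ(α)(1+x)^{-α} by ∫ t^{α-1}e^{-(1+x)t} dt and exchange the integrals; two further Gamma
integrals give Γ(1-α)Γ(2α-1). The lower integral is used so that finiteness, hence integrability,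
comes with the value. -/
theorem lintegral_rpow_mul_one_add_rpow {α : ℝ} (h₀ : 1 / 2 < α) (h₁ : α < 1) :
    ∫⁻ x in Set.Ioi (0 : ℝ), ENNReal.ofReal (x ^ (-α) * (1 + x) ^ (-α))
      = ENNReal.ofReal (ProbabilityTheory.beta (1 - α) (2 * α - 1)) := by
  have hα : 0 < α := by linarith
  have hΓ : 0 < Real.Gamma α := Real.Gamma_pos_of_pos hα
  set μ := volume.restrict (Set.Ioi (0 : ℝ)) with hμ
  have hmem : ∀ᵐ x ∂μ, 0 < x := ae_restrict_mem measurableSet_Ioi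
  have e1 : ENNReal.ofReal (Real.Gamma α) *
      ∫⁻ x, ENNReal.ofReal (x ^ (-α) * (1 + x) ^ (-α)) ∂μ
      = ∫⁻ x, ∫⁻ t, ENNReal.ofReal (x ^ (-α)) *
          ENNReal.ofReal (t ^ (α - 1) * Real.exp (-((1 + x) * t))) ∂μ ∂μ := by
    rw [← lintegral_const_mul _ (by fun_prop)]
    refine lintegral_congr_ae ?_
    filter_upwards [hmem] with x hx
    rw [lintegral_const_mul _ (by fun_prop), lintegral_rpow_mul_exp_neg_mul hα (by linarith),
      ← ENNReal.ofReal_mul hΓ.le, ← ENNReal.ofReal_mul (Real.rpow_nonneg hx.le _)]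
    congr 1
    rw [one_div, Real.inv_rpow (by linarith), Real.rpow_neg (by linarith : 0 ≤ 1 + x)]
    ring
  have e2 : ∫⁻ x, ∫⁻ t, ENNReal.ofReal (x ^ (-α)) *
          ENNReal.ofReal (t ^ (α - 1) * Real.exp (-((1 + x) * t))) ∂μ ∂μ
      = ∫⁻ t, ∫⁻ x, ENNReal.ofReal (x ^ (-α)) *
          ENNReal.ofReal (t ^ (α - 1) * Real.exp (-((1 + x) * t))) ∂μ ∂μ :=
    lintegral_lintegral_swap (by fun_prop)
  have e3 : ∫⁻ t, ∫⁻ x, ENNReal.ofReal (x ^ (-α)) *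
          ENNReal.ofReal (t ^ (α - 1) * Real.exp (-((1 + x) * t))) ∂μ ∂μ
      = ∫⁻ t, ENNReal.ofReal (Real.Gamma (1 - α)) *
          ENNReal.ofReal (t ^ ((2 * α - 1) - 1) * Real.exp (-(1 * t))) ∂μ := by
    refine lintegral_congr_ae ?_
    filter_upwards [hmem] with t ht
    have : ∀ᵐ x ∂μ, ENNReal.ofReal (x ^ (-α)) *
          ENNReal.ofReal (t ^ (α - 1) * Real.exp (-((1 + x) * t)))
        = ENNReal.ofReal (t ^ (α - 1) * Real.exp (-t)) *
          ENNReal.ofReal (x ^ ((1 - α) - 1) * Real.exp (-(t * x))) := by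
      filter_upwards [hmem] with x hx
      rw [← ENNReal.ofReal_mul (Real.rpow_nonneg hx.le _), ← ENNReal.ofReal_mul
        (mul_nonneg (Real.rpow_nonneg ht.le _) (Real.exp_pos _).le)]
      congr 1
      have : Real.exp (-((1 + x) * t)) = Real.exp (-t) * Real.exp (-(t * x)) := by
        rw [← Real.exp_add]; ring_nf
      rw [this]
      ring_nf
    rw [lintegral_congr_ae this, lintegral_const_mul _ (by fun_prop),
      lintegral_rpow_mul_exp_neg_mul (by linarith) ht, ← ENNReal.ofReal_mul
        (mul_nonneg (Real.rpow_nonneg ht.le _) (Real.exp_pos _).le),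
      ← ENNReal.ofReal_mul (Real.Gamma_pos_of_pos (by linarith)).le]
    congr 1
    have : t ^ ((2 * α - 1) - 1) = t ^ (α - 1) * (1 / t) ^ (1 - α) := by
      rw [one_div, Real.inv_rpow ht.le, ← Real.rpow_neg ht.le, ← Real.rpow_add ht]
      ring_nf
    rw [this]
    ring_nf
  have e4 : ∫⁻ t, ENNReal.ofReal (Real.Gamma (1 - α)) *
          ENNReal.ofReal (t ^ ((2 * α - 1) - 1) * Real.exp (-(1 * t))) ∂μ
      = ENNReal.ofReal (Real.Gamma α) *
        ENNReal.ofReal (ProbabilityTheory.beta (1 - α) (2 * α - 1)) := by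
    rw [lintegral_const_mul _ (by fun_prop), lintegral_rpow_mul_exp_neg_mul (by linarith) one_pos,
      ← ENNReal.ofReal_mul (Real.Gamma_pos_of_pos (by linarith)).le, ← ENNReal.ofReal_mul hΓ.le]
    congr 1
    rw [ProbabilityTheory.beta, show (1 - α) + (2 * α - 1) = α by ring]
    field_simp
    simp
  have h := e1.trans (e2.trans (e3.trans e4))
  exact (ENNReal.mul_right_inj (by simpa using hΓ) ENNReal.ofReal_ne_top).mp h

/-! ### Coefficients and their autocovariances -/

section Coefficients

variable {a : ℕ → ℝ} {α : ℝ}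

lemma IsPowerType.tendsto_mul_rpow (ha : IsPowerType a α) :
    Tendsto (fun n : ℕ => (n : ℝ) ^ α * a n) atTop (𝓝 1) := by
  have h := (isEquivalent_iff_tendsto_one (by
    filter_upwards [eventually_gt_atTop 0] with n hn
    exact (Real.rpow_pos_of_pos (by exact_mod_cast hn) _).ne')).mp ha.1
  refine h.congr' ?_
  filter_upwards [eventually_gt_atTop 0] with n hn
  rw [Pi.div_apply, Real.rpow_neg (Nat.cast_nonneg n), div_inv_eq_mul, mul_comm]

lemma IsPowerType.exists_abs_le (ha : IsPowerType a α) :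
    ∃ K : ℝ, 0 < K ∧ ∀ l : ℕ, |a l| ≤ K * ((l : ℝ) + 1) ^ (-α) := by
  have h2 : Tendsto (fun n : ℕ => (((n : ℝ) + 1) / n) ^ α) atTop (𝓝 1) := by
    have : Tendsto (fun n : ℕ => ((n : ℝ) + 1) / n) atTop (𝓝 1) := by
      have := (tendsto_inv_atTop_nhds_zero_nat (𝕜 := ℝ)).const_add 1
      rw [add_zero] at this
      refine this.congr' ?_
      filter_upwards [eventually_gt_atTop 0] with n hn
      have : (n : ℝ) ≠ 0 := by exact_mod_cast hn.ne'
      field_simp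
    simpa using this.rpow_const (p := α) (Or.inl one_ne_zero)
  have h3 : Tendsto (fun n : ℕ => a n / ((n : ℝ) + 1) ^ (-α)) atTop (𝓝 1) := by
    have := ha.tendsto_mul_rpow.mul h2
    rw [one_mul] at this
    refine this.congr' ?_
    filter_upwards [eventually_gt_atTop 0] with n hn
    have hn' : (0 : ℝ) < n := by exact_mod_cast hn
    rw [Real.div_rpow (by positivity) hn'.le, Real.rpow_neg (by positivity)]
    have := (Real.rpow_pos_of_pos hn' α).ne'
    field_simp
  obtain ⟨K, hK⟩ := h3.abs.bddAbove_range
  refine ⟨max K 1, by positivity, fun l => ?_⟩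
  have hl : (0 : ℝ) < ((l : ℝ) + 1) ^ (-α) := Real.rpow_pos_of_pos (by positivity) _
  have := hK ⟨l, rfl⟩
  simp only [abs_div, abs_of_pos hl] at this
  rw [div_le_iff₀ hl] at this
  exact this.trans (by gcongr; exact le_max_left _ _)

lemma IsPowerType.summable_sq (ha : IsPowerType a α) (h₀ : 1 / 2 < α) :
    Summable fun l => a l ^ 2 := by
  obtain ⟨K, hK, h⟩ := ha.exists_abs_le
  have hs : Summable fun l : ℕ => K ^ 2 * (((l + 1 : ℕ) : ℝ) ^ (-(2 * α))) :=
    ((summable_nat_add_iff 1).mpr (Real.summable_nat_rpow.mpr (by linarith))).mul_left _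
  refine hs.of_nonneg_of_le (fun l => sq_nonneg _) fun l => ?_
  have h1 : a l ^ 2 ≤ (K * ((l : ℝ) + 1) ^ (-α)) ^ 2 := by
    rw [← sq_abs]; gcongr; exact h l
  refine h1.trans (le_of_eq ?_)
  rw [mul_pow, ← Real.rpow_natCast (((l : ℝ) + 1) ^ (-α)), ← Real.rpow_mul (by positivity)]
  push_cast
  ring_nf

/-- `r(k) = ∑_l a_l a_{l+k}`. -/
noncomputable def autocov (a : ℕ → ℝ) (k : ℕ) : ℝ := ∑' l, a l * a (l + k)

lemma summable_autocov (ha : Summable fun l => a l ^ 2) (k : ℕ) :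
    Summable fun l => a l * a (l + k) := by
  refine Summable.of_norm_bounded (ha.add ((summable_nat_add_iff k).mpr ha)) fun l => ?_
  rw [Real.norm_eq_abs, abs_mul, ← sq_abs (a l), ← sq_abs (a (l + k))]
  nlinarith [sq_nonneg (|a l| - |a (l + k)|), abs_nonneg (a l), abs_nonneg (a (l + k))]

/-- A sum as the integral of a step function with steps of length `1 / k`. -/
lemma integral_floor_mul {f : ℕ → ℝ} (hf : Summable f) {k : ℕ} (hk : 0 < k) :
    (k : ℝ) * ∫ x in Set.Ioi (0 : ℝ), f ⌊(k : ℝ) * x⌋₊ = ∑' l, f l := by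
  have hk' : (0 : ℝ) < k := by exact_mod_cast hk
  set s : ℕ → Set ℝ := fun l => Set.Ico ((l : ℝ) / k) ((l + 1 : ℝ) / k) with hs
  have hfloor : ∀ l, ∀ x ∈ s l, ⌊(k : ℝ) * x⌋₊ = l := by
    intro l x hx
    have hx1 := (div_le_iff₀' hk').mp hx.1
    have hx2 := (lt_div_iff₀' hk').mp hx.2
    exact (Nat.floor_eq_iff ((Nat.cast_nonneg l).trans hx1)).mpr ⟨hx1, hx2⟩
  have hunion : ⋃ l, s l = Set.Ici (0 : ℝ) := by
    ext x
    simp only [Set.mem_iUnion, Set.mem_Ici]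
    refine ⟨fun ⟨l, hl⟩ => le_trans (by positivity) hl.1, fun hx => ⟨⌊(k : ℝ) * x⌋₊, ?_, ?_⟩⟩
    · rw [div_le_iff₀' hk']; exact Nat.floor_le (by positivity)
    · rw [lt_div_iff₀' hk']; exact Nat.lt_floor_add_one _
  have hdisj : Pairwise (Function.onFun Disjoint s) := by
    intro l l' hll
    refine Set.disjoint_left.mpr fun x hx hx' => hll ?_
    rw [← hfloor l x hx, hfloor l' x hx']
  have hpiece : ∀ l, ∫ x in s l, f ⌊(k : ℝ) * x⌋₊ = (k : ℝ)⁻¹ * f l := by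
    intro l
    rw [setIntegral_congr_fun measurableSet_Ico (fun x hx => by
      rw [hfloor l x hx]), setIntegral_const]
    rw [measureReal_def, Real.volume_Ico, ENNReal.toReal_ofReal (by
      rw [← sub_div]; simp [hk'.le]), smul_eq_mul]
    congr 1
    field_simp
    ring
  have hpiece' : ∀ l, ∫ x in s l, ‖f ⌊(k : ℝ) * x⌋₊‖ = (k : ℝ)⁻¹ * ‖f l‖ := by
    intro l
    rw [setIntegral_congr_fun measurableSet_Ico (fun x hx => by
      rw [hfloor l x hx]), setIntegral_const]
    rw [measureReal_def, Real.volume_Ico, ENNReal.toReal_ofReal (by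
      rw [← sub_div]; simp [hk'.le]), smul_eq_mul]
    congr 1
    field_simp
    ring
  have hint : ∀ l, IntegrableOn (fun x : ℝ => f ⌊(k : ℝ) * x⌋₊) (s l) := by
    intro l
    refine (integrableOn_const (C := f l) (by simp [hs])).congr_fun (fun x hx => ?_)
      measurableSet_Ico
    rw [hfloor l x hx]
  have hIon : IntegrableOn (fun x : ℝ => f ⌊(k : ℝ) * x⌋₊) (⋃ l, s l) := by
    refine integrableOn_iUnion_of_summable_integral_norm hint ?_
    simp_rw [hpiece']
    exact hf.norm.mul_left _
  have := integral_iUnion (fun l => (measurableSet_Ico : MeasurableSet (s l))) hdisj hIon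
  rw [hunion, integral_Ici_eq_integral_Ioi] at this
  rw [this, tsum_congr hpiece, tsum_mul_left, ← mul_assoc, mul_inv_cancel₀ hk'.ne', one_mul]

lemma tendsto_floor_mul_atTop {x : ℝ} (hx : 0 < x) :
    Tendsto (fun k : ℕ => ⌊(k : ℝ) * x⌋₊) atTop atTop :=
  tendsto_nat_floor_atTop.comp (tendsto_natCast_atTop_atTop.atTop_mul_const hx)

lemma tendsto_floor_mul_div {x : ℝ} (hx : 0 ≤ x) :
    Tendsto (fun k : ℕ => (⌊(k : ℝ) * x⌋₊ : ℝ) / k) atTop (𝓝 x) := by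
  have h := (tendsto_nat_floor_mul_div_atTop (R := ℝ) hx).comp tendsto_natCast_atTop_atTop
  refine h.congr fun k => ?_
  simp [mul_comm]

/-- The sum r(k) is k times the integral of a(⌊kx⌋)a(⌊kx⌋+k) over x > 0. Multiplied by k^{2α}, the
integrand tends to x^{-α}(1+x)^{-α} and is dominated by a multiple of it, so the limit is the Beta
integral above. -/
theorem IsPowerType.tendsto_autocov (ha : IsPowerType a α) (h₀ : 1 / 2 < α) (h₁ : α < 1) :
    Tendsto (fun k : ℕ => autocov a k / (k : ℝ) ^ (1 - 2 * α)) atTop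
      (𝓝 (ProbabilityTheory.beta (1 - α) (2 * α - 1))) := by
  obtain ⟨K, hK, hb⟩ := ha.exists_abs_le
  have hα : 0 < α := by linarith
  set g : ℝ → ℝ := fun x => x ^ (-α) * (1 + x) ^ (-α) with hg
  have hgnn : 0 ≤ᵐ[volume.restrict (Set.Ioi (0 : ℝ))] g := by
    filter_upwards [ae_restrict_mem measurableSet_Ioi] with x hx
    have hx : (0 : ℝ) < x := hx
    exact mul_nonneg (Real.rpow_nonneg hx.le _) (Real.rpow_nonneg (by linarith) _)
  have hgm : Measurable g := by fun_prop
  have hlg := lintegral_rpow_mul_one_add_rpow h₀ h₁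
  have hgint : Integrable g (volume.restrict (Set.Ioi (0 : ℝ))) := by
    refine ⟨hgm.aestronglyMeasurable, ?_⟩
    rw [hasFiniteIntegral_iff_ofReal hgnn, hlg]
    exact ENNReal.ofReal_lt_top
  have hgval : ∫ x in Set.Ioi (0 : ℝ), g x = ProbabilityTheory.beta (1 - α) (2 * α - 1) := by
    rw [integral_eq_lintegral_of_nonneg_ae hgnn hgm.aestronglyMeasurable, hlg,
      ENNReal.toReal_ofReal (beta_pos (by linarith) (by linarith)).le]
  rw [← hgval]
  set f : ℕ → ℝ → ℝ := fun k x =>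
    (k : ℝ) ^ (2 * α) * (a ⌊(k : ℝ) * x⌋₊ * a (⌊(k : ℝ) * x⌋₊ + k)) with hf
  have hlim : Tendsto (fun k : ℕ => ∫ x in Set.Ioi (0 : ℝ), f k x) atTop
      (𝓝 (∫ x in Set.Ioi (0 : ℝ), g x)) := by
    refine tendsto_integral_filter_of_dominated_convergence (fun x => K ^ 2 * g x) ?_ ?_
      (hgint.const_mul _) ?_
    · refine Eventually.of_forall fun k => Measurable.aestronglyMeasurable ?_
      have hfl : Measurable fun x : ℝ => ⌊(k : ℝ) * x⌋₊ :=
        Nat.measurable_floor.comp (measurable_const_mul _)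
      have h1 : Measurable fun x : ℝ => a ⌊(k : ℝ) * x⌋₊ := (measurable_from_nat (f := a)).comp hfl
      have h2 : Measurable fun x : ℝ => a (⌊(k : ℝ) * x⌋₊ + k) :=
        (measurable_from_nat (f := fun i => a (i + k))).comp hfl
      exact (h1.mul h2).const_mul _
    · filter_upwards [eventually_gt_atTop 0] with k hk
      have hk' : (0 : ℝ) < k := by exact_mod_cast hk
      filter_upwards [ae_restrict_mem measurableSet_Ioi] with x hx
      have hx : (0 : ℝ) < x := hx
      -- The bound on a_l is in terms of l + 1, and ⌊kx⌋ + 1 ≥ kx, so the domination remains valid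
      -- for x < 1/k, where ⌊kx⌋ = 0.
      have hfl : (k : ℝ) * x ≤ (⌊(k : ℝ) * x⌋₊ : ℝ) + 1 := (Nat.lt_floor_add_one _).le
      have b1 : |a ⌊(k : ℝ) * x⌋₊| ≤ K * ((k : ℝ) ^ (-α) * x ^ (-α)) := by
        refine (hb _).trans ?_
        rw [← Real.mul_rpow hk'.le hx.le]
        exact mul_le_mul_of_nonneg_left
          (Real.rpow_le_rpow_of_nonpos (by positivity) hfl (by linarith)) hK.le
      have b2 : |a (⌊(k : ℝ) * x⌋₊ + k)| ≤ K * ((k : ℝ) ^ (-α) * (1 + x) ^ (-α)) := by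
        refine (hb _).trans ?_
        rw [← Real.mul_rpow hk'.le (by linarith)]
        refine mul_le_mul_of_nonneg_left
          (Real.rpow_le_rpow_of_nonpos (by positivity) ?_ (by linarith)) hK.le
        push_cast
        linarith
      have hkk : (k : ℝ) ^ (2 * α) * ((k : ℝ) ^ (-α) * (k : ℝ) ^ (-α)) = 1 := by
        rw [← Real.rpow_add hk', ← Real.rpow_add hk']
        ring_nf
        exact Real.rpow_zero _
      rw [hf, Real.norm_eq_abs, abs_mul, abs_mul, abs_of_nonneg (Real.rpow_nonneg hk'.le _)]
      calc (k : ℝ) ^ (2 * α) * (|a ⌊(k : ℝ) * x⌋₊| * |a (⌊(k : ℝ) * x⌋₊ + k)|)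
          ≤ (k : ℝ) ^ (2 * α) * (K * ((k : ℝ) ^ (-α) * x ^ (-α)) *
              (K * ((k : ℝ) ^ (-α) * (1 + x) ^ (-α)))) := by gcongr
        _ = K ^ 2 * g x * ((k : ℝ) ^ (2 * α) * ((k : ℝ) ^ (-α) * (k : ℝ) ^ (-α))) := by
            simp only [hg]; ring
        _ = K ^ 2 * g x := by rw [hkk, mul_one]
    · filter_upwards [ae_restrict_mem measurableSet_Ioi] with x hx
      have hx : (0 : ℝ) < x := hx
      have c1 := tendsto_floor_mul_atTop hx
      have c2 : Tendsto (fun k : ℕ => ⌊(k : ℝ) * x⌋₊ + k) atTop atTop :=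
        tendsto_atTop_mono (fun _ => Nat.le_add_left _ _) tendsto_id
      have d1 := ha.tendsto_mul_rpow.comp c1
      have d2 := ha.tendsto_mul_rpow.comp c2
      have e1 : Tendsto (fun k : ℕ => ((⌊(k : ℝ) * x⌋₊ : ℝ) / k) ^ (-α)) atTop (𝓝 (x ^ (-α))) :=
        (tendsto_floor_mul_div hx.le).rpow_const (Or.inl hx.ne')
      have e2 : Tendsto (fun k : ℕ => (1 + (⌊(k : ℝ) * x⌋₊ : ℝ) / k) ^ (-α)) atTop
          (𝓝 ((1 + x) ^ (-α))) :=
        ((tendsto_floor_mul_div hx.le).const_add 1).rpow_const (Or.inl (by linarith))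
      have := (d1.mul e1).mul (d2.mul e2)
      rw [one_mul, one_mul] at this
      refine this.congr' ?_
      filter_upwards [eventually_gt_atTop 0, c1.eventually_gt_atTop 0] with k hk hkx
      have hk' : (0 : ℝ) < k := by exact_mod_cast hk
      have hkx' : (0 : ℝ) < (⌊(k : ℝ) * x⌋₊ : ℝ) := by exact_mod_cast hkx
      simp only [Function.comp, hf]
      set m := ⌊(k : ℝ) * x⌋₊
      have s1 : (m : ℝ) ^ α * ((m : ℝ) / k) ^ (-α) = (k : ℝ) ^ α := by
        rw [Real.div_rpow hkx'.le hk'.le, Real.rpow_neg hkx'.le, Real.rpow_neg hk'.le]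
        have := (Real.rpow_pos_of_pos hk' α).ne'
        have := (Real.rpow_pos_of_pos hkx' α).ne'
        field_simp
      have s2 : ((m + k : ℕ) : ℝ) ^ α * (1 + (m : ℝ) / k) ^ (-α) = (k : ℝ) ^ α := by
        have : 1 + (m : ℝ) / k = ((m + k : ℕ) : ℝ) / k := by
          push_cast; field_simp; ring
        have hmk : (0 : ℝ) < ((m + k : ℕ) : ℝ) := by positivity
        rw [this, Real.div_rpow hmk.le hk'.le, Real.rpow_neg hmk.le, Real.rpow_neg hk'.le]
        have := (Real.rpow_pos_of_pos hk' α).ne'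
        have := (Real.rpow_pos_of_pos hmk α).ne'
        field_simp
      have s3 : (k : ℝ) ^ (2 * α) = (k : ℝ) ^ α * (k : ℝ) ^ α := by
        rw [← Real.rpow_add hk']; ring_nf
      calc _ = ((m : ℝ) ^ α * ((m : ℝ) / k) ^ (-α)) *
            (((m + k : ℕ) : ℝ) ^ α * (1 + (m : ℝ) / k) ^ (-α)) * (a m * a (m + k)) := by ring
        _ = _ := by rw [s1, s2, s3]
  refine hlim.congr' ?_
  filter_upwards [eventually_gt_atTop 0] with k hk
  have hk' : (0 : ℝ) < k := by exact_mod_cast hk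
  have h := integral_floor_mul (summable_autocov (ha.summable_sq h₀) k) hk
  rw [autocov, ← h, hf, integral_const_mul]
  have : (k : ℝ) ^ (1 - 2 * α) = k / (k : ℝ) ^ (2 * α) := by
    rw [Real.rpow_sub hk', Real.rpow_one]
  rw [this]
  have := (Real.rpow_pos_of_pos hk' (2 * α)).ne'
  field_simp

end Coefficients

/-! ### Coefficient vectors in `ℓ²(ℤ)` -/

/-- The Hilbert space `ℓ²(ℤ)`. -/
abbrev ell2 : Type := lp (fun _ : ℤ => ℝ) 2

/-- The coefficient of `Z_k` in `X_i`. -/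
def shiftCoeff (a : ℕ → ℝ) (i : ℕ) (k : ℤ) : ℝ := if k ≤ i then a ((i : ℤ) - k).toNat else 0

open Classical in
/-- The coefficients of `X_i` as an element of `ℓ²(ℤ)` (zero if they are not square summable). -/
noncomputable def coeffVec (a : ℕ → ℝ) (i : ℕ) : ell2 :=
  if h : Memℓp (shiftCoeff a i) 2 then ⟨shiftCoeff a i, h⟩ else 0

/-- The coefficients of `X_j + ⋯ + X_{n+j-1}`. -/
noncomputable def blockVec (a : ℕ → ℝ) (j n : ℕ) : ell2 := ∑ i ∈ Finset.Ico j (n + j), coeffVec a i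

section Vectors

variable {a : ℕ → ℝ} {α : ℝ}

lemma shiftCoeff_sub (a : ℕ → ℝ) (i l : ℕ) : shiftCoeff a i ((i : ℤ) - l) = a l := by
  simp [shiftCoeff]

lemma shiftCoeff_sub_of_le (a : ℕ → ℝ) {i i' : ℕ} (h : i ≤ i') (l : ℕ) :
    shiftCoeff a i' ((i : ℤ) - l) = a (l + (i' - i)) := by
  rw [shiftCoeff, if_pos (by omega)]
  congr 1
  omega

lemma injective_sub_natCast (i : ℤ) : Function.Injective fun l : ℕ => i - (l : ℤ) := by
  intro l l' h
  simpa using h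

lemma support_subset_range {f : ℤ → ℝ} {i : ℕ} (hf : ∀ k : ℤ, (i : ℤ) < k → f k = 0) :
    Function.support f ⊆ Set.range fun l : ℕ => (i : ℤ) - (l : ℤ) := by
  intro k hk
  have : k ≤ i := not_lt.mp fun h => hk (hf k h)
  exact ⟨((i : ℤ) - k).toNat, by simp; omega⟩

lemma shiftCoeff_eq_zero {i : ℕ} {k : ℤ} (h : (i : ℤ) < k) : shiftCoeff a i k = 0 :=
  if_neg (not_le.mpr h)

lemma memℓp_shiftCoeff (ha : Summable fun l => a l ^ 2) (i : ℕ) : Memℓp (shiftCoeff a i) 2 := by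
  refine memℓp_gen ?_
  have h : ∀ k : ℤ, ‖shiftCoeff a i k‖ ^ (2 : ℝ≥0∞).toReal = shiftCoeff a i k ^ 2 := by
    intro k
    simp
  simp_rw [h]
  rw [← (injective_sub_natCast i).summable_iff]
  · simpa [Function.comp_def, shiftCoeff_sub] using ha
  · intro k hk
    by_contra h0
    exact hk (support_subset_range (f := fun k => shiftCoeff a i k ^ 2)
      (fun k hk => by simp [shiftCoeff_eq_zero hk]) h0)

lemma coeffVec_apply (ha : Summable fun l => a l ^ 2) (i : ℕ) (k : ℤ) :
    coeffVec a i k = shiftCoeff a i k := by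
  rw [coeffVec, dif_pos (memℓp_shiftCoeff ha i)]

lemma inner_coeffVec (ha : Summable fun l => a l ^ 2) {i i' : ℕ} (h : i ≤ i') :
    inner ℝ (coeffVec a i) (coeffVec a i') = autocov a (i' - i) := by
  rw [lp.inner_eq_tsum, autocov]
  simp_rw [coeffVec_apply ha]
  rw [← (injective_sub_natCast i).tsum_eq]
  · refine tsum_congr fun l => ?_
    rw [shiftCoeff_sub, shiftCoeff_sub_of_le a h]
    simp [mul_comm]
  · exact support_subset_range fun k hk => by simp [shiftCoeff_eq_zero hk]

lemma inner_coeffVec_add (ha : Summable fun l => a l ^ 2) (i i' s : ℕ) :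
    inner ℝ (coeffVec a (i + s)) (coeffVec a (i' + s)) = inner ℝ (coeffVec a i) (coeffVec a i') := by
  rcases le_total i i' with h | h
  · rw [inner_coeffVec ha h, inner_coeffVec ha (by omega), Nat.add_sub_add_right]
  · rw [real_inner_comm, inner_coeffVec ha (by omega), real_inner_comm, inner_coeffVec ha h,
      Nat.add_sub_add_right]

lemma blockVec_eq_sum_range (a : ℕ → ℝ) (j n : ℕ) :
    blockVec a j n = ∑ p ∈ Finset.range n, coeffVec a (j + p) := by
  rw [blockVec, Finset.sum_Ico_eq_sum_range, Nat.add_sub_cancel]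

lemma inner_blockVec (a : ℕ → ℝ) (i j n m : ℕ) :
    inner ℝ (blockVec a i n) (blockVec a j m) = ∑ p ∈ Finset.range n, ∑ q ∈ Finset.range m,
      inner ℝ (coeffVec a (i + p)) (coeffVec a (j + q)) := by
  rw [blockVec_eq_sum_range, blockVec_eq_sum_range, sum_inner]
  simp_rw [inner_sum]

lemma inner_blockVec_add (ha : Summable fun l => a l ^ 2) (i j s n m : ℕ) :
    inner ℝ (blockVec a (i + s) n) (blockVec a (j + s) m)
      = inner ℝ (blockVec a i n) (blockVec a j m) := by
  rw [inner_blockVec, inner_blockVec]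
  refine Finset.sum_congr rfl fun p _ => Finset.sum_congr rfl fun q _ => ?_
  rw [add_right_comm i, add_right_comm j, inner_coeffVec_add ha]

lemma norm_blockVec (ha : Summable fun l => a l ^ 2) (j n : ℕ) :
    ‖blockVec a j n‖ = ‖blockVec a 0 n‖ := by
  have h := inner_blockVec_add ha 0 0 j n n
  rw [Nat.zero_add, real_inner_self_eq_norm_sq, real_inner_self_eq_norm_sq] at h
  exact (pow_left_inj₀ (norm_nonneg _) (norm_nonneg _) two_ne_zero).mp h

/-- The overlap of the two blocks cancels. What remains are two blocks of length d, one at each end,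
so the size of an increment is governed by d and not by n. -/
lemma blockVec_sub (a : ℕ → ℝ) (i d n : ℕ) :
    blockVec a (i + d) n - blockVec a i n = blockVec a (i + n) d - blockVec a i d := by
  have h1 : blockVec a i n + blockVec a (i + n) d = ∑ p ∈ Finset.Ico i (i + n + d), coeffVec a p := by
    rw [blockVec, blockVec, add_comm n i, add_comm d (i + n)]
    exact Finset.sum_Ico_consecutive _ (by omega) (by omega)
  have h2 : blockVec a i d + blockVec a (i + d) n = ∑ p ∈ Finset.Ico i (i + n + d), coeffVec a p := by
    rw [blockVec, blockVec, add_comm d i, show n + (i + d) = i + n + d by omega]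
    exact Finset.sum_Ico_consecutive _ (by omega) (by omega)
  rw [sub_eq_sub_iff_add_eq_add, add_comm, h2, add_comm (blockVec a (i + n) d), h1]

/-- The first term is twice the variance of a block of length d and gives the limit. The inner
product belongs to two blocks at distance n and is negligible when d has order n^β. -/
lemma norm_blockVec_sub_sq (ha : Summable fun l => a l ^ 2) (i d n : ℕ) :
    ‖blockVec a (i + d) n - blockVec a i n‖ ^ 2
      = 2 * ‖blockVec a 0 d‖ ^ 2 - 2 * inner ℝ (blockVec a n d) (blockVec a 0 d) := by
  rw [blockVec_sub, norm_sub_sq_real, norm_blockVec ha (i + n), norm_blockVec ha i]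
  have := inner_blockVec_add ha n 0 i d d
  rw [zero_add, add_comm n i] at this
  rw [this]
  ring

lemma norm_blockVec_sub (ha : Summable fun l => a l ^ 2) (i d n : ℕ) :
    ‖blockVec a (i + d) n - blockVec a i n‖ = ‖blockVec a d n - blockVec a 0 n‖ := by
  have h := norm_blockVec_sub_sq ha 0 d n
  rw [zero_add, ← norm_blockVec_sub_sq ha i d n] at h
  exact (pow_left_inj₀ (norm_nonneg _) (norm_nonneg _) two_ne_zero).mp h.symm

lemma norm_blockVec_sub_le (ha : Summable fun l => a l ^ 2) (i d n : ℕ) :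
    ‖blockVec a (i + d) n - blockVec a i n‖ ≤ 2 * ‖blockVec a 0 d‖ := by
  rw [blockVec_sub]
  refine (norm_sub_le _ _).trans ?_
  rw [norm_blockVec ha (i + n), norm_blockVec ha i, two_mul]

lemma norm_blockVec_succ_sq (ha : Summable fun l => a l ^ 2) (n : ℕ) :
    ‖blockVec a 0 (n + 1)‖ ^ 2 = ‖blockVec a 0 n‖ ^ 2
      + (autocov a 0 + 2 * ∑ k ∈ Finset.range n, autocov a (k + 1)) := by
  have h1 : blockVec a 0 (n + 1) = blockVec a 0 n + coeffVec a n := by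
    rw [blockVec_eq_sum_range, blockVec_eq_sum_range, Finset.sum_range_succ, zero_add]
  have h2 : inner ℝ (blockVec a 0 n) (coeffVec a n) = ∑ k ∈ Finset.range n, autocov a (k + 1) := by
    rw [blockVec_eq_sum_range, sum_inner, ← Finset.sum_range_reflect]
    refine Finset.sum_congr rfl fun p hp => ?_
    have := Finset.mem_range.mp hp
    rw [inner_coeffVec ha (by omega)]
    congr 1
    omega
  have h3 : ‖coeffVec a n‖ ^ 2 = autocov a 0 := by
    rw [← real_inner_self_eq_norm_sq, inner_coeffVec ha le_rfl, Nat.sub_self]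
  rw [h1, norm_add_sq_real, h2, h3]
  ring

lemma norm_blockVec_sq (ha : Summable fun l => a l ^ 2) (n : ℕ) :
    ‖blockVec a 0 n‖ ^ 2 = ∑ m ∈ Finset.range n,
      (autocov a 0 + 2 * ∑ k ∈ Finset.range m, autocov a (k + 1)) := by
  induction n with
  | zero => simp [blockVec]
  | succ n ih => rw [norm_blockVec_succ_sq ha, ih, Finset.sum_range_succ]

/-- The variance of the partial sums of the moving average grows like `C_α n^{3-2α}`. -/
theorem IsPowerType.tendsto_norm_blockVec_sq (ha : IsPowerType a α) (h₀ : 1 / 2 < α) (h₁ : α < 1) :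
    Tendsto (fun n : ℕ => ‖blockVec a 0 n‖ ^ 2 / (n : ℝ) ^ (3 - 2 * α)) atTop
      (𝓝 (constC α)) := by
  set b := ProbabilityTheory.beta (1 - α) (2 * α - 1) with hb
  have hr := ha.tendsto_autocov h₀ h₁
  have hsum := tendsto_sum_range_div_rpow (by linarith) hr
  rw [show (1 - 2 * α) + 1 = 2 - 2 * α by ring, ← hb] at hsum
  have h0 : ∀ c : ℝ, Tendsto (fun m : ℕ => c / (m : ℝ) ^ (2 - 2 * α)) atTop (𝓝 0) := fun c =>
    tendsto_const_nhds.div_atTop ((tendsto_rpow_atTop (by linarith)).comp tendsto_natCast_atTop_atTop)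
  have hrm : Tendsto (fun m : ℕ => autocov a m / (m : ℝ) ^ (2 - 2 * α)) atTop (𝓝 0) := by
    have := hr.mul tendsto_inv_atTop_nhds_zero_nat
    rw [mul_zero] at this
    refine this.congr' ?_
    filter_upwards [eventually_gt_atTop 0] with m hm
    have hm' : (0 : ℝ) < m := by exact_mod_cast hm
    rw [show 2 - 2 * α = (1 - 2 * α) + 1 by ring, Real.rpow_add hm', Real.rpow_one]
    have := (Real.rpow_pos_of_pos hm' (1 - 2 * α)).ne'
    field_simp
  have hsum' : Tendsto (fun m : ℕ => (autocov a 0 + 2 * ∑ k ∈ Finset.range m, autocov a (k + 1))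
      / (m : ℝ) ^ (2 - 2 * α)) atTop (𝓝 (2 * (b / (2 - 2 * α)))) := by
    have := (h0 (-autocov a 0)).add ((hsum.add hrm).const_mul 2)
    rw [zero_add, add_zero] at this
    refine this.congr fun m => ?_
    -- The index shift removes r(0) and adds r(m); both are negligible compared with m^{2-2α}.
    have hs : ∑ k ∈ Finset.range m, autocov a (k + 1)
        = (∑ k ∈ Finset.range m, autocov a k) + autocov a m - autocov a 0 := by
      rw [← Finset.sum_range_succ, Finset.sum_range_succ']; ring
    rw [hs]
    ring
  have hV := tendsto_sum_range_div_rpow (by linarith) hsum'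
  simp_rw [← norm_blockVec_sq (ha.summable_sq h₀)] at hV
  rw [show 2 - 2 * α + 1 = 3 - 2 * α by ring] at hV
  convert hV using 2
  rw [constC, ← hb]
  have : (1 - α) ≠ 0 := by linarith
  have : (3 - 2 * α) ≠ 0 := by linarith
  have : (2 - 2 * α) ≠ 0 := by linarith
  field_simp

lemma constC_pos (h₀ : 1 / 2 < α) (h₁ : α < 1) : 0 < constC α :=
  div_pos (beta_pos (by linarith) (by linarith)) (mul_pos (by linarith) (by linarith))

lemma IsPowerType.exists_norm_blockVec_sq_le (ha : IsPowerType a α) (h₀ : 1 / 2 < α)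
    (h₁ : α < 1) : ∃ K : ℝ, 0 < K ∧ ∀ n : ℕ, ‖blockVec a 0 n‖ ^ 2 ≤ K * (n : ℝ) ^ (3 - 2 * α) := by
  obtain ⟨K, hK⟩ := (ha.tendsto_norm_blockVec_sq h₀ h₁).bddAbove_range
  refine ⟨max K 1, by positivity, fun n => ?_⟩
  rcases Nat.eq_zero_or_pos n with rfl | hn
  · simp [blockVec, Real.zero_rpow (by linarith : 3 - 2 * α ≠ 0)]
  · have hn' : (0 : ℝ) < (n : ℝ) ^ (3 - 2 * α) := Real.rpow_pos_of_pos (by exact_mod_cast hn) _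
    have := hK ⟨n, rfl⟩
    simp only [div_le_iff₀ hn'] at this
    exact this.trans (by gcongr; exact le_max_left _ _)

lemma sum_range_shift_eq {E : Type*} [AddCommMonoid E] (f : ℕ → E) (s n : ℕ) :
    ∑ p ∈ Finset.range n, (if s ≤ p then f (p - s) else 0) = ∑ l ∈ Finset.range (n - s), f l := by
  induction n with
  | zero => simp
  | succ n ih =>
    rw [Finset.sum_range_succ, ih]
    split_ifs with h
    · rw [show n + 1 - s = n - s + 1 by omega, Finset.sum_range_succ]
    · rw [add_zero, show n + 1 - s = n - s by omega]

/-- A window that starts later along a decreasing sequence has a smaller sum, and for s > 0 the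
window is an initial segment with fewer terms. The coefficient of one noise variable in a block is
such a window sum. -/
lemma sum_range_shift_le {f : ℕ → ℝ} (hf : Antitone f) (h0 : ∀ l, 0 ≤ f l) (s : ℤ) (n : ℕ) :
    ∑ p ∈ Finset.range n, (if s ≤ p then f ((p : ℤ) - s).toNat else 0)
      ≤ ∑ l ∈ Finset.range n, f l := by
  rcases le_or_gt s 0 with hs | hs
  · refine Finset.sum_le_sum fun p _ => ?_
    rw [if_pos (by omega)]
    exact hf (by omega)
  · lift s to ℕ using hs.le
    have : ∀ p : ℕ, (if (s : ℤ) ≤ p then f ((p : ℤ) - s).toNat else 0)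
        = if s ≤ p then f (p - s) else 0 := by
      intro p
      split_ifs with h h' h'
      · congr 1; omega
      · omega
      · omega
      · rfl
    simp_rw [this]
    rw [sum_range_shift_eq]
    exact Finset.sum_le_sum_of_subset_of_nonneg (Finset.range_subset_range.mpr (Nat.sub_le _ _))
      fun l _ _ => h0 l

lemma blockVec_apply (ha : Summable fun l => a l ^ 2) (j n : ℕ) (k : ℤ) :
    blockVec a j n k = ∑ p ∈ Finset.range n, shiftCoeff a (j + p) k := by
  rw [blockVec_eq_sum_range, lp.coeFn_sum, Finset.sum_apply]
  exact Finset.sum_congr rfl fun p _ => coeffVec_apply ha _ _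

/-- Each coefficient is a sum of at most n consecutive values of a, hence at most a multiple of the
sum of (l+1)^{-α} over l < n, which has order n^{1-α}. The bound is uniform in the noise index and
in the position of the block. -/
lemma IsPowerType.exists_abs_blockVec_le (ha : IsPowerType a α) (h₀ : 1 / 2 < α) (h₁ : α < 1) :
    ∃ K : ℝ, 0 < K ∧ ∀ (j n : ℕ) (k : ℤ), |blockVec a j n k| ≤ K * (n : ℝ) ^ (1 - α) := by
  obtain ⟨K, hK, hb⟩ := ha.exists_abs_le
  set f : ℕ → ℝ := fun l => ((l : ℝ) + 1) ^ (-α) with hf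
  have hanti : Antitone f := fun l l' hl =>
    Real.rpow_le_rpow_of_nonpos (by positivity) (by gcongr) (by linarith)
  have hf0 : ∀ l, 0 ≤ f l := fun l => Real.rpow_nonneg (by positivity) _
  have hlim : Tendsto (fun k : ℕ => f k / (k : ℝ) ^ (-α)) atTop (𝓝 1) := by
    have h1 : Tendsto (fun n : ℕ => ((n : ℝ) + 1) / n) atTop (𝓝 1) := by
      have := (tendsto_inv_atTop_nhds_zero_nat (𝕜 := ℝ)).const_add 1
      rw [add_zero] at this
      refine this.congr' ?_
      filter_upwards [eventually_gt_atTop 0] with n hn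
      have : (n : ℝ) ≠ 0 := by exact_mod_cast hn.ne'
      field_simp
    have h2 := h1.rpow_const (p := -α) (Or.inl one_ne_zero)
    rw [Real.one_rpow] at h2
    exact h2.congr fun k => by rw [Real.div_rpow (by positivity) (by positivity)]
  obtain ⟨K', hK'⟩ := (tendsto_sum_range_div_rpow (by linarith) hlim).bddAbove_range
  refine ⟨K * max K' 1, by positivity, fun j n k => ?_⟩
  have h1 : |blockVec a j n k| ≤ K * ∑ l ∈ Finset.range n, f l := by
    rw [blockVec_apply (ha.summable_sq h₀)]
    refine (Finset.abs_sum_le_sum_abs _ _).trans ?_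
    refine le_trans ?_ (mul_le_mul_of_nonneg_left (sum_range_shift_le hanti hf0 (k - j) n) hK.le)
    rw [Finset.mul_sum]
    refine Finset.sum_le_sum fun p _ => ?_
    rw [shiftCoeff]
    by_cases h : k ≤ ((j + p : ℕ) : ℤ)
    · rw [if_pos h, if_pos (by push_cast at h; omega)]
      refine (hb _).trans (le_of_eq ?_)
      simp only [hf]
      congr 5
      push_cast
      omega
    · rw [if_neg h, if_neg (by push_cast at h; omega)]
      simp
  refine h1.trans ?_
  rw [mul_assoc]
  gcongr
  rcases Nat.eq_zero_or_pos n with rfl | hn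
  · simp [Real.zero_rpow (by linarith : 1 - α ≠ 0)]
  · have hn' : (0 : ℝ) < (n : ℝ) ^ (1 - α) := Real.rpow_pos_of_pos (by exact_mod_cast hn) _
    have := hK' ⟨n, rfl⟩
    simp only [show -α + 1 = 1 - α by ring, div_le_iff₀ hn'] at this
    exact this.trans (by gcongr; exact le_max_left _ _)

/-- When 2d ≤ n each of the d² pairs of indices has a lag of at least n/2, so every term is at most
a multiple of n^{1-2α}. -/
lemma IsPowerType.exists_abs_inner_blockVec_le (ha : IsPowerType a α) (h₀ : 1 / 2 < α)
    (h₁ : α < 1) : ∃ K : ℝ, 0 < K ∧ ∀ n d : ℕ, 2 * d ≤ n →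
      |inner ℝ (blockVec a n d) (blockVec a 0 d)| ≤ K * ((d : ℝ) ^ 2 * (n : ℝ) ^ (1 - 2 * α)) := by
  obtain ⟨K, hK⟩ := (ha.tendsto_autocov h₀ h₁).abs.bddAbove_range
  set K' := max K 1 with hK'
  have hb : ∀ k : ℕ, 0 < k → |autocov a k| ≤ K' * (k : ℝ) ^ (1 - 2 * α) := by
    intro k hk
    have hk' : (0 : ℝ) < (k : ℝ) ^ (1 - 2 * α) := Real.rpow_pos_of_pos (by exact_mod_cast hk) _
    have := hK ⟨k, rfl⟩
    simp only [abs_div, abs_of_pos hk', div_le_iff₀ hk'] at this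
    exact this.trans (by gcongr; exact le_max_left _ _)
  refine ⟨K' * (1 / 2 : ℝ) ^ (1 - 2 * α), by positivity, fun n d hd => ?_⟩
  rw [inner_blockVec]
  have hterm : ∀ p ∈ Finset.range d, ∀ q ∈ Finset.range d,
      |inner ℝ (coeffVec a (n + p)) (coeffVec a (0 + q))|
        ≤ K' * (1 / 2 : ℝ) ^ (1 - 2 * α) * (n : ℝ) ^ (1 - 2 * α) := by
    intro p hp q hq
    have hp := Finset.mem_range.mp hp
    have hq := Finset.mem_range.mp hq
    have hn : (0 : ℝ) < n := by exact_mod_cast (by omega : 0 < n)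
    rw [real_inner_comm, inner_coeffVec (ha.summable_sq h₀) (by omega)]
    refine (hb _ (by omega)).trans ?_
    rw [mul_assoc, ← Real.mul_rpow (by norm_num) hn.le]
    refine mul_le_mul_of_nonneg_left
      (Real.rpow_le_rpow_of_nonpos (by positivity) ?_ (by linarith)) (by positivity)
    rw [Nat.cast_sub (by omega)]
    push_cast
    have h1 : (q : ℝ) ≤ d := by exact_mod_cast hq.le
    have h2 : 2 * (d : ℝ) ≤ n := by exact_mod_cast hd
    have h3 : (0 : ℝ) ≤ p := Nat.cast_nonneg p
    linarith
  refine (Finset.abs_sum_le_sum_abs _ _).trans ?_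
  refine (Finset.sum_le_sum fun p hp => (Finset.abs_sum_le_sum_abs _ _).trans
    (Finset.sum_le_sum (hterm p hp))).trans (le_of_eq ?_)
  simp only [Finset.sum_const, Finset.card_range, nsmul_eq_mul]
  ring

end Vectors

/-! ### Series of independent random variables -/

section Series

variable {Ω : Type*} [MeasurableSpace Ω] {P : Measure Ω}

/-- The partial sums form a martingale bounded in L², hence in L¹, and Doob's convergence theorem
applies. Measurability of the ζ_l is needed only for their natural filtration. -/
lemma ae_exists_tendsto_sum_of_measurable [IsProbabilityMeasure P] {ζ : ℕ → Ω → ℝ}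
    (hm : ∀ l, Measurable (ζ l))
    (hind : iIndepFun ζ P) (hL2 : ∀ l, MemLp (ζ l) 2 P) (hmean : ∀ l, P[ζ l] = 0) {v : ℝ}
    (hvar : ∀ l, Var[ζ l; P] ≤ v) {b : ℕ → ℝ} (hb : Summable fun l => b l ^ 2) :
    ∀ᵐ ω ∂P, ∃ x, Tendsto (fun N => ∑ l ∈ Finset.range N, b l * ζ l ω) atTop (𝓝 x) := by
  have hsm : ∀ l, StronglyMeasurable (ζ l) := fun l => (hm l).stronglyMeasurable
  set 𝒢 := Filtration.natural ζ hsm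
  have hη : ∀ l, MemLp (fun ω => b l * ζ l ω) 2 P := fun l => (hL2 l).const_mul _
  -- The sum includes the term with index N, in step with the filtration, whose Nth member is
  -- generated by ζ_0, …, ζ_N.
  set f : ℕ → Ω → ℝ := fun N ω => ∑ l ∈ Finset.range (N + 1), b l * ζ l ω with hf
  have hf2 : ∀ N, MemLp (f N) 2 P := fun N => memLp_finsetSum _ fun l _ => hη l
  have hfint : ∀ N, Integrable (f N) P := fun N => (hf2 N).integrable one_le_two
  have hadp : StronglyAdapted 𝒢 f := by
    intro N
    refine Finset.stronglyMeasurable_fun_sum _ fun l hl => ?_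
    have := Filtration.stronglyAdapted_natural hsm l
    exact (this.mono (𝒢.mono (Nat.lt_succ_iff.mp (Finset.mem_range.mp hl)))).const_mul _
  have hmart : Martingale f 𝒢 P := by
    refine martingale_of_condExp_sub_eq_zero_nat hadp hfint fun N => ?_
    have h1 : f (N + 1) - f N = fun ω => b (N + 1) * ζ (N + 1) ω := by
      ext ω
      simp only [hf, Pi.sub_apply]
      rw [Finset.sum_range_succ]
      ring
    rw [h1]
    have hc : Measurable[MeasurableSpace.comap (ζ (N + 1)) inferInstance]
        fun ω => b (N + 1) * ζ (N + 1) ω :=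
      (measurable_const_mul (b (N + 1))).comp (comap_measurable (ζ (N + 1)))
    have h2 := condExp_indep_eq (hm (N + 1)).comap_le (𝒢.le N) hc.stronglyMeasurable
      (hind.indep_comap_natural_of_lt hsm (Nat.lt_succ_self N))
    filter_upwards [h2] with ω hω
    rw [hω, integral_const_mul, hmean, mul_zero]
    rfl
  have hvarf : ∀ N, ∫ ω, f N ω ^ 2 ∂P ≤ v * ∑' l, b l ^ 2 := by
    intro N
    have hmean' : P[f N] = 0 := by
      simp only [hf]
      rw [integral_finsetSum _ fun l _ => (hη l).integrable one_le_two]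
      exact Finset.sum_eq_zero fun l _ => by rw [integral_const_mul, hmean, mul_zero]
    have h1 : Var[f N; P] = ∫ ω, f N ω ^ 2 ∂P := by
      rw [variance_of_integral_eq_zero (hf2 N).aemeasurable hmean']
    have h2 : f N = ∑ l ∈ Finset.range (N + 1), fun ω => b l * ζ l ω := by
      ext ω; simp [hf]
    have h3 : Var[f N; P] = ∑ l ∈ Finset.range (N + 1), Var[fun ω => b l * ζ l ω; P] := by
      rw [h2]
      refine IndepFun.variance_sum (fun l _ => hη l) fun i _ j _ hij => ?_
      exact (hind.indepFun hij).comp (measurable_const_mul (b i)) (measurable_const_mul (b j))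
    have hv0 : 0 ≤ v := (variance_nonneg _ _).trans (hvar 0)
    rw [← h1, h3]
    calc ∑ l ∈ Finset.range (N + 1), Var[fun ω => b l * ζ l ω; P]
        ≤ ∑ l ∈ Finset.range (N + 1), v * b l ^ 2 := Finset.sum_le_sum fun l _ => by
          rw [variance_const_mul, mul_comm]
          exact mul_le_mul_of_nonneg_right (hvar l) (sq_nonneg _)
      _ = v * ∑ l ∈ Finset.range (N + 1), b l ^ 2 := by rw [Finset.mul_sum]
      _ ≤ _ := by
          gcongr
          exact hb.sum_le_tsum _ fun l _ => sq_nonneg _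
  have hL1 : ∀ N, eLpNorm (f N) 1 P ≤ ((1 + v * ∑' l, b l ^ 2).toNNReal : ℝ≥0∞) := by
    intro N
    rw [eLpNorm_one_eq_lintegral_enorm, ← ofReal_integral_norm_eq_lintegral_enorm (hfint N)]
    refine ENNReal.ofReal_le_ofReal ?_
    have hsq : Integrable (fun ω => f N ω ^ 2) P := (hf2 N).integrable_sq
    calc ∫ ω, ‖f N ω‖ ∂P ≤ ∫ ω, (1 + f N ω ^ 2) ∂P := by
          refine integral_mono (hfint N).norm ((integrable_const _).add hsq) fun ω => ?_
          rw [Real.norm_eq_abs, ← sq_abs (f N ω)]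
          nlinarith [sq_nonneg (|f N ω| - 1), abs_nonneg (f N ω)]
      _ = 1 + ∫ ω, f N ω ^ 2 ∂P := by
          rw [integral_add (integrable_const _) hsq]; simp
      _ ≤ _ := by linarith [hvarf N]
  filter_upwards [hmart.submartingale.ae_tendsto_limitProcess hL1] with ω hω
  exact ⟨_, (tendsto_add_atTop_iff_nat 1).mp hω⟩

/-- A series of independent centered random variables converges almost surely if the variances are
summable. -/
theorem ae_exists_tendsto_sum [IsProbabilityMeasure P] {ζ : ℕ → Ω → ℝ}
    (hind : iIndepFun ζ P) (hL2 : ∀ l, MemLp (ζ l) 2 P) (hmean : ∀ l, P[ζ l] = 0) {v : ℝ}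
    (hvar : ∀ l, Var[ζ l; P] ≤ v) {b : ℕ → ℝ} (hb : Summable fun l => b l ^ 2) :
    ∀ᵐ ω ∂P, ∃ x, Tendsto (fun N => ∑ l ∈ Finset.range N, b l * ζ l ω) atTop (𝓝 x) := by
  have hae : ∀ l, AEMeasurable (ζ l) P := fun l => (hL2 l).aemeasurable
  have heq : ∀ l, ζ l =ᵐ[P] (hae l).mk := fun l => (hae l).ae_eq_mk
  have h := ae_exists_tendsto_sum_of_measurable (fun l => (hae l).measurable_mk)
    ((iIndepFun_congr heq).mp hind) (fun l => (memLp_congr_ae (heq l)).mp (hL2 l))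
    (fun l => (integral_congr_ae (heq l)).symm.trans (hmean l))
    (fun l => (variance_congr (heq l)).symm.trans_le (hvar l)) hb
  filter_upwards [h, ae_all_iff.mpr heq] with ω hω hω'
  simpa [hω'] using hω

/-- Almost sure convergence of an `L²`-bounded sequence implies convergence of the means. -/
theorem tendsto_integral_of_sq_bounded [IsFiniteMeasure P] {f : ℕ → Ω → ℂ} {g : Ω → ℂ} {K : ℝ}
    (hf : ∀ n, AEStronglyMeasurable (f n) P)
    (hint : ∀ n, Integrable (fun ω => ‖f n ω‖ ^ 2) P)
    (hK : ∀ n, ∫ ω, ‖f n ω‖ ^ 2 ∂P ≤ K)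
    (hlim : ∀ᵐ ω ∂P, Tendsto (fun n => f n ω) atTop (𝓝 (g ω))) :
    Integrable g P ∧ Tendsto (fun n => ∫ ω, f n ω ∂P) atTop (𝓝 (∫ ω, g ω ∂P)) := by
  have hlK : ∀ n, ∫⁻ ω, ENNReal.ofReal (‖f n ω‖ ^ 2) ∂P ≤ ENNReal.ofReal K := fun n => by
    rw [← ofReal_integral_eq_lintegral_ofReal (hint n) (ae_of_all _ fun ω => by positivity)]
    exact ENNReal.ofReal_le_ofReal (hK n)
  have hgm : AEStronglyMeasurable g P := aestronglyMeasurable_of_tendsto_ae atTop hf hlim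
  have hL1 : ∀ n, eLpNorm (f n) 1 P ≤ ENNReal.ofReal K + P Set.univ := by
    intro n
    rw [eLpNorm_one_eq_lintegral_enorm]
    calc ∫⁻ ω, ‖f n ω‖ₑ ∂P ≤ ∫⁻ ω, (ENNReal.ofReal (‖f n ω‖ ^ 2) + 1) ∂P := by
          refine lintegral_mono fun ω => ?_
          rw [← ofReal_norm, ← ENNReal.ofReal_one,
            ← ENNReal.ofReal_add (by positivity) zero_le_one]
          refine ENNReal.ofReal_le_ofReal ?_
          nlinarith [sq_nonneg (‖f n ω‖ - 1), norm_nonneg (f n ω)]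
      _ = ∫⁻ ω, ENNReal.ofReal (‖f n ω‖ ^ 2) ∂P + P Set.univ := by
          rw [lintegral_add_right _ measurable_const]; simp
      _ ≤ _ := by gcongr; exact hlK n
  have hgL : MemLp g 1 P := by
    refine ⟨hgm, ?_⟩
    refine (Lp.eLpNorm_lim_le_liminf_eLpNorm hf g hlim).trans_lt ?_
    refine lt_of_le_of_lt (liminf_le_of_frequently_le' (Frequently.of_forall hL1)) ?_
    exact ENNReal.add_lt_top.mpr ⟨ENNReal.ofReal_lt_top, measure_lt_top _ _⟩
  have hgi : Integrable g P := memLp_one_iff_integrable.mp hgL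
  refine ⟨hgi, ?_⟩
  have hUI : UnifIntegrable f 1 P := by
    refine unifIntegrable_of le_rfl ENNReal.one_ne_top hf fun ε hε => ?_
    -- On ‖f‖ ≥ C one has ‖f‖ ≤ ‖f‖²/C, so the truncated mean is at most K/C ≤ ε. The maximum with 1
    -- only makes C positive.
    set C : ℝ := max (K / ε) 1 with hC
    have hCpos : 0 < C := by positivity
    refine ⟨C.toNNReal, fun n => ?_⟩
    rw [eLpNorm_one_eq_lintegral_enorm]
    calc ∫⁻ ω, ‖{x | C.toNNReal ≤ ‖f n x‖₊}.indicator (f n) ω‖ₑ ∂P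
        ≤ ∫⁻ ω, ENNReal.ofReal C⁻¹ * ENNReal.ofReal (‖f n ω‖ ^ 2) ∂P := by
          refine lintegral_mono fun ω => ?_
          by_cases h : C.toNNReal ≤ ‖f n ω‖₊
          · rw [Set.indicator_of_mem (by exact h), ← ENNReal.ofReal_mul (by positivity),
              ← ofReal_norm]
            refine ENNReal.ofReal_le_ofReal ?_
            have h' : C ≤ ‖f n ω‖ := Real.toNNReal_le_iff_le_coe.mp h
            rw [inv_mul_eq_div, le_div_iff₀ hCpos, pow_two]
            exact mul_le_mul_of_nonneg_left h' (norm_nonneg _)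
          · rw [Set.indicator_of_notMem (by exact h)]; simp
      _ = ENNReal.ofReal C⁻¹ * ∫⁻ ω, ENNReal.ofReal (‖f n ω‖ ^ 2) ∂P :=
          lintegral_const_mul' _ _ ENNReal.ofReal_ne_top
      _ ≤ ENNReal.ofReal C⁻¹ * ENNReal.ofReal K := by gcongr; exact hlK n
      _ = ENNReal.ofReal (C⁻¹ * K) := (ENNReal.ofReal_mul (by positivity)).symm
      _ ≤ ENNReal.ofReal ε := by
          refine ENNReal.ofReal_le_ofReal ?_
          rw [inv_mul_eq_div, div_le_iff₀ hCpos, ← div_le_iff₀' hε]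
          exact le_max_left _ _
  have hconv := tendsto_Lp_finite_of_tendsto_ae le_rfl ENNReal.one_ne_top hf hgL hUI hlim
  have hfi : ∀ n, Integrable (f n) P := fun n => memLp_one_iff_integrable.mp
    ⟨hf n, (hL1 n).trans_lt
      (ENNReal.add_lt_top.mpr ⟨ENNReal.ofReal_lt_top, measure_lt_top _ _⟩)⟩
  refine tendsto_integral_of_L1' g hgi.aestronglyMeasurable (Eventually.of_forall hfi) ?_
  exact hconv

end Series

/-! ### Linear functionals of the moving average -/

/-- The standing assumptions on the noise and on the coefficients. -/
structure IsLongMemoryModel {Ω : Type*} [MeasurableSpace Ω] (P : Measure Ω) (F : Measure ℝ)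
    (Z : ℤ → Ω → ℝ) (a : ℕ → ℝ) (α : ℝ) : Prop where
  isProb : IsProbabilityMeasure P
  law : ∀ k, HasLaw (Z k) F P
  indep : iIndepFun Z P
  nondeg : ∀ c : ℝ, F ≠ Measure.dirac c
  half_lt : 1 / 2 < α
  lt_one : α < 1
  exp : HasExponentialMoments F
  power : IsPowerType a α
  moments : MatchesGaussianMoments F (kappa α)

/-- The linear functional `∑ c_i X_i`. -/
noncomputable def linForm {Ω : Type*} (X : ℕ → Ω → ℝ) (c : ℕ →₀ ℝ) (ω : Ω) : ℝ :=
  Finsupp.linearCombination ℝ (fun i => X i ω) c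

/-- The coefficients of `∑ c_i X_i` with respect to the noise. -/
noncomputable def linVec (a : ℕ → ℝ) (c : ℕ →₀ ℝ) : ell2 :=
  Finsupp.linearCombination ℝ (coeffVec a) c

section ell2

lemma hasSum_sq_ell2 (x : ell2) : HasSum (fun k => x k ^ 2) (‖x‖ ^ 2) := by
  have := lp.hasSum_inner (𝕜 := ℝ) x x
  rw [real_inner_self_eq_norm_sq] at this
  simpa [pow_two] using this

lemma sum_sq_le_ell2 (x : ell2) (s : Finset ℤ) : ∑ k ∈ s, x k ^ 2 ≤ ‖x‖ ^ 2 :=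
  sum_le_hasSum s (fun _ _ => sq_nonneg _) (hasSum_sq_ell2 x)

/-- The functionals depend on the noise up to some index m, so their partial sums run backwards from
m. Summability over ℤ is unconditional, hence this order of summation also gives the inner product.
-/
lemma tendsto_sum_mul_ell2 {x : ell2} (y : ell2) {m : ℕ} (hx : ∀ k : ℤ, (m : ℤ) < k → x k = 0) :
    Tendsto (fun L => ∑ l ∈ Finset.range L, x ((m : ℤ) - l) * y ((m : ℤ) - l)) atTop
      (𝓝 (inner ℝ x y)) := by
  have h := lp.hasSum_inner (𝕜 := ℝ) x y
  have h' : HasSum ((fun k => x k * y k) ∘ fun l : ℕ => (m : ℤ) - l) (inner ℝ x y) := by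
    rw [(injective_sub_natCast m).hasSum_iff]
    · simpa [mul_comm] using h
    · intro k hk
      by_contra h0
      exact hk (support_subset_range (f := fun k => x k * y k)
        (fun k hk => by simp [hx k hk]) h0)
  exact h'.tendsto_sum_nat

end ell2

section

variable {Ω : Type*} [MeasurableSpace Ω] {P : Measure Ω} {F : Measure ℝ}
  {Z : ℤ → Ω → ℝ} {a : ℕ → ℝ} {α : ℝ}

lemma linVec_apply (ha : Summable fun l => a l ^ 2) (c : ℕ →₀ ℝ) (k : ℤ) :
    linVec a c k = ∑ i ∈ c.support, c i * shiftCoeff a i k := by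
  rw [linVec, Finsupp.linearCombination_apply, Finsupp.sum, lp.coeFn_sum, Finset.sum_apply]
  refine Finset.sum_congr rfl fun i _ => ?_
  rw [lp.coeFn_smul, Pi.smul_apply, coeffVec_apply ha, smul_eq_mul]

lemma linVec_eq_zero (ha : Summable fun l => a l ^ 2) {c : ℕ →₀ ℝ} {m : ℕ}
    (hc : ∀ i ∈ c.support, i ≤ m) {k : ℤ} (hk : (m : ℤ) < k) : linVec a c k = 0 := by
  rw [linVec_apply ha]
  refine Finset.sum_eq_zero fun i hi => ?_
  rw [shiftCoeff_eq_zero, mul_zero]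
  have := hc i hi
  omega

namespace IsLongMemoryModel

lemma isProb_law (M : IsLongMemoryModel P F Z a α) : IsProbabilityMeasure F :=
  have := M.isProb
  (M.law 0).isProbabilityMeasure_iff.mp M.isProb

lemma summable_sq (M : IsLongMemoryModel P F Z a α) : Summable fun l => a l ^ 2 :=
  M.power.summable_sq M.half_lt

lemma variance_pos (M : IsLongMemoryModel P F Z a α) : 0 < noiseVariance F :=
  have := M.isProb_law
  M.exp.noiseVariance_pos M.nondeg

lemma ae_tendsto_movingAverage (M : IsLongMemoryModel P F Z a α) (n : ℕ) :
    ∀ᵐ ω ∂P, Tendsto (fun N : ℕ => ∑ i ∈ Finset.range N, a i * Z ((n : ℤ) - (i : ℤ)) ω) atTop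
      (𝓝 (movingAverage a Z n ω)) := by
  have := M.isProb
  have := M.isProb_law
  have hmem : MemLp (fun z : ℝ => z) 2 F :=
    (memLp_two_iff_integrable_sq (by fun_prop)).mpr (M.exp.integrable_pow 2)
  have hL2 : ∀ k, MemLp (Z k) 2 P := fun k =>
    MemLp.comp_of_map (g := fun z : ℝ => z) (by rwa [(M.law k).map_eq]) (M.law k).aemeasurable
  have hmean : ∀ k, P[Z k] = 0 := fun k => by
    rw [(M.law k).integral_eq]
    exact M.moments.integral_eq_zero (one_le_two.trans (two_le_kappa M.half_lt M.lt_one))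
  have hvar : ∀ k, Var[Z k; P] ≤ Var[id; F] := fun k => (M.law k).variance_eq.le
  have h := ae_exists_tendsto_sum (ζ := fun l : ℕ => Z ((n : ℤ) - l))
    (M.indep.precomp (injective_sub_natCast n)) (fun l => hL2 _) (fun l => hmean _)
    (fun l => hvar _) M.summable_sq
  filter_upwards [h] with ω hω
  obtain ⟨x, hx⟩ := hω
  exact tendsto_nhds_limUnder ⟨x, hx⟩

lemma aemeasurable_movingAverage (M : IsLongMemoryModel P F Z a α) (n : ℕ) :
    AEMeasurable (movingAverage a Z n) P :=
  aemeasurable_of_tendsto_metrizable_ae atTop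
    (fun _ => Finset.aemeasurable_fun_sum _ fun _ _ => (M.law _).aemeasurable.const_mul _)
    (M.ae_tendsto_movingAverage n)

lemma aemeasurable_linForm (M : IsLongMemoryModel P F Z a α) (c : ℕ →₀ ℝ) :
    AEMeasurable (linForm (movingAverage a Z) c) P := by
  have : linForm (movingAverage a Z) c
      = fun ω => ∑ i ∈ c.support, c i * movingAverage a Z i ω := by
    ext ω
    simp [linForm, Finsupp.linearCombination_apply, Finsupp.sum]
  rw [this]
  exact Finset.aemeasurable_fun_sum _ fun i _ => (M.aemeasurable_movingAverage i).const_mul _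

/-- A linear functional of the moving average is the limit of the sums over `Z_k`, `k > m - L`. -/
lemma ae_tendsto_linForm (M : IsLongMemoryModel P F Z a α) {c : ℕ →₀ ℝ} {m : ℕ}
    (hc : ∀ i ∈ c.support, i ≤ m) :
    ∀ᵐ ω ∂P, Tendsto (fun L : ℕ => ∑ l ∈ Finset.range L,
      linVec a c ((m : ℤ) - l) * Z ((m : ℤ) - l) ω) atTop
      (𝓝 (linForm (movingAverage a Z) c ω)) := by
  filter_upwards [ae_all_iff.mpr M.ae_tendsto_movingAverage] with ω hω
  -- Among the variables Z_k with m - L < k ≤ m, exactly those with k ≤ i enter X_i; they are the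
  -- first L - (m - i) terms of its series. The truncated subtraction gives 0 when there are none.
  have h1 : Tendsto (fun L : ℕ => ∑ i ∈ c.support, c i *
      ∑ l ∈ Finset.range (L - (m - i)), a l * Z ((i : ℤ) - l) ω) atTop
      (𝓝 (∑ i ∈ c.support, c i * movingAverage a Z i ω)) :=
    tendsto_finsetSum _ fun i _ =>
      ((hω i).comp (tendsto_sub_atTop_nat (m - i))).const_mul (c i)
  have h2 : linForm (movingAverage a Z) c ω = ∑ i ∈ c.support, c i * movingAverage a Z i ω := by
    simp [linForm, Finsupp.linearCombination_apply, Finsupp.sum]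
  rw [h2]
  refine h1.congr fun L => ?_
  simp_rw [linVec_apply M.summable_sq, Finset.sum_mul]
  rw [Finset.sum_comm]
  refine Finset.sum_congr rfl fun i hi => ?_
  rw [← sum_range_shift_eq, Finset.mul_sum]
  refine Finset.sum_congr rfl fun l _ => ?_
  have := hc i hi
  split_ifs with h
  · rw [mul_assoc]
    congr 2
    · rw [shiftCoeff, if_pos (by omega)]
      congr 1
      omega
    · congr 1
      omega
  · rw [shiftCoeff_eq_zero (by omega)]
    simp

lemma integral_cexp_sum (M : IsLongMemoryModel P F Z a α) (m : ℤ) (L : ℕ) (w : ℕ → ℂ) :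
    ∫ ω, Complex.exp (∑ l ∈ Finset.range L, w l * Z (m - l) ω) ∂P
      = ∏ l ∈ Finset.range L, complexMGF id F (w l) := by
  have hind : iIndepFun (fun l : Fin L => Z (m - (l : ℕ))) P :=
    M.indep.precomp (g := fun l : Fin L => m - ((l : ℕ) : ℤ)) fun i j h => by
      have : ((i : ℕ) : ℤ) = ((j : ℕ) : ℤ) := by simpa using h
      exact Fin.ext (by exact_mod_cast this)
  have h := hind.integral_fun_prod_comp (f := fun (l : Fin L) (z : ℝ) => Complex.exp (w l * z))
    (fun l => (M.law _).aemeasurable) (fun l => by fun_prop)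
  simp_rw [Complex.exp_sum, Finset.prod_range]
  rw [h]
  refine Finset.prod_congr rfl fun l _ => ?_
  exact (M.law (m - (l : ℕ))).integral_comp (f := fun z : ℝ => Complex.exp (w l * z))
    (by fun_prop)

end IsLongMemoryModel

/-- The constant in the comparison of the noise with Gaussian noise. -/
def IsGaussianBound (F : Measure ℝ) (κ : ℕ) (C : ℝ) : Prop :=
  0 ≤ C ∧ ∀ w : ℂ, ‖w‖ ≤ 1 →
    ‖complexMGF id F w * Complex.exp (-(noiseVariance F * w ^ 2 / 2)) - 1‖ ≤ C * ‖w‖ ^ (κ + 1)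

/-- Each factor is exp(σ²w²/2)(1 + η) with |η| ≤ C|w|^{κ+1}, and |∏(1+η) - 1| ≤ exp(∑|η|) - 1. The
error is relative to the Gaussian transform, which is essential because that transform may be
exponentially large or small. -/
lemma IsGaussianBound.norm_prod_sub_le {κ : ℕ} {C : ℝ} (hC : IsGaussianBound F κ C) {L : ℕ}
    {w : ℕ → ℂ} (hw : ∀ l, ‖w l‖ ≤ 1) {S : ℝ}
    (hS : ∑ l ∈ Finset.range L, ‖w l‖ ^ (κ + 1) ≤ S) :
    ‖∏ l ∈ Finset.range L, complexMGF id F (w l)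
        - Complex.exp (noiseVariance F / 2 * ∑ l ∈ Finset.range L, w l ^ 2)‖
      ≤ ‖Complex.exp (noiseVariance F / 2 * ∑ l ∈ Finset.range L, w l ^ 2)‖
        * (Real.exp (C * S) - 1) := by
  set η : ℕ → ℂ := fun l =>
    complexMGF id F (w l) * Complex.exp (-(noiseVariance F * w l ^ 2 / 2)) - 1 with hη
  have h1 : ∀ l, complexMGF id F (w l)
      = Complex.exp (noiseVariance F / 2 * w l ^ 2) * (1 + η l) := by
    intro l
    simp only [hη]
    rw [add_sub_cancel, mul_left_comm, ← Complex.exp_add]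
    rw [show (noiseVariance F : ℂ) / 2 * w l ^ 2 + -(noiseVariance F * w l ^ 2 / 2) = 0 by ring]
    simp
  have h2 : ∏ l ∈ Finset.range L, complexMGF id F (w l)
      = Complex.exp (noiseVariance F / 2 * ∑ l ∈ Finset.range L, w l ^ 2)
        * ∏ l ∈ Finset.range L, (1 + η l) := by
    rw [Finset.prod_congr rfl fun l _ => h1 l, Finset.prod_mul_distrib, Finset.mul_sum,
      Complex.exp_sum]
  rw [h2, show ∀ x y : ℂ, x * y - x = x * (y - 1) by intros; ring, norm_mul]
  refine mul_le_mul_of_nonneg_left ?_ (norm_nonneg _)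
  refine (Finset.norm_prod_one_add_sub_one_le _ _).trans (sub_le_sub_right ?_ 1)
  refine Real.exp_le_exp.mpr ?_
  calc ∑ l ∈ Finset.range L, ‖η l‖ ≤ ∑ l ∈ Finset.range L, C * ‖w l‖ ^ (κ + 1) :=
        Finset.sum_le_sum fun l _ => hC.2 _ (hw l)
    _ = C * ∑ l ∈ Finset.range L, ‖w l‖ ^ (κ + 1) := by rw [Finset.mul_sum]
    _ ≤ C * S := mul_le_mul_of_nonneg_left hS hC.1

/-- The exponent of the Gaussian approximation of `E exp(∑ (x_k + i y_k) Z_k)`. -/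
noncomputable def gaussExponent (F : Measure ℝ) (x y : ell2) : ℂ :=
  noiseVariance F / 2 * ((‖x‖ ^ 2 - ‖y‖ ^ 2 : ℝ) + 2 * (inner ℝ x y : ℝ) * Complex.I)

lemma sum_range_sub_le_of_forall {f : ℤ → ℝ} {S : ℝ} (hS : ∀ s : Finset ℤ, ∑ k ∈ s, f k ≤ S)
    (m : ℤ) (L : ℕ) : ∑ l ∈ Finset.range L, f (m - l) ≤ S := by
  have h := hS ((Finset.range L).image fun l : ℕ => m - (l : ℤ))
  rwa [Finset.sum_image fun i _ j _ h => injective_sub_natCast m h] at h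

/-- Bounds for the exponential moments of linear functionals of the moving average: they are
compared with those for Gaussian noise. -/
theorem IsLongMemoryModel.norm_integral_cexp_sub_le (M : IsLongMemoryModel P F Z a α) {C : ℝ}
    (hC : IsGaussianBound F (kappa α) C) (c c' : ℕ →₀ ℝ)
    (hsup : ∀ k, |linVec a c k| + |linVec a c' k| ≤ 1 / 2) {S : ℝ}
    (hS : ∀ s : Finset ℤ,
      ∑ k ∈ s, (|linVec a c k| + |linVec a c' k|) ^ (kappa α + 1) ≤ S) :
    Integrable (fun ω => Real.exp (linForm (movingAverage a Z) c ω)) P ∧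
    ‖∫ ω, Complex.exp (linForm (movingAverage a Z) c ω
          + linForm (movingAverage a Z) c' ω * Complex.I) ∂P
        - Complex.exp (gaussExponent F (linVec a c) (linVec a c'))‖
      ≤ ‖Complex.exp (gaussExponent F (linVec a c) (linVec a c'))‖ * (Real.exp (C * S) - 1) := by
  have := M.isProb
  have := M.isProb_law
  set κ := kappa α
  set x := linVec a c with hx
  set y := linVec a c' with hy
  set X := movingAverage a Z
  obtain ⟨m, hm⟩ : ∃ m : ℕ, ∀ i ∈ c.support ∪ c'.support, i ≤ m :=
    ⟨(c.support ∪ c'.support).sup id, fun i hi => Finset.le_sup (f := id) hi⟩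
  have hmc : ∀ i ∈ c.support, i ≤ m := fun i hi => hm i (Finset.mem_union_left _ hi)
  have hmc' : ∀ i ∈ c'.support, i ≤ m := fun i hi => hm i (Finset.mem_union_right _ hi)
  have hx0 : ∀ k : ℤ, (m : ℤ) < k → x k = 0 := fun k hk => linVec_eq_zero M.summable_sq hmc hk
  have hy0 : ∀ k : ℤ, (m : ℤ) < k → y k = 0 := fun k hk => linVec_eq_zero M.summable_sq hmc' hk
  set w : ℕ → ℂ := fun l => (x ((m : ℤ) - l) : ℂ) + (y ((m : ℤ) - l) : ℂ) * Complex.I with hw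
  have hwn : ∀ l : ℕ, ‖w l‖ ≤ |x ((m : ℤ) - l)| + |y ((m : ℤ) - l)| := fun l => by
    refine (norm_add_le _ _).trans ?_
    simp
  have hw1 : ∀ l, ‖w l‖ ≤ 1 := fun l => by linarith [hwn l, hsup ((m : ℤ) - l)]
  have hS0 : 0 ≤ S := by simpa using hS ∅
  have hwS : ∀ L, ∑ l ∈ Finset.range L, ‖w l‖ ^ (κ + 1) ≤ S := fun L =>
    (Finset.sum_le_sum fun l _ => pow_le_pow_left₀ (norm_nonneg _) (hwn l) _).trans
      (sum_range_sub_le_of_forall hS m L)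
  have hw2 : Tendsto (fun L => ∑ l ∈ Finset.range L, w l ^ 2) atTop
      (𝓝 ((‖x‖ ^ 2 - ‖y‖ ^ 2 : ℝ) + 2 * (inner ℝ x y : ℝ) * Complex.I)) := by
    have e1 := tendsto_sum_mul_ell2 x hx0
    have e2 := tendsto_sum_mul_ell2 y hy0
    have e3 := tendsto_sum_mul_ell2 y hx0
    rw [real_inner_self_eq_norm_sq] at e1 e2
    have e4 := ((Complex.continuous_ofReal.tendsto _).comp (e1.sub e2)).add
      ((((Complex.continuous_ofReal.tendsto _).comp e3).const_mul 2).mul_const Complex.I)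
    refine e4.congr fun L => ?_
    simp only [Function.comp]
    push_cast
    rw [← Finset.sum_sub_distrib, Finset.mul_sum, Finset.sum_mul, ← Finset.sum_add_distrib]
    refine Finset.sum_congr rfl fun l _ => ?_
    simp only [hw]
    linear_combination -((y ((m : ℤ) - l) : ℂ)) ^ 2 * Complex.I_sq
  set T : ℕ → Ω → ℂ := fun L ω => Complex.exp (∑ l ∈ Finset.range L, w l * Z ((m : ℤ) - l) ω)
    with hT
  have hTm : ∀ L, AEStronglyMeasurable (T L) P := by
    intro L
    have : AEMeasurable (T L) P := by
      refine Complex.measurable_exp.comp_aemeasurable ?_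
      exact Finset.aemeasurable_fun_sum _ fun l _ =>
        (Complex.measurable_ofReal.comp_aemeasurable (M.law _).aemeasurable).const_mul _
    exact this.aestronglyMeasurable
  have hlimT : ∀ᵐ ω ∂P, Tendsto (fun L => T L ω) atTop
      (𝓝 (Complex.exp (linForm X c ω + linForm X c' ω * Complex.I))) := by
    filter_upwards [M.ae_tendsto_linForm hmc, M.ae_tendsto_linForm hmc'] with ω h1 h2
    refine (Complex.continuous_exp.tendsto _).comp ?_
    have := ((Complex.continuous_ofReal.tendsto _).comp h1).add
      (((Complex.continuous_ofReal.tendsto _).comp h2).mul_const Complex.I)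
    refine this.congr fun L => ?_
    simp only [Function.comp, hw]
    push_cast
    rw [Finset.sum_mul, ← Finset.sum_add_distrib]
    exact Finset.sum_congr rfl fun l _ => by ring
  -- The squared modulus of T L is again the exponential of a linear functional, now with real
  -- coefficients 2x. The same comparison therefore bounds its mean uniformly in L, which justifies
  -- the passage to the limit; the bound 1/2 on the coefficients makes room for the doubling.
  have hsq : ∀ L, (fun ω => ((‖T L ω‖ ^ 2 : ℝ) : ℂ))
      = fun ω => Complex.exp (∑ l ∈ Finset.range L,
          ((2 * x ((m : ℤ) - l) : ℝ) : ℂ) * Z ((m : ℤ) - l) ω) := by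
    intro L
    ext ω
    simp only [hT]
    rw [Complex.norm_exp, ← Real.exp_nat_mul, Complex.ofReal_exp]
    congr 1
    rw [Complex.re_sum]
    push_cast
    rw [Finset.mul_sum]
    refine Finset.sum_congr rfl fun l _ => ?_
    simp [hw]
    ring
  have hu1 : ∀ l : ℕ, ‖((2 * x ((m : ℤ) - l) : ℝ) : ℂ)‖ ≤ 1 := fun l => by
    rw [Complex.norm_real, Real.norm_eq_abs, abs_mul, abs_two]
    linarith [hsup ((m : ℤ) - l), abs_nonneg (y ((m : ℤ) - l))]
  have huS : ∀ L, ∑ l ∈ Finset.range L, ‖((2 * x ((m : ℤ) - l) : ℝ) : ℂ)‖ ^ (κ + 1)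
      ≤ 2 ^ (κ + 1) * S := fun L => by
    refine le_trans ?_ (mul_le_mul_of_nonneg_left (sum_range_sub_le_of_forall hS m L)
      (by positivity))
    rw [Finset.mul_sum]
    refine Finset.sum_le_sum fun l _ => ?_
    rw [← mul_pow, Complex.norm_real, Real.norm_eq_abs, abs_mul, abs_two]
    gcongr
    linarith [abs_nonneg (y ((m : ℤ) - l))]
  have hsqval : ∀ L, ∫ ω, ‖T L ω‖ ^ 2 ∂P ≤
      Real.exp (2 * noiseVariance F * ‖x‖ ^ 2) * Real.exp (C * (2 ^ (κ + 1) * S)) := by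
    intro L
    have h1 := M.integral_cexp_sum m L fun l => ((2 * x ((m : ℤ) - l) : ℝ) : ℂ)
    rw [← hsq L, integral_complex_ofReal] at h1
    have h2 := hC.norm_prod_sub_le hu1 (huS L)
    rw [← h1] at h2
    have h3 : ‖Complex.exp (noiseVariance F / 2 *
        ∑ l ∈ Finset.range L, ((2 * x ((m : ℤ) - l) : ℝ) : ℂ) ^ 2)‖
        ≤ Real.exp (2 * noiseVariance F * ‖x‖ ^ 2) := by
      have : (noiseVariance F : ℂ) / 2 * ∑ l ∈ Finset.range L, ((2 * x ((m : ℤ) - l) : ℝ) : ℂ) ^ 2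
          = ((2 * noiseVariance F * ∑ l ∈ Finset.range L, x ((m : ℤ) - l) ^ 2 : ℝ) : ℂ) := by
        push_cast
        rw [Finset.mul_sum, Finset.mul_sum]
        exact Finset.sum_congr rfl fun l _ => by ring
      rw [this, ← Complex.ofReal_exp, Complex.norm_real, Real.norm_of_nonneg (Real.exp_pos _).le]
      refine Real.exp_le_exp.mpr (mul_le_mul_of_nonneg_left
        (sum_range_sub_le_of_forall (f := fun k => x k ^ 2) (sum_sq_le_ell2 x) m L) ?_)
      have := noiseVariance_nonneg F
      positivity
    have h4 := (norm_le_norm_add_norm_sub' _ _).trans (add_le_add_right h2 _)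
    rw [Complex.norm_real] at h4
    refine (le_abs_self _).trans (h4.trans ?_)
    rw [show ∀ u v : ℝ, u + u * (v - 1) = u * v by intros; ring]
    gcongr
  have hsqint : ∀ L, Integrable (fun ω => ‖T L ω‖ ^ 2) P := by
    intro L
    have : ∀ ω, ‖T L ω‖ ^ 2 = ∏ l ∈ Finset.range L,
        Real.exp (2 * x ((m : ℤ) - l) * Z ((m : ℤ) - l) ω) := by
      intro ω
      have := congrFun (hsq L) ω
      rw [← Real.exp_sum, ← Complex.ofReal_inj, this]
      push_cast
      rfl
    simp_rw [this, Finset.prod_range]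
    have hind : iIndepFun (fun l : Fin L => Z ((m : ℤ) - (l : ℕ))) P :=
      M.indep.precomp (g := fun l : Fin L => (m : ℤ) - ((l : ℕ) : ℤ)) fun i j h => by
        have : ((i : ℕ) : ℤ) = ((j : ℕ) : ℤ) := by simpa using h
        exact Fin.ext (by exact_mod_cast this)
    have hi := Integrable.fintype_prod (μ := fun _ : Fin L => F)
      (f := fun (l : Fin L) (z : ℝ) => Real.exp (2 * x ((m : ℤ) - (l : ℕ)) * z))
      (fun l => M.exp (2 * x ((m : ℤ) - (l : ℕ))))
    have hmap := hind.map_fun_eq_pi_map (fun l => (M.law _).aemeasurable)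
    simp_rw [(M.law _).map_eq] at hmap
    change Integrable _ (Measure.pi fun _ : Fin L => F) at hi
    rw [← hmap] at hi
    exact hi.comp_aemeasurable (aemeasurable_pi_lambda _ fun l => (M.law _).aemeasurable)
  obtain ⟨hint, hconv⟩ := tendsto_integral_of_sq_bounded hTm hsqint hsqval hlimT
  refine ⟨?_, ?_⟩
  · refine hint.norm.congr (ae_of_all _ fun ω => ?_)
    simp only [Complex.norm_exp]
    simp
  · have hI : ∀ L, ∫ ω, T L ω ∂P = ∏ l ∈ Finset.range L, complexMGF id F (w l) :=
      fun L => M.integral_cexp_sum m L w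
    have hlim1 : Tendsto (fun L => Complex.exp (noiseVariance F / 2 *
        ∑ l ∈ Finset.range L, w l ^ 2)) atTop (𝓝 (Complex.exp (gaussExponent F x y))) :=
      (Complex.continuous_exp.tendsto _).comp (hw2.const_mul _)
    refine le_of_tendsto_of_tendsto (hconv.sub hlim1).norm (hlim1.norm.mul_const _)
      (Eventually.of_forall fun L => ?_)
    simp only [hI]
    exact hC.norm_prod_sub_le hw1 (hwS L)

end

/-! ### Exponential moments along a sequence of tilts -/

lemma linForm_add {Ω : Type*} (X : ℕ → Ω → ℝ) (c c' : ℕ →₀ ℝ) (ω : Ω) :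
    linForm X (c + c') ω = linForm X c ω + linForm X c' ω := map_add _ _ _

lemma linForm_sub {Ω : Type*} (X : ℕ → Ω → ℝ) (c c' : ℕ →₀ ℝ) (ω : Ω) :
    linForm X (c - c') ω = linForm X c ω - linForm X c' ω := map_sub _ _ _

lemma linForm_smul {Ω : Type*} (X : ℕ → Ω → ℝ) (r : ℝ) (c : ℕ →₀ ℝ) (ω : Ω) :
    linForm X (r • c) ω = r * linForm X c ω := by
  simp [linForm]

lemma linForm_zero {Ω : Type*} (X : ℕ → Ω → ℝ) (ω : Ω) : linForm X 0 ω = 0 := by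
  simp [linForm]

section Tilt

variable {Ω : Type*} [MeasurableSpace Ω] {P : Measure Ω} {F : Measure ℝ}
  {Z : ℤ → Ω → ℝ} {a : ℕ → ℝ} {α : ℝ}

/-- A sequence of linear functionals with large variances and small coefficients. The numbers `b n`
bound the coefficients. -/
structure IsTiltSequence (a : ℕ → ℝ) (κ : ℕ) (u : ℕ → ℕ →₀ ℝ) (b : ℕ → ℝ) : Prop where
  norm_tendsto : Tendsto (fun n => ‖linVec a (u n)‖) atTop atTop
  abs_le : ∀ n k, |linVec a (u n) k| ≤ b n
  pos : ∀ᶠ n in atTop, 0 < b n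
  tendsto_zero : Tendsto b atTop (𝓝 0)
  tendsto_pow : Tendsto (fun n => b n ^ (κ - 1) * ‖linVec a (u n)‖ ^ 2) atTop (𝓝 0)
  tendsto_exp : ∀ δ, 0 < δ →
    Tendsto (fun n => ‖linVec a (u n)‖ * Real.exp (-(δ / b n))) atTop (𝓝 0)

/-- The linear functional of `u`, centered at its mean under the Gaussian tilt. -/
noncomputable def tiltVar (F : Measure ℝ) (Z : ℤ → Ω → ℝ) (a : ℕ → ℝ) (u : ℕ →₀ ℝ) (ω : Ω) : ℝ :=
  linForm (movingAverage a Z) u ω - noiseVariance F * ‖linVec a u‖ ^ 2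

/-- The normalized transform `E exp((1 + it) Y + ∑ p_i X_i + i ∑ q_i X_i)`, with `Y = tiltVar`. -/
noncomputable def tiltTransform (P : Measure Ω) (F : Measure ℝ) (Z : ℤ → Ω → ℝ) (a : ℕ → ℝ)
    (u p q : ℕ →₀ ℝ) (t : ℝ) : ℂ :=
  Complex.exp (noiseVariance F * ‖linVec a u‖ ^ 2 / 2 : ℝ) *
    ∫ ω, Complex.exp ((1 + t * Complex.I) * tiltVar F Z a u ω
      + linForm (movingAverage a Z) p ω + linForm (movingAverage a Z) q ω * Complex.I) ∂P

lemma linVec_add (c c' : ℕ →₀ ℝ) : linVec a (c + c') = linVec a c + linVec a c' :=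
  map_add _ _ _

lemma linVec_smul (r : ℝ) (c : ℕ →₀ ℝ) : linVec a (r • c) = r • linVec a c := map_smul _ _ _

lemma linVec_sub (c c' : ℕ →₀ ℝ) : linVec a (c - c') = linVec a c - linVec a c' :=
  map_sub _ _ _

lemma linVec_zero : linVec a 0 = 0 := by
  simp [linVec]

lemma tiltTransform_eq (u p q : ℕ →₀ ℝ) (t : ℝ) :
    tiltTransform P F Z a u p q t
      = Complex.exp (noiseVariance F * ‖linVec a u‖ ^ 2 / 2
          - (1 + t * Complex.I) * (noiseVariance F * ‖linVec a u‖ ^ 2)) *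
        ∫ ω, Complex.exp (linForm (movingAverage a Z) (u + p) ω
          + linForm (movingAverage a Z) (t • u + q) ω * Complex.I) ∂P := by
  rw [tiltTransform, sub_eq_add_neg, Complex.exp_add, mul_assoc]
  congr 1
  · push_cast; rfl
  · rw [← integral_const_mul]
    refine integral_congr_ae (ae_of_all _ fun ω => ?_)
    simp only [← Complex.exp_add, tiltVar, linForm_add, linForm_smul]
    congr 1
    push_cast
    ring

/-- The Gaussian approximation of `tiltTransform`. -/
noncomputable def tiltExponent (F : Measure ℝ) (a : ℕ → ℝ) (u p q : ℕ →₀ ℝ) (t : ℝ) : ℂ :=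
  noiseVariance F * ‖linVec a u‖ ^ 2 / 2
    - (1 + t * Complex.I) * (noiseVariance F * ‖linVec a u‖ ^ 2)
    + gaussExponent F (linVec a (u + p)) (linVec a (t • u + q))

/-- All terms of order ‖u‖² without t² cancel: the normalization and the centering remove the
variance from the real part and the mean tσ²‖u‖² from the imaginary part. Only the inner products
with p and q and the decay in t remain. -/
lemma tiltExponent_eq (F : Measure ℝ) (a : ℕ → ℝ) (u p q : ℕ →₀ ℝ) (t : ℝ) :
    tiltExponent F a u p q t
      = ((noiseVariance F / 2 * (2 * inner ℝ (linVec a u) (linVec a p) + ‖linVec a p‖ ^ 2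
          - ‖t • linVec a u + linVec a q‖ ^ 2) : ℝ) : ℂ)
        + ((noiseVariance F * (inner ℝ (linVec a u) (linVec a q)
          + inner ℝ (linVec a p) (t • linVec a u + linVec a q)) : ℝ) : ℂ) * Complex.I := by
  rw [tiltExponent, gaussExponent, linVec_add, linVec_add, linVec_smul, norm_add_sq_real,
    inner_add_left (linVec a u), inner_add_right (linVec a u), real_inner_smul_right,
    real_inner_self_eq_norm_sq]
  push_cast
  ring

lemma norm_exp_tiltExponent (F : Measure ℝ) (a : ℕ → ℝ) (u p q : ℕ →₀ ℝ) (t : ℝ) :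
    ‖Complex.exp (tiltExponent F a u p q t)‖
      = Real.exp (noiseVariance F / 2 * (2 * inner ℝ (linVec a u) (linVec a p) + ‖linVec a p‖ ^ 2
          - ‖t • linVec a u + linVec a q‖ ^ 2)) := by
  rw [tiltExponent_eq, Complex.norm_exp, Complex.add_re, Complex.ofReal_re, Complex.re_ofReal_mul,
    Complex.I_re, mul_zero, add_zero]

lemma IsLongMemoryModel.norm_tiltTransform_sub_le (M : IsLongMemoryModel P F Z a α) {C : ℝ}
    (hC : IsGaussianBound F (kappa α) C) (u p q : ℕ →₀ ℝ) (t : ℝ)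
    (hsup : ∀ k, (1 + |t|) * |linVec a u k| + (|linVec a p k| + |linVec a q k|) ≤ 1 / 2) {S : ℝ}
    (hS : ∀ s : Finset ℤ, ∑ k ∈ s, ((1 + |t|) * |linVec a u k|
      + (|linVec a p k| + |linVec a q k|)) ^ (kappa α + 1) ≤ S) :
    Integrable (fun ω => Real.exp (linForm (movingAverage a Z) (u + p) ω)) P ∧
    ‖tiltTransform P F Z a u p q t - Complex.exp (tiltExponent F a u p q t)‖
      ≤ ‖Complex.exp (tiltExponent F a u p q t)‖ * (Real.exp (C * S) - 1) := by
  have hle : ∀ k, |linVec a (u + p) k| + |linVec a (t • u + q) k|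
      ≤ (1 + |t|) * |linVec a u k| + (|linVec a p k| + |linVec a q k|) := by
    intro k
    rw [linVec_add, linVec_add, linVec_smul, lp.coeFn_add, lp.coeFn_add, lp.coeFn_smul,
      Pi.add_apply, Pi.add_apply, Pi.smul_apply, smul_eq_mul]
    have h1 := abs_add_le (linVec a u k) (linVec a p k)
    have h2 := abs_add_le (t * linVec a u k) (linVec a q k)
    rw [abs_mul] at h2
    linarith
  obtain ⟨h1, h2⟩ := M.norm_integral_cexp_sub_le hC (u + p) (t • u + q)
    (fun k => (hle k).trans (hsup k)) (S := S)
    (fun s => (Finset.sum_le_sum fun k _ => pow_le_pow_left₀ (by positivity) (hle k) _).trans (hS s))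
  refine ⟨h1, ?_⟩
  rw [tiltTransform_eq, tiltExponent, Complex.exp_add, ← mul_sub, norm_mul, norm_mul, mul_assoc]
  exact mul_le_mul_of_nonneg_left h2 (norm_nonneg _)

/-- Of the κ + 1 powers, κ - 1 are paid for by the bound on the coefficients and two are kept for
the ℓ² norm. -/
lemma pow_succ_le_mul_sq {x r : ℝ} (hx : 0 ≤ x) (hxr : x ≤ r) {κ : ℕ} (hκ : 1 ≤ κ) :
    x ^ (κ + 1) ≤ r ^ (κ - 1) * x ^ 2 := by
  rw [show κ + 1 = (κ - 1) + 2 by omega, pow_add]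
  gcongr

/-- Uniform Gaussian bound for the transforms along a tilt sequence. -/
theorem IsTiltSequence.exists_norm_tiltTransform_le (M : IsLongMemoryModel P F Z a α)
    {u : ℕ → ℕ →₀ ℝ} {b : ℕ → ℝ} (hu : IsTiltSequence a (kappa α) u b) (D : ℝ) :
    ∃ ρ C : ℝ, 0 < ρ ∧ ∀ᶠ n in atTop, ∀ p q : ℕ →₀ ℝ,
      (∀ k, |linVec a p k| ≤ ρ) → (∀ k, |linVec a q k| ≤ ρ) →
      ‖linVec a p‖ ≤ D → ‖linVec a q‖ ≤ D → inner ℝ (linVec a (u n)) (linVec a p) ≤ D →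
      Integrable (fun ω => Real.exp (linForm (movingAverage a Z) (u n + p) ω)) P ∧
      ∀ t : ℝ, |t| * b n ≤ ρ → ‖tiltTransform P F Z a (u n) p q t‖
        ≤ Real.exp (C - noiseVariance F / 8 * (t * ‖linVec a (u n)‖) ^ 2) := by
  have := M.isProb_law
  obtain ⟨C₀, hC₀⟩ : ∃ C, IsGaussianBound F (kappa α) C := M.moments.exists_complexMGF_bound M.exp
  have hκ := two_le_kappa M.half_lt M.lt_one
  set κ := kappa α
  set v := noiseVariance F
  have hv : 0 < v := M.variance_pos
  -- The bound 1/12 gives 1/4 + 3ρ ≤ 1/2 for the coefficients. The second bound keeps the error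
  -- growing like (t‖u‖)² below σ²/8, to be absorbed by the Gaussian decay with rate σ²/4.
  set ρ : ℝ := min (1 / 12) (v / (64 * 2 ^ κ * (C₀ + 1))) with hρ
  have hC₀0 := hC₀.1
  have hρ0 : 0 < ρ := by positivity
  have hρ1 : ρ ≤ 1 / 12 := min_le_left _ _
  have hρ2 : C₀ * (2 ^ κ * (8 * ρ)) ≤ v / 8 := by
    have h1 : ρ ≤ v / (64 * 2 ^ κ * (C₀ + 1)) := min_le_right _ _
    rw [le_div_iff₀ (by positivity)] at h1
    have : 0 ≤ ρ * 64 * 2 ^ κ := by positivity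
    nlinarith
  refine ⟨ρ, v * (D + D ^ 2) + C₀ * (2 ^ κ * (1 + 4 * D ^ 2)), hρ0, ?_⟩
  have hb0 : ∀ᶠ n in atTop, b n < 1 / 4 := hu.tendsto_zero.eventually_lt_const (by norm_num)
  have hpow : ∀ᶠ n in atTop, b n ^ (κ - 1) * ‖linVec a (u n)‖ ^ 2 < 1 / 2 ^ (κ + 1) :=
    hu.tendsto_pow.eventually_lt_const (by positivity)
  filter_upwards [hu.pos, hb0, hpow] with n hpos hbn hpn p q hp hq hpD hqD hup
  set U := linVec a (u n)
  set N := ‖U‖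
  set x := linVec a p
  set y := linVec a q
  have hU : ∀ k, |U k| ≤ b n := hu.abs_le n
  have key : ∀ t : ℝ, |t| * b n ≤ ρ →
      (∀ k, (1 + |t|) * |U k| + (|x k| + |y k|) ≤ 1 / 2) ∧
      ∀ s : Finset ℤ, ∑ k ∈ s, ((1 + |t|) * |U k| + (|x k| + |y k|)) ^ (κ + 1)
        ≤ 2 ^ κ * (1 + 8 * ρ * (t * N) ^ 2 + 4 * D ^ 2) := by
    intro t ht
    have hA : ∀ k, |t| * |U k| ≤ ρ := fun k =>
      (mul_le_mul_of_nonneg_left (hU k) (abs_nonneg t)).trans ht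
    refine ⟨fun k => by linarith [hA k, hU k, hp k, hq k], fun s => ?_⟩
    have hterm : ∀ k, ((1 + |t|) * |U k| + (|x k| + |y k|)) ^ (κ + 1)
        ≤ 2 ^ κ * ((2 ^ (κ + 1) * b n ^ (κ - 1) * U k ^ 2 + 8 * ρ * t ^ 2 * U k ^ 2)
          + (2 * x k ^ 2 + 2 * y k ^ 2)) := by
      intro k
      refine (add_pow_le (by positivity) (by positivity) (κ + 1)).trans ?_
      rw [Nat.add_sub_cancel]
      gcongr
      -- For |t| ≤ 1 the tilt itself dominates and its contribution is controlled by b^{κ-1}‖u‖².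
      -- For |t| ≥ 1 one factor 2ρ is gained from the κ - 1 ≥ 1 spare powers, leaving a small
      -- multiple of t²U_k².
      · rcases le_total |t| 1 with h1 | h1
        · have hle : (1 + |t|) * |U k| ≤ 2 * |U k| := by nlinarith [abs_nonneg (U k)]
          calc ((1 + |t|) * |U k|) ^ (κ + 1) ≤ (2 * |U k|) ^ (κ + 1) := by gcongr
            _ = 2 ^ (κ + 1) * |U k| ^ (κ + 1) := mul_pow _ _ _
            _ ≤ 2 ^ (κ + 1) * (b n ^ (κ - 1) * |U k| ^ 2) := by
                gcongr
                exact pow_succ_le_mul_sq (abs_nonneg _) (hU k) (by omega)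
            _ = 2 ^ (κ + 1) * b n ^ (κ - 1) * U k ^ 2 := by rw [sq_abs, mul_assoc]
            _ ≤ _ := le_add_of_nonneg_right (by positivity)
        · have hle : (1 + |t|) * |U k| ≤ 2 * (|t| * |U k|) := by nlinarith [abs_nonneg (U k)]
          have hle2 : (2 * ρ) ^ (κ - 1) ≤ 2 * ρ := by
            calc (2 * ρ) ^ (κ - 1) ≤ (2 * ρ) ^ 1 :=
                  pow_le_pow_of_le_one (by positivity) (by linarith) (by omega)
              _ = 2 * ρ := pow_one _
          calc ((1 + |t|) * |U k|) ^ (κ + 1) ≤ (2 * (|t| * |U k|)) ^ (κ + 1) := by gcongr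
            _ ≤ (2 * ρ) ^ (κ - 1) * (2 * (|t| * |U k|)) ^ 2 :=
                pow_succ_le_mul_sq (by positivity) (by linarith [hA k]) (by omega)
            _ ≤ 2 * ρ * (2 * (|t| * |U k|)) ^ 2 := by gcongr
            _ = 8 * ρ * t ^ 2 * U k ^ 2 := by
                rw [mul_pow, mul_pow, sq_abs, sq_abs]; ring
            _ ≤ _ := le_add_of_nonneg_left (by positivity)
      · have h1 : |x k| + |y k| ≤ 1 := by linarith [hp k, hq k]
        calc (|x k| + |y k|) ^ (κ + 1) ≤ (|x k| + |y k|) ^ 2 :=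
              pow_le_pow_of_le_one (by positivity) h1 (by omega)
          _ ≤ 2 * x k ^ 2 + 2 * y k ^ 2 := by
              rw [← sq_abs (x k), ← sq_abs (y k)]
              nlinarith [sq_nonneg (|x k| - |y k|)]
    refine (Finset.sum_le_sum fun k _ => hterm k).trans ?_
    rw [← Finset.mul_sum, Finset.sum_add_distrib, Finset.sum_add_distrib, Finset.sum_add_distrib,
      ← Finset.mul_sum, ← Finset.mul_sum, ← Finset.mul_sum, ← Finset.mul_sum]
    have e1 : ∑ k ∈ s, U k ^ 2 ≤ N ^ 2 := sum_sq_le_ell2 U s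
    have e2 : ∑ k ∈ s, x k ^ 2 ≤ D ^ 2 := (sum_sq_le_ell2 x s).trans (by gcongr)
    have e3 : ∑ k ∈ s, y k ^ 2 ≤ D ^ 2 := (sum_sq_le_ell2 y s).trans (by gcongr)
    have e4 : 2 ^ (κ + 1) * b n ^ (κ - 1) * ∑ k ∈ s, U k ^ 2 ≤ 1 := by
      rw [lt_div_iff₀' (by positivity)] at hpn
      refine le_trans ?_ hpn.le
      rw [mul_assoc]
      gcongr
    have e5 : 8 * ρ * t ^ 2 * ∑ k ∈ s, U k ^ 2 ≤ 8 * ρ * (t * N) ^ 2 := by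
      rw [mul_pow, ← mul_assoc]; gcongr
    gcongr
    linarith
  refine ⟨?_, fun t ht => ?_⟩
  · obtain ⟨k1, k2⟩ := key 0 (by simpa using hρ0.le)
    exact (M.norm_tiltTransform_sub_le hC₀ (u n) p q 0 k1 k2).1
  · obtain ⟨k1, k2⟩ := key t ht
    have h := (M.norm_tiltTransform_sub_le hC₀ (u n) p q t k1 k2).2
    have h4 := (norm_le_norm_add_norm_sub' _ _).trans (add_le_add_right h _)
    refine h4.trans ?_
    rw [show ∀ u v : ℝ, u + u * (v - 1) = u * v by intros; ring, norm_exp_tiltExponent,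
      ← Real.exp_add]
    refine Real.exp_le_exp.mpr ?_
    have g1 : ‖x‖ ^ 2 ≤ D ^ 2 := by gcongr
    -- From ‖tU‖² ≤ 2‖tU + y‖² + 2‖y‖²: the perturbation y costs half of the decay and a constant.
    have g2 : (t * N) ^ 2 / 2 - D ^ 2 ≤ ‖t • U + y‖ ^ 2 := by
      have : ‖t • U‖ ^ 2 ≤ 2 * ‖t • U + y‖ ^ 2 + 2 * ‖y‖ ^ 2 := by
        have h1 : ‖t • U‖ ≤ ‖t • U + y‖ + ‖y‖ := by
          simpa using norm_sub_le (t • U + y) y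
        nlinarith [sq_nonneg (‖t • U + y‖ - ‖y‖), norm_nonneg (t • U), norm_nonneg y,
          norm_nonneg (t • U + y)]
      rw [norm_smul, mul_pow, Real.norm_eq_abs, sq_abs, ← mul_pow] at this
      have h2 : ‖y‖ ^ 2 ≤ D ^ 2 := by gcongr
      linarith
    have g3 : v / 2 * (2 * inner ℝ U x + ‖x‖ ^ 2 - ‖t • U + y‖ ^ 2)
        ≤ v / 2 * (2 * D + 2 * D ^ 2 - (t * N) ^ 2 / 2) :=
      mul_le_mul_of_nonneg_left (by linarith) (by positivity)
    have g4 : C₀ * (2 ^ κ * (1 + 8 * ρ * (t * N) ^ 2 + 4 * D ^ 2))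
        = C₀ * (2 ^ κ * (1 + 4 * D ^ 2)) + C₀ * (2 ^ κ * (8 * ρ)) * (t * N) ^ 2 := by ring
    have g5 := mul_le_mul_of_nonneg_right hρ2 (sq_nonneg (t * N))
    rw [g4]
    linarith

/-- The limit of the transforms at frequencies of order `1 / ‖u n‖`. -/
theorem IsTiltSequence.tendsto_tiltTransform (M : IsLongMemoryModel P F Z a α)
    {u : ℕ → ℕ →₀ ℝ} {b : ℕ → ℝ} (hu : IsTiltSequence a (kappa α) u b)
    {q : ℕ → ℕ →₀ ℝ} {r : ℕ → ℝ} (hqr : ∀ n k, |linVec a (q n) k| ≤ r n)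
    (hr : Tendsto r atTop (𝓝 0)) {s2 m : ℝ}
    (hs : Tendsto (fun n => ‖linVec a (q n)‖ ^ 2) atTop (𝓝 s2))
    (hm : Tendsto (fun n => inner ℝ (linVec a (u n)) (linVec a (q n))) atTop (𝓝 m)) (t : ℝ) :
    Tendsto (fun n => tiltTransform P F Z a (u n) 0 (q n) (t / ‖linVec a (u n)‖)) atTop
      (𝓝 (Complex.exp ((-(noiseVariance F / 2 * t ^ 2) : ℝ)
        + ((-(noiseVariance F / 2 * s2) : ℝ) + (noiseVariance F * m : ℝ) * Complex.I)))) := by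
  have := M.isProb_law
  obtain ⟨C₀, hC₀⟩ : ∃ C, IsGaussianBound F (kappa α) C := M.moments.exists_complexMGF_bound M.exp
  have hκ := two_le_kappa M.half_lt M.lt_one
  set κ := kappa α
  set v := noiseVariance F
  set N : ℕ → ℝ := fun n => ‖linVec a (u n)‖ with hN
  have htN : Tendsto (fun n => t / N n) atTop (𝓝 0) := tendsto_const_nhds.div_atTop hu.norm_tendsto
  set S : ℕ → ℝ := fun n => 2 ^ κ * (2 ^ (κ + 1) * (b n ^ (κ - 1) * N n ^ 2)
    + r n ^ (κ - 1) * ‖linVec a (q n)‖ ^ 2) with hS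
  have hS0 : Tendsto S atTop (𝓝 0) := by
    have h1 := (hu.tendsto_pow.const_mul (2 ^ (κ + 1))).add ((hr.pow (κ - 1)).mul hs)
    have h2 := h1.const_mul (2 ^ κ)
    rwa [zero_pow (by omega), mul_zero, zero_mul, add_zero, mul_zero] at h2
  have hexp : Tendsto (fun n => tiltExponent F a (u n) 0 (q n) (t / N n)) atTop
      (𝓝 ((-(v / 2 * t ^ 2) : ℝ) + ((-(v / 2 * s2) : ℝ) + (v * m : ℝ) * Complex.I))) := by
    -- The cross term carries a factor 1/‖u n‖ and a bounded inner product, so it vanishes. This is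
    -- the asymptotic independence of the tilted functional and the increments.
    have e1 : Tendsto (fun n => -(v / 2 * t ^ 2) + -(v / 2 * ‖linVec a (q n)‖ ^ 2)
        - v * (t / N n * inner ℝ (linVec a (u n)) (linVec a (q n)))) atTop
        (𝓝 (-(v / 2 * t ^ 2) + -(v / 2 * s2))) := by
      have := ((hs.const_mul (v / 2)).neg.const_add (-(v / 2 * t ^ 2))).sub
        ((htN.mul hm).const_mul v)
      rwa [zero_mul, mul_zero, sub_zero] at this
    have e2 := ((Complex.continuous_ofReal.tendsto _).comp e1).add
      (((Complex.continuous_ofReal.tendsto _).comp (hm.const_mul v)).mul_const Complex.I)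
    rw [← add_assoc, ← Complex.ofReal_add]
    refine e2.congr' ?_
    filter_upwards [hu.norm_tendsto.eventually_gt_atTop 0] with n hn
    rw [tiltExponent_eq, norm_add_sq_real, norm_smul, mul_pow, Real.norm_eq_abs, sq_abs]
    simp only [Function.comp, linVec_zero, inner_zero_right, norm_zero, inner_zero_left,
      real_inner_smul_left]
    have : N n ≠ 0 := hn.ne'
    congr 3
    · change _ = v / 2 * (2 * 0 + 0 ^ 2 - ((t / N n) ^ 2 * N n ^ 2 + _ + _))
      field_simp
      ring
    · rw [add_zero]
  have hE := (Complex.continuous_exp.tendsto _).comp hexp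
  have hdiff : Tendsto (fun n => tiltTransform P F Z a (u n) 0 (q n) (t / N n)
      - Complex.exp (tiltExponent F a (u n) 0 (q n) (t / N n))) atTop (𝓝 0) := by
    have hbd : Tendsto (fun n => ‖Complex.exp (tiltExponent F a (u n) 0 (q n) (t / N n))‖
        * (Real.exp (C₀ * S n) - 1)) atTop (𝓝 0) := by
      have h1 : Tendsto (fun n => Real.exp (C₀ * S n) - 1) atTop (𝓝 0) := by
        have := ((Real.continuous_exp.tendsto _).comp (hS0.const_mul C₀)).sub_const 1
        simpa using this
      simpa using hE.norm.mul h1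
    refine squeeze_zero_norm' ?_ hbd
    have ht1 : ∀ᶠ n in atTop, |t / N n| < 1 := by
      have := htN.abs
      rw [abs_zero] at this
      exact this.eventually_lt_const one_pos
    filter_upwards [ht1, hu.tendsto_zero.eventually_lt_const (show (0 : ℝ) < 1 / 8 by norm_num),
      hr.eventually_lt_const (show (0 : ℝ) < 1 / 4 by norm_num)] with n h1 h2 h3
    have hU := hu.abs_le n
    refine (M.norm_tiltTransform_sub_le hC₀ (u n) 0 (q n) (t / N n) (S := S n) ?_ ?_).2
    · intro k
      have hz : (0 : ell2) k = 0 := rfl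
      rw [linVec_zero, hz, abs_zero, zero_add]
      nlinarith [hU k, hqr n k, abs_nonneg (linVec a (u n) k), abs_nonneg (t / N n)]
    · intro s
      have hterm : ∀ k, ((1 + |t / N n|) * |linVec a (u n) k|
          + (|linVec a 0 k| + |linVec a (q n) k|)) ^ (κ + 1)
          ≤ 2 ^ κ * (2 ^ (κ + 1) * (b n ^ (κ - 1) * linVec a (u n) k ^ 2)
            + r n ^ (κ - 1) * linVec a (q n) k ^ 2) := by
        intro k
        have hz : (0 : ell2) k = 0 := rfl
        rw [linVec_zero, hz, abs_zero, zero_add]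
        refine (add_pow_le (by positivity) (by positivity) (κ + 1)).trans ?_
        rw [Nat.add_sub_cancel]
        gcongr
        · calc ((1 + |t / N n|) * |linVec a (u n) k|) ^ (κ + 1)
              ≤ (2 * |linVec a (u n) k|) ^ (κ + 1) := by
                gcongr
                linarith
            _ = 2 ^ (κ + 1) * |linVec a (u n) k| ^ (κ + 1) := mul_pow _ _ _
            _ ≤ 2 ^ (κ + 1) * (b n ^ (κ - 1) * |linVec a (u n) k| ^ 2) := by
                gcongr
                exact pow_succ_le_mul_sq (abs_nonneg _) (hU k) (by omega)
            _ = _ := by rw [sq_abs]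
        · rw [← sq_abs (linVec a (q n) k)]
          exact pow_succ_le_mul_sq (abs_nonneg _) (hqr n k) (by omega)
      refine (Finset.sum_le_sum fun k _ => hterm k).trans ?_
      have hbn : 0 ≤ b n := (abs_nonneg _).trans (hU 0)
      have hrn : 0 ≤ r n := (abs_nonneg _).trans (hqr n 0)
      rw [← Finset.mul_sum, Finset.sum_add_distrib, ← Finset.mul_sum, ← Finset.mul_sum,
        ← Finset.mul_sum]
      simp only [hS]
      gcongr
      · exact sum_sq_le_ell2 _ s
      · exact sum_sq_le_ell2 _ s
  have := hdiff.add hE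
  rw [zero_add] at this
  refine this.congr fun n => ?_
  simp only [Function.comp]
  ring

end Tilt

/-! ### The Cauchy kernel -/

lemma integrable_exp_neg_mul_abs {c : ℝ} (hc : 0 < c) :
    Integrable fun x : ℝ => Real.exp (-(c * |x|)) := by
  rw [← integrableOn_univ, ← Set.Iic_union_Ioi (a := (0 : ℝ))]
  refine IntegrableOn.union ?_ ?_
  · refine (integrableOn_exp_mul_Iic hc 0).congr_fun (fun x hx => ?_) measurableSet_Iic
    change Real.exp (c * x) = _
    rw [abs_of_nonpos hx]
    ring_nf
  · refine (integrableOn_exp_mul_Ioi (neg_neg_of_pos hc) 0).congr_fun (fun x hx => ?_)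
      measurableSet_Ioi
    change Real.exp (-c * x) = _
    rw [abs_of_pos hx]
    ring_nf

lemma integral_exp_neg_abs_mul_cexp (y : ℝ) :
    ∫ x : ℝ, (Real.exp (-|x|) : ℂ) * Complex.exp (x * y * Complex.I)
      = ((2 * (1 + y ^ 2)⁻¹ : ℝ) : ℂ) := by
  have h1 : ∫ x in Set.Iic (0 : ℝ), (Real.exp (-|x|) : ℂ) * Complex.exp (x * y * Complex.I)
      = 1 / (1 + y * Complex.I) := by
    have := integral_exp_mul_complex_Iic (a := 1 + y * Complex.I) (by simp) 0
    rw [Complex.ofReal_zero, mul_zero, Complex.exp_zero] at this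
    rw [← this]
    refine setIntegral_congr_fun measurableSet_Iic fun x hx => ?_
    simp only [abs_of_nonpos (Set.mem_Iic.mp hx), Complex.ofReal_exp, ← Complex.exp_add]
    congr 1
    push_cast
    ring
  have h2 : ∫ x in Set.Ioi (0 : ℝ), (Real.exp (-|x|) : ℂ) * Complex.exp (x * y * Complex.I)
      = 1 / (1 - y * Complex.I) := by
    have := integral_exp_mul_complex_Ioi (a := -(1 - y * Complex.I)) (by simp) 0
    rw [Complex.ofReal_zero, mul_zero, Complex.exp_zero, neg_div_neg_eq] at this
    rw [← this]
    refine setIntegral_congr_fun measurableSet_Ioi fun x hx => ?_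
    simp only [abs_of_pos (Set.mem_Ioi.mp hx), Complex.ofReal_exp, ← Complex.exp_add]
    congr 1
    push_cast
    ring
  have hint : Integrable fun x : ℝ => (Real.exp (-|x|) : ℂ) * Complex.exp (x * y * Complex.I) := by
    have h0 : Integrable fun x : ℝ => Real.exp (-|x|) := by
      simpa using integrable_exp_neg_mul_abs one_pos
    refine h0.mono' (Continuous.aestronglyMeasurable (by fun_prop)) (ae_of_all _ fun x => ?_)
    rw [norm_mul, Complex.norm_real, Real.norm_of_nonneg (Real.exp_pos _).le,
      ← Complex.ofReal_mul, Complex.norm_exp_ofReal_mul_I, mul_one]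
  rw [← setIntegral_univ, ← Set.Iic_union_Ioi (a := (0 : ℝ)),
    setIntegral_union (Set.Iic_disjoint_Ioi le_rfl) measurableSet_Ioi hint.integrableOn
      hint.integrableOn, h1, h2]
  have e1 : (1 + (y : ℂ) * Complex.I) * (1 - y * Complex.I) = ((1 + y ^ 2 : ℝ) : ℂ) := by
    push_cast
    linear_combination -(y : ℂ) ^ 2 * Complex.I_sq
  have e0 : ((1 + y ^ 2 : ℝ) : ℂ) ≠ 0 := by
    rw [Complex.ofReal_ne_zero]; positivity
  have e2 : 1 + (y : ℂ) * Complex.I ≠ 0 := fun h => by rw [h, zero_mul] at e1; exact e0 e1.symm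
  have e3 : 1 - (y : ℂ) * Complex.I ≠ 0 := fun h => by rw [h, mul_zero] at e1; exact e0 e1.symm
  rw [div_add_div _ _ e2 e3, e1, Complex.ofReal_mul, Complex.ofReal_inv]
  field_simp
  push_cast
  ring

/-- The characteristic function of the Cauchy distribution. -/
theorem integral_inv_one_add_sq_mul_cexp (ξ : ℝ) :
    ∫ y : ℝ, (((1 + y ^ 2)⁻¹ : ℝ) : ℂ) * Complex.exp (ξ * y * Complex.I)
      = (Real.pi * Real.exp (-|ξ|) : ℝ) := by
  -- Fourier inversion applied to e^{-|x|}, whose transform is integrable. The substitution y = 2πv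
  -- absorbs the 2π in the exponent of the Fourier transform.
  set f : ℝ → ℂ := fun x => (Real.exp (-|x|) : ℂ) with hf
  have hfc : Continuous f := by fun_prop
  have hfi : Integrable f := by
    have := (integrable_exp_neg_mul_abs one_pos).ofReal (𝕜 := ℂ)
    simpa [hf] using this
  have hF : FourierTransform.fourier f
      = fun w : ℝ => ((2 * (1 + (2 * Real.pi * w) ^ 2)⁻¹ : ℝ) : ℂ) := by
    ext w
    have h2 := integral_exp_neg_abs_mul_cexp (-2 * Real.pi * w)
    rw [show (-2 * Real.pi * w) ^ 2 = (2 * Real.pi * w) ^ 2 by ring] at h2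
    rw [Real.fourier_eq', ← h2]
    refine integral_congr_ae (ae_of_all _ fun x => ?_)
    simp only [hf, smul_eq_mul]
    rw [mul_comm]
    congr 2
    simp
    ring
  have hFi : Integrable (FourierTransform.fourier f) := by
    rw [hF]
    have h1 : Integrable fun w : ℝ => (1 + (2 * Real.pi * w) ^ 2)⁻¹ :=
      integrable_inv_one_add_sq.comp_mul_left' (by positivity)
    exact (h1.const_mul 2).ofReal
  have hinv := congrFun (hfc.fourierInv_fourier_eq hfi hFi) ξ
  rw [Real.fourierInv_eq', hF] at hinv
  have hsub := Measure.integral_comp_mul_left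
    (fun y : ℝ => (((1 + y ^ 2)⁻¹ : ℝ) : ℂ) * Complex.exp (ξ * y * Complex.I)) (2 * Real.pi)
  have h3 : ∫ v : ℝ, Complex.exp (((2 * Real.pi * inner ℝ v ξ : ℝ) : ℂ) * Complex.I) •
        ((2 * (1 + (2 * Real.pi * v) ^ 2)⁻¹ : ℝ) : ℂ)
      = 2 * ∫ v : ℝ, (((1 + (2 * Real.pi * v) ^ 2)⁻¹ : ℝ) : ℂ)
          * Complex.exp (ξ * (2 * Real.pi * v : ℝ) * Complex.I) := by
    rw [← integral_const_mul]
    refine integral_congr_ae (ae_of_all _ fun v => ?_)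
    have : (((2 * Real.pi * inner ℝ v ξ : ℝ) : ℂ) * Complex.I)
        = ξ * (2 * Real.pi * v : ℝ) * Complex.I := by
      simp
      ring
    simp only [this, smul_eq_mul]
    push_cast
    ring
  rw [h3, hsub, abs_of_pos (by positivity)] at hinv
  have hpi : (Real.pi : ℂ) ≠ 0 := by exact_mod_cast Real.pi_ne_zero
  simp only [hf, Complex.real_smul] at hinv
  rw [Complex.ofReal_mul, ← hinv, mul_left_comm, ← mul_assoc, ← mul_assoc]
  push_cast
  rw [show 2 * (Real.pi : ℂ) * (2 * (Real.pi : ℂ))⁻¹ = 1 by field_simp, one_mul]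

lemma inv_one_add_sq_eq (y : ℝ) : (((1 + y ^ 2)⁻¹ : ℝ) : ℂ)
    = 1 / 2 * ∫ x : ℝ, (Real.exp (-|x|) : ℂ) * Complex.exp (x * y * Complex.I) := by
  rw [integral_exp_neg_abs_mul_cexp]
  push_cast
  ring

section Kernel

variable {Ω : Type*} [MeasurableSpace Ω] {P : Measure Ω}

/-- Weighting with the Cauchy kernel, in terms of transforms. -/
lemma integral_cauchy_kernel [SFinite P] {Y U W : Ω → ℝ} (hY : AEMeasurable Y P) (hU : AEMeasurable U P)
    (hW : AEMeasurable W P) (hint : Integrable (fun ω => Real.exp (Y ω + U ω)) P) (ξ : ℝ) :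
    ∫ ω, ((Real.exp (Y ω + U ω) * (1 + Y ω ^ 2)⁻¹ : ℝ) : ℂ)
        * Complex.exp ((ξ * Y ω + W ω : ℝ) * Complex.I) ∂P
      = 1 / 2 * ∫ t : ℝ, (Real.exp (-|t - ξ|) : ℂ) *
          ∫ ω, Complex.exp ((1 + t * Complex.I) * Y ω + U ω + W ω * Complex.I) ∂P := by
  set G : Ω → ℝ → ℂ := fun ω t => (Real.exp (-|t - ξ|) : ℂ) *
    Complex.exp ((1 + t * Complex.I) * Y ω + U ω + W ω * Complex.I) with hG
  have h1 : ∀ ω, ((Real.exp (Y ω + U ω) * (1 + Y ω ^ 2)⁻¹ : ℝ) : ℂ)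
        * Complex.exp ((ξ * Y ω + W ω : ℝ) * Complex.I) = 1 / 2 * ∫ t : ℝ, G ω t := by
    intro ω
    have hs := integral_add_right_eq_self (μ := volume) (G ω) ξ
    rw [← hs, Complex.ofReal_mul, inv_one_add_sq_eq, mul_left_comm, mul_assoc]
    congr 1
    rw [mul_right_comm, ← integral_const_mul]
    refine integral_congr_ae (ae_of_all _ fun t => ?_)
    simp only [hG, add_sub_cancel_right]
    rw [mul_left_comm]
    congr 1
    rw [Complex.ofReal_exp, ← Complex.exp_add, ← Complex.exp_add]
    congr 1
    push_cast
    ring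
  have hm : AEStronglyMeasurable (Function.uncurry G) (P.prod volume) := by
    have hY' : AEMeasurable (fun z : Ω × ℝ => Y z.1) (P.prod volume) := hY.comp_fst
    have hU' : AEMeasurable (fun z : Ω × ℝ => U z.1) (P.prod volume) := hU.comp_fst
    have hW' : AEMeasurable (fun z : Ω × ℝ => W z.1) (P.prod volume) := hW.comp_fst
    have : AEMeasurable (fun z : Ω × ℝ => (Real.exp (-|z.2 - ξ|) : ℂ) *
        Complex.exp ((1 + z.2 * Complex.I) * Y z.1 + U z.1 + W z.1 * Complex.I))
        (P.prod volume) := by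
      fun_prop
    exact this.aestronglyMeasurable
  -- The modulus of the exponential factor does not depend on t, so the double integrand is bounded
  -- by a product of an integrable function of ω and e^{-|t-ξ|}.
  have hGi : Integrable (Function.uncurry G) (P.prod volume) := by
    have hk : Integrable fun t : ℝ => Real.exp (-|t - ξ|) := by
      have := (integrable_exp_neg_mul_abs one_pos).comp_sub_right ξ
      simpa using this
    refine (hint.mul_prod hk).mono' hm (ae_of_all _ fun z => ?_)
    simp only [Function.uncurry, hG]
    rw [norm_mul, Complex.norm_real, Real.norm_of_nonneg (Real.exp_pos _).le, Complex.norm_exp,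
      mul_comm]
    simp
  simp_rw [h1]
  rw [integral_const_mul, integral_integral_swap hGi]
  congr 1
  refine integral_congr_ae (ae_of_all _ fun t => ?_)
  simp only [hG]
  rw [integral_const_mul]

end Kernel

/-! ### Laplace's method and weak limits under the tilted density -/

section Tilt

variable {Ω : Type*} [MeasurableSpace Ω] {P : Measure Ω} {F : Measure ℝ}
  {Z : ℤ → Ω → ℝ} {a : ℕ → ℝ} {α : ℝ}

lemma integral_exp_neg_mul_abs {c : ℝ} (hc : 0 < c) :
    ∫ x : ℝ, Real.exp (-(c * |x|)) = 2 / c := by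
  rw [integral_comp_abs (f := fun x => Real.exp (-(c * x)))]
  have h := integral_exp_mul_Ioi (neg_neg_of_pos hc) 0
  simp only [mul_zero, Real.exp_zero, neg_mul, neg_div_neg_eq] at h
  rw [h, mul_one_div]

/-- Low frequencies contribute a Gaussian integral of size √(π/c)/N. At high frequencies |t| exceeds
ρ/b: half of the decay e^{-|t|} gives the factor e^{-ρ/(2b)}, and the other half has integral 4. -/
lemma integral_mul_exp_neg_abs_mul_norm_le {E : Type*} [NormedAddCommGroup E] {N b ρ c C : ℝ}
    (hN : 0 < N) (hb : 0 < b) (hc : 0 < c) {Ψ : ℝ → E}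
    (hΨ : AEStronglyMeasurable Ψ)
    (h1 : ∀ t, |t| * b ≤ ρ → ‖Ψ t‖ ≤ Real.exp (C - c * (t * N) ^ 2))
    (h2 : ∀ t, ‖Ψ t‖ ≤ Real.exp C) :
    N * ∫ t : ℝ, Real.exp (-|t|) * ‖Ψ t‖
      ≤ Real.exp C * (√(Real.pi / c) + 4 * (N * Real.exp (-(ρ / 2 / b)))) := by
  have hG : Integrable fun t : ℝ => Real.exp (-(c * N ^ 2) * t ^ 2) :=
    integrable_exp_neg_mul_sq (by positivity)
  have hL : Integrable fun t : ℝ => Real.exp (-(1 / 2 * |t|)) :=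
    integrable_exp_neg_mul_abs (by norm_num)
  have hLval : ∫ t : ℝ, Real.exp (-(1 / 2 * |t|)) = 4 := by
    rw [integral_exp_neg_mul_abs (by norm_num)]
    norm_num
  have hpt : ∀ t : ℝ, Real.exp (-|t|) * ‖Ψ t‖ ≤ Real.exp C * Real.exp (-(c * N ^ 2) * t ^ 2)
      + Real.exp C * Real.exp (-(ρ / 2 / b)) * Real.exp (-(1 / 2 * |t|)) := by
    intro t
    by_cases ht : |t| * b ≤ ρ
    · refine le_add_of_le_of_nonneg ?_ (by positivity)
      calc Real.exp (-|t|) * ‖Ψ t‖ ≤ 1 * Real.exp (C - c * (t * N) ^ 2) := by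
            gcongr
            · exact Real.exp_le_one_iff.mpr (neg_nonpos.mpr (abs_nonneg t))
            · exact h1 t ht
        _ = _ := by rw [one_mul, ← Real.exp_add]; ring_nf
    · refine le_add_of_nonneg_of_le (by positivity) ?_
      have ht' : ρ / 2 / b ≤ 1 / 2 * |t| := by
        rw [div_le_iff₀ hb]
        linarith
      calc Real.exp (-|t|) * ‖Ψ t‖ ≤ Real.exp (-(1 / 2 * |t|) + -(1 / 2 * |t|)) * Real.exp C := by
            gcongr
            · linarith
            · exact h2 t
        _ ≤ Real.exp (-(ρ / 2 / b) + -(1 / 2 * |t|)) * Real.exp C := by gcongr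
        _ = _ := by rw [Real.exp_add]; ring
  have hint := (hG.const_mul (Real.exp C)).add
    (hL.const_mul (Real.exp C * Real.exp (-(ρ / 2 / b))))
  have hm : AEStronglyMeasurable fun t : ℝ => Real.exp (-|t|) * ‖Ψ t‖ :=
    (Continuous.aestronglyMeasurable (by fun_prop)).mul hΨ.norm
  have hle : ∫ t : ℝ, Real.exp (-|t|) * ‖Ψ t‖ ≤ Real.exp C * √(Real.pi / (c * N ^ 2))
      + Real.exp C * Real.exp (-(ρ / 2 / b)) * 4 := by
    have e := integral_add (hG.const_mul (Real.exp C))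
      (hL.const_mul (Real.exp C * Real.exp (-(ρ / 2 / b))))
    rw [integral_const_mul, integral_const_mul, integral_gaussian, hLval] at e
    rw [← e]
    refine integral_mono (hint.mono' hm (ae_of_all _ fun t => ?_)) hint hpt
    rw [Real.norm_of_nonneg (by positivity)]
    exact hpt t
  calc _ ≤ N * (Real.exp C * √(Real.pi / (c * N ^ 2))
        + Real.exp C * Real.exp (-(ρ / 2 / b)) * 4) := by gcongr
    _ = _ := by
        rw [← div_div, Real.sqrt_div' _ (by positivity), Real.sqrt_sq hN.le]
        field_simp

/-- Laplace's method for transforms which are close to Gaussian ones after rescaling. -/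
lemma tendsto_mul_integral_exp_neg_abs {N b : ℕ → ℝ} {ρ c C : ℝ} (hN : Tendsto N atTop atTop)
    (hb : ∀ᶠ n in atTop, 0 < b n) (hb0 : Tendsto b atTop (𝓝 0)) (hρ : 0 < ρ) (hc : 0 < c)
    (hNb : ∀ δ, 0 < δ → Tendsto (fun n => N n * Real.exp (-(δ / b n))) atTop (𝓝 0))
    {Ψ : ℕ → ℝ → ℂ} {g : ℝ → ℂ} (hΨ : ∀ᶠ n in atTop, Continuous (Ψ n))
    (h1 : ∀ᶠ n in atTop, ∀ t, |t| * b n ≤ ρ → ‖Ψ n t‖ ≤ Real.exp (C - c * (t * N n) ^ 2))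
    (h2 : ∀ᶠ n in atTop, ∀ t, ‖Ψ n t‖ ≤ Real.exp C)
    (hlim : ∀ s, Tendsto (fun n => Ψ n (s / N n)) atTop (𝓝 (g s))) (ξ : ℝ) :
    Tendsto (fun n => (N n : ℂ) * ∫ t : ℝ, (Real.exp (-|t - ξ|) : ℂ) * Ψ n t) atTop
      (𝓝 ((Real.exp (-|ξ|) : ℂ) * ∫ s, g s)) := by
  set f : ℕ → ℝ → ℂ := fun n s => (Real.exp (-|s / N n - ξ|) : ℂ) * Ψ n (s / N n) with hf
  set A : ℕ → Set ℝ := fun n => {s | |s / N n| * b n ≤ ρ} with hA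
  have hAm : ∀ n, MeasurableSet (A n) := fun n =>
    measurableSet_le (by fun_prop) measurable_const
  have hNpos : ∀ᶠ n in atTop, 0 < N n := hN.eventually_gt_atTop 0
  have hfm : ∀ᶠ n in atTop, AEStronglyMeasurable (f n) := by
    filter_upwards [hΨ] with n hn
    exact Continuous.aestronglyMeasurable (by fun_prop)
  have hexple : ∀ n s, Real.exp (-|s / N n - ξ|) ≤ Real.exp |ξ| * Real.exp (-|s / N n|) := by
    intro n s
    rw [← Real.exp_add]
    refine Real.exp_le_exp.mpr ?_
    have := abs_sub_abs_le_abs_sub (s / N n) ξ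
    linarith
  have hnorm : ∀ n s, ‖f n s‖ = Real.exp (-|s / N n - ξ|) * ‖Ψ n (s / N n)‖ := fun n s => by
    simp only [hf]
    rw [norm_mul, Complex.norm_real, Real.norm_of_nonneg (Real.exp_pos _).le]
  have hG : Integrable fun s : ℝ => Real.exp (C - c * s ^ 2) := by
    have := (integrable_exp_neg_mul_sq hc).const_mul (Real.exp C)
    refine this.congr (ae_of_all _ fun s => ?_)
    simp only [← Real.exp_add]
    ring_nf
  -- After the substitution s = tN the low frequencies are dominated by a fixed Gaussian function,
  -- the kernel tends to e^{-|ξ|}, and the truncation disappears because b tends to 0.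
  have hin : Tendsto (fun n => ∫ s, (A n).indicator (f n) s) atTop
      (𝓝 (∫ s, (Real.exp (-|ξ|) : ℂ) * g s)) := by
    refine tendsto_integral_filter_of_dominated_convergence
      (fun s => Real.exp (C - c * s ^ 2)) ?_ ?_ hG ?_
    · filter_upwards [hfm] with n hn using hn.indicator (hAm n)
    · filter_upwards [h1, hNpos] with n hn hnp
      refine ae_of_all _ fun s => ?_
      by_cases hs : s ∈ A n
      · rw [Set.indicator_of_mem hs, hnorm]
        have := hn (s / N n) hs
        rw [div_mul_cancel₀ _ hnp.ne'] at this
        calc _ ≤ 1 * Real.exp (C - c * s ^ 2) := by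
              gcongr
              exact Real.exp_le_one_iff.mpr (neg_nonpos.mpr (abs_nonneg _))
          _ = _ := one_mul _
      · rw [Set.indicator_of_notMem hs, norm_zero]
        positivity
    · refine ae_of_all _ fun s => ?_
      have hs0 : Tendsto (fun n => s / N n) atTop (𝓝 0) := tendsto_const_nhds.div_atTop hN
      have hmem : ∀ᶠ n in atTop, s ∈ A n := by
        have := hs0.abs.mul hb0
        rw [mul_zero] at this
        filter_upwards [this.eventually_lt_const hρ] with n hn using hn.le
      have hff : Tendsto (fun n => f n s) atTop (𝓝 ((Real.exp (-|ξ|) : ℂ) * g s)) := by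
        refine Tendsto.mul ?_ (hlim s)
        refine (Complex.continuous_ofReal.tendsto _).comp ((Real.continuous_exp.tendsto _).comp ?_)
        have := (hs0.sub_const ξ).abs.neg
        rwa [zero_sub, abs_neg] at this
      refine hff.congr' ?_
      filter_upwards [hmem] with n hn
      rw [Set.indicator_of_mem hn]
  -- At high frequencies the integral in s is at most a constant times N e^{-ρ/(2b)}, which tends to
  -- 0 by `hNb`.
  have hout : Tendsto (fun n => ∫ s, (A n)ᶜ.indicator (f n) s) atTop (𝓝 0) := by
    have hz := (hNb (ρ / 2) (by positivity)).const_mul (4 * (Real.exp |ξ| * Real.exp C))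
    rw [mul_zero] at hz
    refine squeeze_zero_norm' ?_ hz
    filter_upwards [h2, hNpos, hb] with n hn hnp hbp
    have hL : Integrable fun s : ℝ => Real.exp (-(1 / (2 * N n) * |s|)) :=
      integrable_exp_neg_mul_abs (by positivity)
    have hLval : ∫ s : ℝ, Real.exp (-(1 / (2 * N n) * |s|)) = 4 * N n := by
      rw [integral_exp_neg_mul_abs (by positivity)]
      field_simp
      norm_num
    have := norm_integral_le_of_norm_le (f := (A n)ᶜ.indicator (f n))
      (hL.const_mul (Real.exp |ξ| * Real.exp C * Real.exp (-(ρ / 2 / b n))))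
      (ae_of_all _ fun s => ?_)
    · rw [integral_const_mul, hLval] at this
      refine this.trans (le_of_eq ?_)
      ring
    · by_cases hs : s ∈ A n
      · rw [Set.indicator_of_notMem (Set.notMem_compl_iff.mpr hs), norm_zero]
        positivity
      · rw [Set.indicator_of_mem hs, hnorm]
        have hs' : ρ < |s / N n| * b n := not_le.mp hs
        have ht' : ρ / 2 / b n ≤ 1 / 2 * |s / N n| := by
          rw [div_le_iff₀ hbp]
          linarith
        have hsN : |s / N n| = |s| / N n := by rw [abs_div, abs_of_pos hnp]
        calc Real.exp (-|s / N n - ξ|) * ‖Ψ n (s / N n)‖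
            ≤ (Real.exp |ξ| * Real.exp (-|s / N n|)) * Real.exp C := by
              gcongr
              · exact hexple n s
              · exact hn _
          _ ≤ (Real.exp |ξ| * Real.exp (-(ρ / 2 / b n) + -(1 / (2 * N n) * |s|))) * Real.exp C := by
              gcongr
              have : 1 / (2 * N n) * |s| = 1 / 2 * |s / N n| := by
                rw [hsN]; field_simp
              rw [this]
              linarith
          _ = _ := by rw [Real.exp_add]; ring
  have hsum := hin.add hout
  rw [add_zero, integral_const_mul] at hsum
  refine hsum.congr' ?_
  filter_upwards [hΨ, h1, h2, hNpos, hb] with n hcont e1 e2 hnp hbp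
  have hfi : Integrable (f n) := by
    have hL : Integrable fun s : ℝ => Real.exp (-(1 / N n * |s|)) :=
      integrable_exp_neg_mul_abs (by positivity)
    refine (hL.const_mul (Real.exp |ξ| * Real.exp C)).mono'
      (Continuous.aestronglyMeasurable (by fun_prop)) (ae_of_all _ fun s => ?_)
    rw [hnorm]
    calc Real.exp (-|s / N n - ξ|) * ‖Ψ n (s / N n)‖
        ≤ (Real.exp |ξ| * Real.exp (-|s / N n|)) * Real.exp C := by
          gcongr
          · exact hexple n s
          · exact e2 _
      _ = _ := by
          rw [abs_div, abs_of_pos hnp]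
          ring_nf
  rw [← integral_add (hfi.indicator (hAm n)) (hfi.indicator (hAm n).compl)]
  simp_rw [Set.indicator_self_add_compl_apply]
  have := Measure.integral_comp_div
    (fun t : ℝ => (Real.exp (-|t - ξ|) : ℂ) * Ψ n t) (N n)
  rw [abs_of_pos hnp, Complex.real_smul] at this
  exact this

lemma IsLongMemoryModel.aemeasurable_tiltVar (M : IsLongMemoryModel P F Z a α) (u : ℕ →₀ ℝ) :
    AEMeasurable (tiltVar F Z a u) P :=
  (M.aemeasurable_linForm u).sub_const _

lemma integrable_exp_tiltVar_add {u p : ℕ →₀ ℝ}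
    (h : Integrable (fun ω => Real.exp (linForm (movingAverage a Z) (u + p) ω)) P) :
    Integrable (fun ω => Real.exp (tiltVar F Z a u ω + linForm (movingAverage a Z) p ω)) P := by
  refine (h.const_mul (Real.exp (-(noiseVariance F * ‖linVec a u‖ ^ 2)))).congr
    (ae_of_all _ fun ω => ?_)
  simp only [← Real.exp_add, tiltVar, linForm_add]
  congr 1
  ring

/-- The modulus of the integrand depends on neither t nor q. This controls the frequencies that are
too large for the Gaussian comparison by the value at frequency 0. -/
lemma norm_tiltTransform_le (u p q : ℕ →₀ ℝ) (t : ℝ) :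
    ‖tiltTransform P F Z a u p q t‖ ≤ ‖tiltTransform P F Z a u p 0 0‖ := by
  rw [tiltTransform, tiltTransform, norm_mul, norm_mul]
  refine mul_le_mul_of_nonneg_left ?_ (norm_nonneg _)
  refine (norm_integral_le_integral_norm _).trans (le_of_eq ?_)
  have h1 : ∀ ω, ‖Complex.exp ((1 + t * Complex.I) * tiltVar F Z a u ω
      + linForm (movingAverage a Z) p ω + linForm (movingAverage a Z) q ω * Complex.I)‖
      = Real.exp (tiltVar F Z a u ω + linForm (movingAverage a Z) p ω) := fun ω => by
    rw [Complex.norm_exp]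
    simp
  have h2 : ∀ ω, Complex.exp ((1 + (0 : ℝ) * Complex.I) * tiltVar F Z a u ω
      + linForm (movingAverage a Z) p ω + linForm (movingAverage a Z) 0 ω * Complex.I)
      = ((Real.exp (tiltVar F Z a u ω + linForm (movingAverage a Z) p ω) : ℝ) : ℂ) := fun ω => by
    rw [linForm_zero]
    push_cast
    simp
  simp_rw [h1, h2]
  rw [integral_complex_ofReal, Complex.norm_real, Real.norm_of_nonneg]
  exact integral_nonneg fun ω => (Real.exp_pos _).le

lemma IsLongMemoryModel.continuous_tiltTransform (M : IsLongMemoryModel P F Z a α)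
    {u p : ℕ →₀ ℝ} (q : ℕ →₀ ℝ)
    (h : Integrable (fun ω => Real.exp (linForm (movingAverage a Z) (u + p) ω)) P) :
    Continuous (tiltTransform P F Z a u p q) := by
  refine continuous_const.mul (continuous_of_dominated (fun t => ?_) (fun t => ?_)
    (integrable_exp_tiltVar_add (F := F) h) ?_)
  · have h1 := M.aemeasurable_tiltVar u
    have h2 := M.aemeasurable_linForm p
    have h3 := M.aemeasurable_linForm q
    exact AEMeasurable.aestronglyMeasurable (by fun_prop)
  · refine ae_of_all _ fun ω => ?_
    rw [Complex.norm_exp]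
    simp
  · exact ae_of_all _ fun ω => by fun_prop

/-- The density with respect to which the functionals of the moving average converge in law: the
exponential tilt of the Cauchy kernel. -/
noncomputable def tiltDensity (F : Measure ℝ) (Z : ℤ → Ω → ℝ) (a : ℕ → ℝ) (u : ℕ →₀ ℝ) (ω : Ω) :
    ℝ :=
  ‖linVec a u‖ * Real.exp (noiseVariance F * ‖linVec a u‖ ^ 2 / 2)
    * (Real.exp (tiltVar F Z a u ω) * (1 + tiltVar F Z a u ω ^ 2)⁻¹)

lemma tiltDensity_nonneg {Ω : Type*} (F : Measure ℝ) (Z : ℤ → Ω → ℝ) (a : ℕ → ℝ) (u : ℕ →₀ ℝ) (ω : Ω) :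
    0 ≤ tiltDensity F Z a u ω := by
  unfold tiltDensity
  positivity

lemma IsLongMemoryModel.aemeasurable_tiltDensity (M : IsLongMemoryModel P F Z a α)
    (u : ℕ →₀ ℝ) : AEMeasurable (tiltDensity F Z a u) P := by
  have h1 := M.aemeasurable_tiltVar u
  unfold tiltDensity
  fun_prop

lemma IsLongMemoryModel.integral_tiltDensity_mul (M : IsLongMemoryModel P F Z a α)
    (u p q : ℕ →₀ ℝ)
    (h : Integrable (fun ω => Real.exp (linForm (movingAverage a Z) (u + p) ω)) P) (ξ : ℝ) :
    ∫ ω, ((tiltDensity F Z a u ω * Real.exp (linForm (movingAverage a Z) p ω) : ℝ) : ℂ)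
        * Complex.exp ((ξ * tiltVar F Z a u ω + linForm (movingAverage a Z) q ω : ℝ) * Complex.I) ∂P
      = 1 / 2 * (‖linVec a u‖ *
          ∫ t : ℝ, (Real.exp (-|t - ξ|) : ℂ) * tiltTransform P F Z a u p q t) := by
  have := M.isProb
  have hk := integral_cauchy_kernel (M.aemeasurable_tiltVar u) (M.aemeasurable_linForm p)
    (M.aemeasurable_linForm q) (integrable_exp_tiltVar_add (F := F) h) ξ
  simp only [tiltTransform]
  simp_rw [mul_left_comm (Complex.ofReal (Real.exp (-|_ - ξ|)))]
  rw [integral_const_mul, mul_left_comm (1 / 2 : ℂ), mul_left_comm (1 / 2 : ℂ), ← hk,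
    ← integral_const_mul, ← integral_const_mul]
  refine integral_congr_ae (ae_of_all _ fun ω => ?_)
  simp only [tiltDensity, Real.exp_add]
  push_cast
  ring

/-- Limit of the characteristic functions under the density `tiltDensity`. -/
theorem IsTiltSequence.tendsto_integral_tiltDensity (M : IsLongMemoryModel P F Z a α)
    {u : ℕ → ℕ →₀ ℝ} {b : ℕ → ℝ} (hu : IsTiltSequence a (kappa α) u b)
    {q : ℕ → ℕ →₀ ℝ} {r : ℕ → ℝ} (hqr : ∀ n k, |linVec a (q n) k| ≤ r n)
    (hr : Tendsto r atTop (𝓝 0)) {s2 m : ℝ}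
    (hs : Tendsto (fun n => ‖linVec a (q n)‖ ^ 2) atTop (𝓝 s2))
    (hm : Tendsto (fun n => inner ℝ (linVec a (u n)) (linVec a (q n))) atTop (𝓝 m)) (ξ : ℝ) :
    Tendsto (fun n => ∫ ω, (tiltDensity F Z a (u n) ω : ℂ) * Complex.exp
        ((ξ * tiltVar F Z a (u n) ω + linForm (movingAverage a Z) (q n) ω : ℝ) * Complex.I) ∂P) atTop
      (𝓝 ((√(Real.pi / (noiseVariance F / 2)) / 2 * Real.exp (-|ξ|) : ℝ) *
        Complex.exp ((-(noiseVariance F / 2 * s2) : ℝ)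
          + (noiseVariance F * m : ℝ) * Complex.I))) := by
  have hv := M.variance_pos
  set v := noiseVariance F
  -- As ‖q n‖² tends to s2, the number √(s2 + 1) eventually bounds the norm of q n.
  obtain ⟨ρ, C, hρ, hev⟩ := hu.exists_norm_tiltTransform_le M (√(s2 + 1))
  have hz : ∀ k, |linVec a 0 k| ≤ ρ := fun k => by
    have : (0 : ell2) k = 0 := rfl
    rw [linVec_zero, this, abs_zero]
    exact hρ.le
  have hbase : ∀ᶠ n in atTop,
      Integrable (fun ω => Real.exp (linForm (movingAverage a Z) (u n + 0) ω)) P ∧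
      ∀ t : ℝ, |t| * b n ≤ ρ → ‖tiltTransform P F Z a (u n) 0 (q n) t‖
        ≤ Real.exp (C - v / 8 * (t * ‖linVec a (u n)‖) ^ 2) := by
    filter_upwards [hev, hr.eventually_lt_const hρ, hs.eventually_lt_const (lt_add_one s2)]
      with n h1 h2 h3
    refine h1 0 (q n) hz (fun k => (hqr n k).trans h2.le) (by simp [linVec_zero]) ?_
      (by simp [linVec_zero])
    rw [← Real.sqrt_sq (norm_nonneg _)]
    exact Real.sqrt_le_sqrt h3.le
  have hbd : ∀ᶠ n in atTop, ∀ t, ‖tiltTransform P F Z a (u n) 0 (q n) t‖ ≤ Real.exp C := by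
    filter_upwards [hev] with n h1 t
    refine (norm_tiltTransform_le _ _ _ _).trans ?_
    have := (h1 0 0 hz hz (by simp [linVec_zero]) (by simp [linVec_zero])
      (by simp [linVec_zero])).2 0 (by simpa using hρ.le)
    simpa using this
  have hlim := tendsto_mul_integral_exp_neg_abs hu.norm_tendsto hu.pos hu.tendsto_zero hρ
    (show 0 < v / 8 by positivity) hu.tendsto_exp
    (hbase.mono fun n hn => M.continuous_tiltTransform (q n) hn.1) (hbase.mono fun n hn => hn.2)
    hbd (hu.tendsto_tiltTransform M hqr hr hs hm) ξ
  have hval : ∫ t : ℝ, Complex.exp ((-(v / 2 * t ^ 2) : ℝ)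
        + ((-(v / 2 * s2) : ℝ) + (v * m : ℝ) * Complex.I))
      = (√(Real.pi / (v / 2)) : ℝ) * Complex.exp ((-(v / 2 * s2) : ℝ) + (v * m : ℝ) * Complex.I) := by
    simp_rw [Complex.exp_add]
    rw [integral_mul_const, ← integral_gaussian, ← integral_complex_ofReal]
    congr 1
    refine integral_congr_ae (ae_of_all _ fun t => ?_)
    simp only [← Complex.ofReal_exp, neg_mul]
  have h2 := hlim.const_mul (1 / 2 : ℂ)
  rw [hval] at h2
  refine Tendsto.congr' ?_ (h2.trans (le_of_eq ?_))
  · filter_upwards [hbase] with n hn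
    rw [← M.integral_tiltDensity_mul (u n) 0 (q n) hn.1 ξ]
    simp only [linForm_zero, Real.exp_zero, mul_one]
  · congr 1
    push_cast
    ring

/-- Uniform bound for exponential moments under the density `tiltDensity`. -/
theorem IsTiltSequence.exists_integral_tiltDensity_mul_exp_le (M : IsLongMemoryModel P F Z a α)
    {u : ℕ → ℕ →₀ ℝ} {b : ℕ → ℝ} (hu : IsTiltSequence a (kappa α) u b) (D : ℝ) :
    ∃ ρ K : ℝ, 0 < ρ ∧ ∀ᶠ n in atTop, ∀ p : ℕ →₀ ℝ, (∀ k, |linVec a p k| ≤ ρ) →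
      ‖linVec a p‖ ≤ D → inner ℝ (linVec a (u n)) (linVec a p) ≤ D →
      Integrable (fun ω => tiltDensity F Z a (u n) ω *
        Real.exp (linForm (movingAverage a Z) p ω)) P ∧
      ∫ ω, tiltDensity F Z a (u n) ω * Real.exp (linForm (movingAverage a Z) p ω) ∂P ≤ K := by
  have hv := M.variance_pos
  set v := noiseVariance F
  obtain ⟨ρ, C, hρ, hev⟩ := hu.exists_norm_tiltTransform_le M D
  have hz : ∀ k, |linVec a 0 k| ≤ ρ := fun k => by
    have : (0 : ell2) k = 0 := rfl
    rw [linVec_zero, this, abs_zero]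
    exact hρ.le
  -- The factor 1/2 comes from the Cauchy kernel, the root from the low frequencies, and the last 1
  -- bounds ‖u n‖e^{-ρ/(2b_n)} for large n.
  refine ⟨ρ, 1 / 2 * (Real.exp C * (√(Real.pi / (v / 8)) + 4 * 1)), hρ, ?_⟩
  filter_upwards [hev, hu.pos, hu.norm_tendsto.eventually_gt_atTop 0,
    (hu.tendsto_exp (ρ / 2) (by positivity)).eventually_lt_const one_pos] with n h1 hb hN hNb p
    hp hpD hup
  have hD : 0 ≤ D := (norm_nonneg _).trans hpD
  obtain ⟨hi, hbd⟩ := h1 p 0 hp hz hpD (by simpa [linVec_zero] using hD) hup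
  have hbd' : ∀ t, ‖tiltTransform P F Z a (u n) p 0 t‖ ≤ Real.exp C := fun t => by
    refine (norm_tiltTransform_le _ _ _ _).trans ?_
    have := hbd 0 (by simpa using hρ.le)
    simpa using this
  have hint := integrable_exp_tiltVar_add (F := F) hi
  refine ⟨?_, ?_⟩
  · refine (hint.const_mul (‖linVec a (u n)‖ *
      Real.exp (noiseVariance F * ‖linVec a (u n)‖ ^ 2 / 2))).mono' ?_ (ae_of_all _ fun ω => ?_)
    · have e1 := M.aemeasurable_tiltDensity (u n)
      have e2 := M.aemeasurable_linForm p
      exact AEMeasurable.aestronglyMeasurable (by fun_prop)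
    · rw [Real.norm_of_nonneg (mul_nonneg (tiltDensity_nonneg _ _ _ _ _) (Real.exp_pos _).le),
        tiltDensity, mul_assoc, Real.exp_add]
      refine mul_le_mul_of_nonneg_left ?_ (by positivity)
      refine mul_le_mul_of_nonneg_right (mul_le_of_le_one_right (Real.exp_pos _).le ?_)
        (Real.exp_pos _).le
      exact inv_le_one_of_one_le₀ (le_add_of_nonneg_right (sq_nonneg _))
  · have hrep := M.integral_tiltDensity_mul (u n) p 0 hi 0
    have h0 : ∀ ω, ((tiltDensity F Z a (u n) ω * Real.exp (linForm (movingAverage a Z) p ω) : ℝ) : ℂ)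
        * Complex.exp ((0 * tiltVar F Z a (u n) ω + linForm (movingAverage a Z) 0 ω : ℝ)
          * Complex.I)
        = ((tiltDensity F Z a (u n) ω * Real.exp (linForm (movingAverage a Z) p ω) : ℝ) : ℂ) :=
      fun ω => by rw [linForm_zero]; simp
    simp_rw [h0, sub_zero] at hrep
    rw [integral_complex_ofReal] at hrep
    have hcont := M.continuous_tiltTransform (F := F) 0 hi
    have hfin := integral_mul_exp_neg_abs_mul_norm_le hN hb (show 0 < v / 8 by positivity)
      hcont.aestronglyMeasurable hbd hbd'
    have hn := congrArg norm hrep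
    rw [Complex.norm_real] at hn
    refine (le_abs_self _).trans (hn.le.trans ?_)
    rw [norm_mul, norm_mul, Complex.norm_real, Real.norm_of_nonneg hN.le]
    refine mul_le_mul (by norm_num) ?_ (by positivity) (by norm_num)
    calc _ ≤ ‖linVec a (u n)‖ * ∫ t : ℝ, Real.exp (-|t|) * ‖tiltTransform P F Z a (u n) p 0 t‖ := by
          gcongr
          refine (norm_integral_le_integral_norm _).trans (le_of_eq ?_)
          refine integral_congr_ae (ae_of_all _ fun t => ?_)
          simp only [norm_mul, Complex.norm_real, Real.norm_of_nonneg (Real.exp_pos _).le]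
      _ ≤ _ := hfin.trans (by gcongr)

end Tilt

/-! ### The tilt of the partial sums and their increments -/

/-- The functional `X_j + ⋯ + X_{n+j-1}`. -/
noncomputable def blockCoeff (j n : ℕ) : ℕ →₀ ℝ := ∑ i ∈ Finset.Ico j (n + j), Finsupp.single i 1

/-- The exponential tilt `θ_n = n ε / (σ² V_n)` which moves the mean of the partial sum to `n ε`. -/
noncomputable def tiltRate (F : Measure ℝ) (a : ℕ → ℝ) (ε : ℝ) (n : ℕ) : ℝ :=
  (n * ε) / (noiseVariance F * ‖blockVec a 0 n‖ ^ 2)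

/-- The functional `θ_n (X_0 + ⋯ + X_{n-1})`. -/
noncomputable def tiltCoeff (F : Measure ℝ) (a : ℕ → ℝ) (ε : ℝ) (n : ℕ) : ℕ →₀ ℝ :=
  tiltRate F a ε n • blockCoeff 0 n

/-- The functional `θ_n ((X_j + ⋯ + X_{n+j-1}) - (X_i + ⋯ + X_{n+i-1}))`. -/
noncomputable def incrCoeff (F : Measure ℝ) (a : ℕ → ℝ) (ε : ℝ) (n i j : ℕ) : ℕ →₀ ℝ :=
  tiltRate F a ε n • (blockCoeff j n - blockCoeff i n)

lemma linVec_blockCoeff (a : ℕ → ℝ) (j n : ℕ) : linVec a (blockCoeff j n) = blockVec a j n := by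
  simp [linVec, blockCoeff, blockVec, map_sum]

lemma linForm_blockCoeff {Ω : Type*} (X : ℕ → Ω → ℝ) (j n : ℕ) (ω : Ω) :
    linForm X (blockCoeff j n) ω = ∑ i ∈ Finset.Ico j (n + j), X i ω := by
  simp [linForm, blockCoeff, map_sum]

lemma linVec_incrCoeff (F : Measure ℝ) (a : ℕ → ℝ) (ε : ℝ) (n i j : ℕ) :
    linVec a (incrCoeff F a ε n i j) = tiltRate F a ε n • (blockVec a j n - blockVec a i n) := by
  rw [incrCoeff, linVec_smul, linVec_sub, linVec_blockCoeff, linVec_blockCoeff]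

lemma linVec_tiltCoeff (F : Measure ℝ) (a : ℕ → ℝ) (ε : ℝ) (n : ℕ) :
    linVec a (tiltCoeff F a ε n) = tiltRate F a ε n • blockVec a 0 n := by
  rw [tiltCoeff, linVec_smul, linVec_blockCoeff]

/-- This identity fixes the time scale: blocks of length n^β have variance of order n^{2(2-2α)},
which is the order of 1/θ_n². -/
lemma scalingExponent_mul {α : ℝ} (h₁ : α < 1) :
    scalingExponent α * (3 - 2 * α) = 2 * (2 - 2 * α) := by
  rw [scalingExponent, div_mul_cancel₀ _ (by linarith)]
  ring

lemma scalingExponent_pos {α : ℝ} (h₁ : α < 1) : 0 < scalingExponent α :=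
  div_pos (by linarith) (by linarith)

lemma scalingExponent_lt_one {α : ℝ} (h₀ : 1 / 2 < α) (h₁ : α < 1) : scalingExponent α < 1 := by
  rw [scalingExponent, div_lt_one (by linarith)]
  linarith

/-- The inequality reduces to (2α-1)² > 0. It makes the covariance of two blocks of length n^β at
distance n, of order n^{2β+1-2α}, negligible compared with their variance. -/
lemma two_mul_scalingExponent_lt {α : ℝ} (h₀ : 1 / 2 < α) (h₁ : α < 1) :
    2 * scalingExponent α < 3 - 2 * α := by
  rw [scalingExponent, ← mul_div_assoc, div_lt_iff₀ (by linarith)]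
  nlinarith [mul_pos (show 0 < 2 * α - 1 by linarith) (show 0 < 2 * α - 1 by linarith)]

namespace IsLongMemoryModel

variable {Ω : Type*} [MeasurableSpace Ω] {P : Measure Ω} {F : Measure ℝ}
  {Z : ℤ → Ω → ℝ} {a : ℕ → ℝ} {α : ℝ}

/-- The limit of `θ_n n^{2-2α}`. -/
noncomputable def tiltLimit (F : Measure ℝ) (α ε : ℝ) : ℝ := ε / (noiseVariance F * constC α)

lemma tiltLimit_pos (M : IsLongMemoryModel P F Z a α) {ε : ℝ} (hε : 0 < ε) :
    0 < tiltLimit F α ε :=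
  div_pos hε (mul_pos M.variance_pos (constC_pos M.half_lt M.lt_one))

lemma tendsto_tiltRate (M : IsLongMemoryModel P F Z a α) (ε : ℝ) :
    Tendsto (fun n : ℕ => tiltRate F a ε n * (n : ℝ) ^ (2 - 2 * α)) atTop
      (𝓝 (tiltLimit F α ε)) := by
  have hv := M.variance_pos
  have hC := constC_pos M.half_lt M.lt_one
  have h1 := (M.power.tendsto_norm_blockVec_sq M.half_lt M.lt_one).const_mul (noiseVariance F)
  have h2 := (tendsto_const_nhds (x := ε)).div h1 (by positivity)
  refine h2.congr' ?_
  filter_upwards [eventually_gt_atTop 0] with n hn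
  have hn' : (0 : ℝ) < n := by exact_mod_cast hn
  rw [tiltRate, Pi.div_apply]
  have : (n : ℝ) ^ (3 - 2 * α) = n * (n : ℝ) ^ (2 - 2 * α) := by
    rw [show 3 - 2 * α = 1 + (2 - 2 * α) by ring, Real.rpow_add hn', Real.rpow_one]
  rw [this]
  have := (Real.rpow_pos_of_pos hn' (2 - 2 * α)).ne'
  field_simp

lemma eventually_tiltRate_pos (M : IsLongMemoryModel P F Z a α) {ε : ℝ} (hε : 0 < ε) :
    ∀ᶠ n in atTop, 0 < tiltRate F a ε n := by
  filter_upwards [(M.tendsto_tiltRate ε).eventually_const_lt (M.tiltLimit_pos hε),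
    eventually_gt_atTop 0] with n h1 h2
  have hn' : (0 : ℝ) < n := by exact_mod_cast h2
  exact (pos_iff_pos_of_mul_pos h1).mpr (Real.rpow_pos_of_pos hn' _)

lemma eventually_norm_blockVec_pos (M : IsLongMemoryModel P F Z a α) {ε : ℝ} (hε : 0 < ε) :
    ∀ᶠ n in atTop, 0 < ‖blockVec a 0 n‖ := by
  filter_upwards [M.eventually_tiltRate_pos hε] with n hn
  -- If the norm were 0, the quotient defining θ_n would be 0 by the convention for division by
  -- zero.
  refine (norm_nonneg _).lt_of_ne fun h => ?_
  rw [tiltRate, ← h] at hn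
  simp at hn

/-- Consequently σ²‖u‖² = θ_n n ε, so the centering in `tiltVar` is exactly the threshold nε of the
large deviation event. -/
lemma norm_linVec_tiltCoeff_sq (M : IsLongMemoryModel P F Z a α) {ε : ℝ} {n : ℕ}
    (hn : 0 < ‖blockVec a 0 n‖) :
    ‖linVec a (tiltCoeff F a ε n)‖ ^ 2 = tiltRate F a ε n * n * ε / noiseVariance F := by
  have hv := M.variance_pos
  rw [linVec_tiltCoeff, norm_smul, mul_pow, Real.norm_eq_abs, sq_abs, tiltRate]
  field_simp

lemma tendsto_norm_linVec_tiltCoeff_sq (M : IsLongMemoryModel P F Z a α) {ε : ℝ} (hε : 0 < ε) :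
    Tendsto (fun n : ℕ => ‖linVec a (tiltCoeff F a ε n)‖ ^ 2 / (n : ℝ) ^ (2 * α - 1)) atTop
      (𝓝 (tiltLimit F α ε * ε / noiseVariance F)) := by
  refine (((M.tendsto_tiltRate ε).mul_const ε).div_const (noiseVariance F)).congr' ?_
  filter_upwards [M.eventually_norm_blockVec_pos hε, eventually_gt_atTop 0] with n hn hn0
  have hn' : (0 : ℝ) < n := by exact_mod_cast hn0
  rw [M.norm_linVec_tiltCoeff_sq hn]
  have : (n : ℝ) ^ (2 - 2 * α) = n / (n : ℝ) ^ (2 * α - 1) := by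
    rw [show 2 - 2 * α = 1 - (2 * α - 1) by ring, Real.rpow_sub hn', Real.rpow_one]
  rw [this]
  ring

lemma tendsto_rpow_neg_natCast {y : ℝ} (hy : 0 < y) :
    Tendsto (fun n : ℕ => (n : ℝ) ^ (-y)) atTop (𝓝 0) :=
  (tendsto_rpow_neg_atTop hy).comp tendsto_natCast_atTop_atTop

lemma tendsto_rpow_natCast {y : ℝ} (hy : 0 < y) :
    Tendsto (fun n : ℕ => (n : ℝ) ^ y) atTop atTop :=
  (tendsto_rpow_atTop hy).comp tendsto_natCast_atTop_atTop

lemma tendsto_tiltRate_mul_rpow (M : IsLongMemoryModel P F Z a α) (ε : ℝ) (K : ℝ) :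
    Tendsto (fun n : ℕ => |tiltRate F a ε n| * (K * (n : ℝ) ^ (1 - α))) atTop (𝓝 0) := by
  have h1 := M.lt_one
  have h := ((M.tendsto_tiltRate ε).abs.mul_const K).mul
    (tendsto_rpow_neg_natCast (show 0 < 1 - α by linarith))
  rw [mul_zero] at h
  refine h.congr' ?_
  filter_upwards [eventually_gt_atTop 0] with n hn
  have hn' : (0 : ℝ) < n := by exact_mod_cast hn
  rw [abs_mul, abs_of_nonneg (Real.rpow_nonneg hn'.le _)]
  have : (n : ℝ) ^ (1 - α) = (n : ℝ) ^ (2 - 2 * α) * (n : ℝ) ^ (-(1 - α)) := by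
    rw [← Real.rpow_add hn']; ring_nf
  rw [this]
  ring

/-- With θ_n of order n^{-(2-2α)} and block coefficients at most of order n^{1-α}, one may take b_n
of order n^{-(1-α)}, while ‖u‖² has order n^{2α-1}. The inequality for κ makes b_n^{κ-1}‖u‖² vanish,
and e^{-δ/b_n} beats every power of n. An increment is a difference of two blocks, whence the factor
2. -/
theorem exists_isTiltSequence (M : IsLongMemoryModel P F Z a α) {ε : ℝ} (hε : 0 < ε) :
    ∃ b : ℕ → ℝ, IsTiltSequence a (kappa α) (tiltCoeff F a ε) b ∧
      ∀ n i j k, |linVec a (incrCoeff F a ε n i j) k| ≤ 2 * b n := by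
  obtain ⟨K, hK, hKb⟩ := M.power.exists_abs_blockVec_le M.half_lt M.lt_one
  have h₀ := M.half_lt
  have h₁ := M.lt_one
  have hv := M.variance_pos
  have hL := M.tiltLimit_pos hε
  have hθ := M.eventually_tiltRate_pos hε
  set L := tiltLimit F α ε
  set b : ℕ → ℝ := fun n => |tiltRate F a ε n| * (K * (n : ℝ) ^ (1 - α)) with hb
  have hb0 : Tendsto b atTop (𝓝 0) := M.tendsto_tiltRate_mul_rpow ε K
  have hsq := M.tendsto_norm_linVec_tiltCoeff_sq hε
  have hlin : 0 < L * ε / noiseVariance F := by positivity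
  have hsqtop : Tendsto (fun n => ‖linVec a (tiltCoeff F a ε n)‖ ^ 2) atTop atTop := by
    have := hsq.pos_mul_atTop hlin (tendsto_rpow_natCast (show 0 < 2 * α - 1 by linarith))
    refine this.congr' ?_
    filter_upwards [eventually_gt_atTop 0] with n hn
    have hn' : (0 : ℝ) < n := by exact_mod_cast hn
    exact div_mul_cancel₀ _ (Real.rpow_pos_of_pos hn' _).ne'
  have hN : Tendsto (fun n => ‖linVec a (tiltCoeff F a ε n)‖) atTop atTop := by
    refine (Real.tendsto_sqrt_atTop.comp hsqtop).congr fun n => ?_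
    simp only [Function.comp]
    rw [Real.sqrt_sq (norm_nonneg _)]
  have hbpos : ∀ᶠ n in atTop, 0 < b n := by
    filter_upwards [hθ, eventually_gt_atTop 0] with n h1 h2
    have hn' : (0 : ℝ) < n := by exact_mod_cast h2
    have := Real.rpow_pos_of_pos hn' (1 - α)
    simp only [hb, abs_of_pos h1]
    positivity
  have hbn : ∀ᶠ n : ℕ in atTop, b n
      = K * (tiltRate F a ε n * (n : ℝ) ^ (2 - 2 * α)) * (n : ℝ) ^ (-(1 - α)) := by
    filter_upwards [hθ, eventually_gt_atTop 0] with n h1 h2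
    have hn' : (0 : ℝ) < n := by exact_mod_cast h2
    have : (n : ℝ) ^ (1 - α) = (n : ℝ) ^ (2 - 2 * α) * (n : ℝ) ^ (-(1 - α)) := by
      rw [← Real.rpow_add hn']; ring_nf
    simp only [hb, abs_of_pos h1]
    rw [this]
    ring
  refine ⟨b, ⟨hN, fun n k => ?_, hbpos, hb0, ?_, fun δ hδ => ?_⟩, fun n i j k => ?_⟩
  · rw [linVec_tiltCoeff, lp.coeFn_smul, Pi.smul_apply, smul_eq_mul, abs_mul]
    exact mul_le_mul_of_nonneg_left (hKb 0 n k) (abs_nonneg _)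
  · have hκ := lt_kappa_mul h₀ h₁
    have hκ2 := two_le_kappa h₀ h₁
    set κ := kappa α
    have hcast : ((κ - 1 : ℕ) : ℝ) = κ - 1 := by
      rw [Nat.cast_sub (by omega)]; simp
    set y := (1 - α) * (κ - 1) - (2 * α - 1) with hy
    have hypos : 0 < y := by rw [hy]; nlinarith
    have h := (((M.tendsto_tiltRate ε).const_mul K).pow (κ - 1)).mul
      (hsq.mul (tendsto_rpow_neg_natCast hypos))
    rw [mul_zero, mul_zero] at h
    refine h.congr' ?_
    filter_upwards [hbn, eventually_gt_atTop 0] with n e1 e2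
    have hn' : (0 : ℝ) < n := by exact_mod_cast e2
    rw [e1, mul_pow _ ((n : ℝ) ^ (-(1 - α)))]
    have : ((n : ℝ) ^ (-(1 - α))) ^ (κ - 1) = (n : ℝ) ^ (-y) / (n : ℝ) ^ (2 * α - 1) := by
      rw [← Real.rpow_natCast, ← Real.rpow_mul hn'.le, hcast, ← Real.rpow_sub hn', hy]
      congr 1
      ring
    rw [this]
    ring
  -- In the variable n^{1-α} the claim compares a power with an exponential. Once ‖u‖ ≥ 1 it can be
  -- replaced by ‖u‖², whose order is known.
  · have h1 := tendsto_rpow_mul_exp_neg_mul_atTop_nhds_zero ((2 * α - 1) / (1 - α))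
      (δ / (K * (2 * L))) (by positivity)
    have h2 := (h1.comp (tendsto_rpow_natCast (show 0 < 1 - α by linarith))).const_mul
      (2 * (L * ε / noiseVariance F))
    rw [mul_zero] at h2
    refine squeeze_zero' (Eventually.of_forall fun n => by positivity) ?_ h2
    filter_upwards [hN.eventually_ge_atTop 1, hbn, hbpos, eventually_gt_atTop 0,
      (M.tendsto_tiltRate ε).eventually_lt_const (show L < 2 * L by linarith),
      hsq.eventually_lt_const (show L * ε / noiseVariance F < 2 * (L * ε / noiseVariance F) by
        linarith)] with n e1 e2 e3 e4 e5 e6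
    have hn' : (0 : ℝ) < n := by exact_mod_cast e4
    have hpow : ((n : ℝ) ^ (1 - α)) ^ ((2 * α - 1) / (1 - α)) = (n : ℝ) ^ (2 * α - 1) := by
      rw [← Real.rpow_mul hn'.le]
      congr 1
      have : (1 - α) ≠ 0 := by linarith
      field_simp
    simp only [Function.comp]
    rw [hpow, ← mul_assoc]
    have hle : b n ≤ K * (2 * L) * (n : ℝ) ^ (-(1 - α)) := by
      rw [e2]
      gcongr
    have hNle : ‖linVec a (tiltCoeff F a ε n)‖
        ≤ 2 * (L * ε / noiseVariance F) * (n : ℝ) ^ (2 * α - 1) := by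
      have hp := Real.rpow_pos_of_pos hn' (2 * α - 1)
      rw [div_lt_iff₀ hp] at e6
      refine le_trans ?_ e6.le
      nlinarith
    refine mul_le_mul hNle (Real.exp_le_exp.mpr ?_) (Real.exp_pos _).le (by positivity)
    rw [neg_mul, neg_le_neg_iff]
    have : δ / (K * (2 * L)) * (n : ℝ) ^ (1 - α) = δ / (K * (2 * L) * (n : ℝ) ^ (-(1 - α))) := by
      rw [Real.rpow_neg hn'.le]
      have := (Real.rpow_pos_of_pos hn' (1 - α)).ne'
      field_simp
    rw [this]
    exact div_le_div_of_nonneg_left hδ.le e3 hle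
  · rw [linVec_incrCoeff, lp.coeFn_smul, Pi.smul_apply, smul_eq_mul, abs_mul, lp.coeFn_sub,
      Pi.sub_apply]
    have h1 := abs_sub (blockVec a j n k) (blockVec a i n k)
    have h2 := hKb j n k
    have h3 := hKb i n k
    have h4 : |blockVec a j n k - blockVec a i n k| ≤ 2 * (K * (n : ℝ) ^ (1 - α)) := by linarith
    calc _ ≤ |tiltRate F a ε n| * (2 * (K * (n : ℝ) ^ (1 - α))) :=
          mul_le_mul_of_nonneg_left h4 (abs_nonneg _)
      _ = _ := by simp only [hb]; ring

lemma rpow_scalingExponent_rpow (h₁ : α < 1) {n : ℕ} :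
    ((n : ℝ) ^ scalingExponent α) ^ (3 - 2 * α) = ((n : ℝ) ^ (2 - 2 * α)) ^ 2 := by
  rw [← Real.rpow_mul (Nat.cast_nonneg n), scalingExponent_mul h₁, ← Real.rpow_natCast,
    ← Real.rpow_mul (Nat.cast_nonneg n), mul_comm]
  norm_num

/-- The limit of the variances of the increments on the time scale `n^β`. -/
theorem tendsto_norm_incrCoeff_zero_sq (M : IsLongMemoryModel P F Z a α) (ε : ℝ)
    {d : ℕ → ℕ} {t : ℝ} (ht : 0 ≤ t)
    (hd : Tendsto (fun n : ℕ => (d n : ℝ) / (n : ℝ) ^ scalingExponent α) atTop (𝓝 t)) :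
    Tendsto (fun n => ‖linVec a (incrCoeff F a ε n 0 (d n))‖ ^ 2) atTop
      (𝓝 (2 * (tiltLimit F α ε ^ 2 * constC α * t ^ (3 - 2 * α)))) := by
  have h₀ := M.half_lt
  have h₁ := M.lt_one
  have hβ := scalingExponent_pos h₁
  have hβ1 := scalingExponent_lt_one h₀ h₁
  have hβ2 := two_mul_scalingExponent_lt h₀ h₁
  set β := scalingExponent α with hβdef
  have h32 : 0 < 3 - 2 * α := by linarith
  have hV : Tendsto (fun n : ℕ => ‖blockVec a 0 (d n)‖ ^ 2 / ((n : ℝ) ^ β) ^ (3 - 2 * α)) atTop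
      (𝓝 (constC α * t ^ (3 - 2 * α))) := by
    have hdp := hd.rpow_const (p := 3 - 2 * α) (Or.inr h32.le)
    -- For t = 0 the lengths d n may stay bounded, and only the uniform bound for the variance is
    -- available. For t > 0 they tend to infinity and the exact asymptotics apply.
    rcases ht.eq_or_lt with rfl | htpos
    · obtain ⟨K, hK, hKb⟩ := M.power.exists_norm_blockVec_sq_le h₀ h₁
      have h := hdp.const_mul K
      rw [Real.zero_rpow h32.ne', mul_zero] at h ⊢
      refine squeeze_zero (fun n => by positivity) (fun n => ?_) h
      rw [Real.div_rpow (Nat.cast_nonneg _) (Real.rpow_nonneg (Nat.cast_nonneg _) _),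
        ← mul_div_assoc]
      exact div_le_div_of_nonneg_right (hKb _) (Real.rpow_nonneg (Real.rpow_nonneg
        (Nat.cast_nonneg _) _) _)
    · have hdtop : Tendsto d atTop atTop := by
        rw [← tendsto_natCast_atTop_iff (R := ℝ)]
        refine (hd.pos_mul_atTop htpos (tendsto_rpow_natCast hβ)).congr' ?_
        filter_upwards [eventually_gt_atTop 0] with n hn
        have hn' : (0 : ℝ) < n := by exact_mod_cast hn
        exact div_mul_cancel₀ _ (Real.rpow_pos_of_pos hn' _).ne'
      refine (((M.power.tendsto_norm_blockVec_sq h₀ h₁).comp hdtop).mul hdp).congr' ?_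
      filter_upwards [hdtop.eventually_gt_atTop 0] with n hn
      have hn' : (0 : ℝ) < d n := by exact_mod_cast hn
      rw [Real.div_rpow (Nat.cast_nonneg _) (Real.rpow_nonneg (Nat.cast_nonneg _) _)]
      have := (Real.rpow_pos_of_pos hn' (3 - 2 * α)).ne'
      simp only [Function.comp]
      field_simp
  -- The covariance of the two end blocks is negligible: β < 1 ensures 2d ≤ n, and 2β < 3 - 2α gives
  -- the decay.
  have hI : Tendsto (fun n : ℕ => inner ℝ (blockVec a n (d n)) (blockVec a 0 (d n))
      / ((n : ℝ) ^ β) ^ (3 - 2 * α)) atTop (𝓝 0) := by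
    obtain ⟨K, hK, hKb⟩ := M.power.exists_abs_inner_blockVec_le h₀ h₁
    have h := ((hd.pow 2).mul (tendsto_rpow_neg_natCast
      (show 0 < (3 - 2 * α) - 2 * β by linarith))).const_mul K
    rw [mul_zero, mul_zero] at h
    have hsmall : ∀ᶠ n : ℕ in atTop, 2 * d n ≤ n := by
      have h2 := (hd.mul (tendsto_rpow_neg_natCast (show 0 < 1 - β by linarith))).const_mul 2
      rw [mul_zero, mul_zero] at h2
      filter_upwards [h2.eventually_lt_const one_pos, eventually_gt_atTop 0] with n e1 e2
      have hn' : (0 : ℝ) < n := by exact_mod_cast e2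
      have : (d n : ℝ) / (n : ℝ) ^ β * (n : ℝ) ^ (-(1 - β)) = d n / n := by
        rw [show -(1 - β) = β - 1 by ring, Real.rpow_sub hn', Real.rpow_one]
        have := (Real.rpow_pos_of_pos hn' β).ne'
        field_simp
      rw [this, ← mul_div_assoc, div_lt_one hn'] at e1
      exact_mod_cast e1.le
    refine squeeze_zero_norm' ?_ h
    filter_upwards [hsmall, eventually_gt_atTop 0] with n e1 e2
    have hn' : (0 : ℝ) < n := by exact_mod_cast e2
    have hp := Real.rpow_pos_of_pos hn' β
    have hp2 := Real.rpow_pos_of_pos hp (3 - 2 * α)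
    rw [norm_div, Real.norm_eq_abs, Real.norm_of_nonneg hp2.le, div_le_iff₀ hp2]
    refine (hKb n (d n) e1).trans (le_of_eq ?_)
    have e3 : (n : ℝ) ^ (1 - 2 * α) = (n : ℝ) ^ (-((3 - 2 * α) - 2 * β))
        / ((n : ℝ) ^ β) ^ 2 * ((n : ℝ) ^ β) ^ (3 - 2 * α) := by
      rw [← Real.rpow_natCast, ← Real.rpow_mul hn'.le, ← Real.rpow_mul hn'.le,
        ← Real.rpow_sub hn', ← Real.rpow_add hn', scalingExponent_mul h₁]
      congr 1
      push_cast
      ring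
    rw [e3]
    field_simp
  have hsum := ((M.tendsto_tiltRate ε).pow 2).mul ((hV.const_mul 2).sub (hI.const_mul 2))
  rw [mul_zero, sub_zero] at hsum
  rw [show 2 * (tiltLimit F α ε ^ 2 * constC α * t ^ (3 - 2 * α))
    = tiltLimit F α ε ^ 2 * (2 * (constC α * t ^ (3 - 2 * α))) by ring]
  refine hsum.congr' ?_
  filter_upwards [eventually_gt_atTop 0] with n hn
  have hn' : (0 : ℝ) < n := by exact_mod_cast hn
  have h := norm_blockVec_sub_sq M.summable_sq 0 (d n) n
  rw [zero_add] at h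
  have h' : ((n : ℝ) ^ β) ^ (3 - 2 * α) = ((n : ℝ) ^ (2 - 2 * α)) ^ 2 :=
    rpow_scalingExponent_rpow h₁
  rw [linVec_incrCoeff, norm_smul, mul_pow ‖_‖, h, Real.norm_eq_abs, sq_abs, h']
  have := (Real.rpow_pos_of_pos hn' (2 - 2 * α)).ne'
  field_simp

lemma norm_incrCoeff (M : IsLongMemoryModel P F Z a α) (ε : ℝ) (n i j : ℕ) :
    ‖linVec a (incrCoeff F a ε n i j)‖ = ‖linVec a (incrCoeff F a ε n 0 (Nat.dist i j))‖ := by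
  rw [linVec_incrCoeff, linVec_incrCoeff, norm_smul, norm_smul]
  congr 1
  rcases le_total i j with h | h
  · obtain ⟨d, rfl⟩ := Nat.exists_eq_add_of_le h
    rw [norm_blockVec_sub M.summable_sq, Nat.dist_eq_sub_of_le h, Nat.add_sub_cancel_left]
  · obtain ⟨d, rfl⟩ := Nat.exists_eq_add_of_le h
    rw [norm_sub_rev, norm_blockVec_sub M.summable_sq, Nat.dist_comm, Nat.dist_eq_sub_of_le h,
      Nat.add_sub_cancel_left]

lemma cast_natDist (i j : ℕ) : ((Nat.dist i j : ℕ) : ℝ) = |(i : ℝ) - j| := by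
  rcases le_total i j with h | h
  · rw [Nat.dist_eq_sub_of_le h, Nat.cast_sub h, abs_of_nonpos (by simpa using h)]
    ring
  · rw [Nat.dist_eq_sub_of_le_right h, Nat.cast_sub h, abs_of_nonneg (by simpa using h)]

lemma tendsto_norm_incrCoeff_sq (M : IsLongMemoryModel P F Z a α) (ε : ℝ)
    {i j : ℕ → ℕ} {s t : ℝ}
    (hi : Tendsto (fun n : ℕ => (i n : ℝ) / (n : ℝ) ^ scalingExponent α) atTop (𝓝 s))
    (hj : Tendsto (fun n : ℕ => (j n : ℝ) / (n : ℝ) ^ scalingExponent α) atTop (𝓝 t)) :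
    Tendsto (fun n => ‖linVec a (incrCoeff F a ε n (i n) (j n))‖ ^ 2) atTop
      (𝓝 (2 * (tiltLimit F α ε ^ 2 * constC α * |s - t| ^ (3 - 2 * α)))) := by
  have h : Tendsto (fun n : ℕ => ((Nat.dist (i n) (j n) : ℕ) : ℝ) / (n : ℝ) ^ scalingExponent α)
      atTop (𝓝 |s - t|) := by
    refine (hi.sub hj).abs.congr fun n => ?_
    rw [cast_natDist, ← sub_div, abs_div,
      abs_of_nonneg (Real.rpow_nonneg (Nat.cast_nonneg n) (scalingExponent α))]
  refine (M.tendsto_norm_incrCoeff_zero_sq ε (abs_nonneg _) h).congr fun n => ?_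
  rw [← M.norm_incrCoeff]

lemma incrCoeff_sub (F : Measure ℝ) (a : ℕ → ℝ) (ε : ℝ) (n i j k : ℕ) :
    incrCoeff F a ε n i k - incrCoeff F a ε n i j = incrCoeff F a ε n j k := by
  rw [incrCoeff, incrCoeff, incrCoeff, ← smul_sub, sub_sub_sub_cancel_right]

/-- Polarization, as the difference of the increments from 0 to j and to i is the increment from i
to j. It turns limits of variances into the covariance of fractional Brownian motion. -/
lemma inner_incrCoeff (F : Measure ℝ) (a : ℕ → ℝ) (ε : ℝ) (n i j : ℕ) :
    inner ℝ (linVec a (incrCoeff F a ε n 0 i)) (linVec a (incrCoeff F a ε n 0 j))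
      = (‖linVec a (incrCoeff F a ε n 0 i)‖ ^ 2 + ‖linVec a (incrCoeff F a ε n 0 j)‖ ^ 2
          - ‖linVec a (incrCoeff F a ε n i j)‖ ^ 2) / 2 := by
  rw [← incrCoeff_sub F a ε n 0 i j, linVec_sub, norm_sub_sq_real, real_inner_comm]
  ring

/-- Tilt plus increment is θ_n times the block at j, which by stationarity has the same norm as the
tilt. Expanding the square makes the drift of the limit exactly minus half its variance. -/
lemma inner_tiltCoeff_incrCoeff (M : IsLongMemoryModel P F Z a α) (ε : ℝ) (n j : ℕ) :
    inner ℝ (linVec a (tiltCoeff F a ε n)) (linVec a (incrCoeff F a ε n 0 j))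
      = -(‖linVec a (incrCoeff F a ε n 0 j)‖ ^ 2 / 2) := by
  have h1 : linVec a (tiltCoeff F a ε n) + linVec a (incrCoeff F a ε n 0 j)
      = tiltRate F a ε n • blockVec a j n := by
    rw [linVec_tiltCoeff, linVec_incrCoeff, ← smul_add, add_sub_cancel]
  have h2 : ‖linVec a (tiltCoeff F a ε n) + linVec a (incrCoeff F a ε n 0 j)‖
      = ‖linVec a (tiltCoeff F a ε n)‖ := by
    rw [h1, linVec_tiltCoeff, norm_smul, norm_smul, norm_blockVec M.summable_sq]
  have h3 := norm_add_sq_real (linVec a (tiltCoeff F a ε n)) (linVec a (incrCoeff F a ε n 0 j))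
  rw [h2] at h3
  linarith

lemma tendsto_inner_incrCoeff (M : IsLongMemoryModel P F Z a α) (ε : ℝ)
    {i j : ℕ → ℕ} {s t : ℝ} (hs : 0 ≤ s) (ht : 0 ≤ t)
    (hi : Tendsto (fun n : ℕ => (i n : ℝ) / (n : ℝ) ^ scalingExponent α) atTop (𝓝 s))
    (hj : Tendsto (fun n : ℕ => (j n : ℝ) / (n : ℝ) ^ scalingExponent α) atTop (𝓝 t)) :
    Tendsto (fun n => inner ℝ (linVec a (incrCoeff F a ε n 0 (i n)))
      (linVec a (incrCoeff F a ε n 0 (j n)))) atTop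
      (𝓝 (tiltLimit F α ε ^ 2 * constC α *
        (s ^ (3 - 2 * α) + t ^ (3 - 2 * α) - |s - t| ^ (3 - 2 * α)))) := by
  simp_rw [inner_incrCoeff]
  have h := (((M.tendsto_norm_incrCoeff_zero_sq ε hs hi).add
    (M.tendsto_norm_incrCoeff_zero_sq ε ht hj)).sub
    (M.tendsto_norm_incrCoeff_sq ε hi hj)).div_const 2
  refine h.trans (le_of_eq ?_)
  congr 1
  ring

lemma tendsto_inner_tiltCoeff_incrCoeff (M : IsLongMemoryModel P F Z a α) (ε : ℝ)
    {j : ℕ → ℕ} {t : ℝ} (ht : 0 ≤ t)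
    (hj : Tendsto (fun n : ℕ => (j n : ℝ) / (n : ℝ) ^ scalingExponent α) atTop (𝓝 t)) :
    Tendsto (fun n => inner ℝ (linVec a (tiltCoeff F a ε n))
      (linVec a (incrCoeff F a ε n 0 (j n)))) atTop
      (𝓝 (-(tiltLimit F α ε ^ 2 * constC α * t ^ (3 - 2 * α)))) := by
  simp_rw [M.inner_tiltCoeff_incrCoeff]
  refine ((M.tendsto_norm_incrCoeff_zero_sq ε ht hj).div_const 2).neg.trans (le_of_eq ?_)
  congr 1
  ring

/-- Uniform bound for the variances of the increments on the time scale `n^β`. -/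
lemma exists_norm_incrCoeff_sq_le (M : IsLongMemoryModel P F Z a α) (ε : ℝ) :
    ∃ K : ℝ, 0 < K ∧ ∀ᶠ n : ℕ in atTop, ∀ i j : ℕ, ‖linVec a (incrCoeff F a ε n i j)‖ ^ 2
      ≤ K * (|(i : ℝ) - j| / (n : ℝ) ^ scalingExponent α) ^ (3 - 2 * α) := by
  obtain ⟨K, hK, hKb⟩ := M.power.exists_norm_blockVec_sq_le M.half_lt M.lt_one
  refine ⟨4 * K * (tiltLimit F α ε ^ 2 + 1), by positivity, ?_⟩
  filter_upwards [((M.tendsto_tiltRate ε).pow 2).eventually_lt_const (lt_add_one _),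
    eventually_gt_atTop 0] with n h1 h2 i j
  have hn' : (0 : ℝ) < n := by exact_mod_cast h2
  rw [M.norm_incrCoeff, ← cast_natDist]
  set d := Nat.dist i j
  have h3 := norm_blockVec_sub_le M.summable_sq 0 d n
  rw [zero_add] at h3
  have hp := Real.rpow_pos_of_pos hn' (2 - 2 * α)
  rw [linVec_incrCoeff, norm_smul, mul_pow, Real.norm_eq_abs, sq_abs,
    Real.div_rpow (Nat.cast_nonneg _) (Real.rpow_nonneg hn'.le _),
    rpow_scalingExponent_rpow M.lt_one]
  calc tiltRate F a ε n ^ 2 * ‖blockVec a d n - blockVec a 0 n‖ ^ 2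
      ≤ tiltRate F a ε n ^ 2 * (2 * ‖blockVec a 0 d‖) ^ 2 := by gcongr
    _ = 4 * tiltRate F a ε n ^ 2 * ‖blockVec a 0 d‖ ^ 2 := by ring
    _ ≤ 4 * tiltRate F a ε n ^ 2 * (K * (d : ℝ) ^ (3 - 2 * α)) := by
        gcongr
        exact hKb d
    _ = 4 * K * (tiltRate F a ε n * (n : ℝ) ^ (2 - 2 * α)) ^ 2 *
        ((d : ℝ) ^ (3 - 2 * α) / ((n : ℝ) ^ (2 - 2 * α)) ^ 2) := by field_simp
    _ ≤ _ := by gcongr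

end IsLongMemoryModel

lemma sq_le_two_mul_exp_add_exp_neg (x : ℝ) : x ^ 2 ≤ 2 * (Real.exp x + Real.exp (-x)) := by
  have h1 := Real.quadratic_le_exp_of_nonneg (abs_nonneg x)
  rw [sq_abs] at h1
  have h2 : Real.exp |x| ≤ Real.exp x + Real.exp (-x) := by
    rcases abs_cases x with ⟨h, -⟩ | ⟨h, -⟩ <;> rw [h]
    · linarith [Real.exp_pos (-x)]
    · linarith [Real.exp_pos x]
  linarith [abs_nonneg x]

lemma linForm_sum {Ω ι : Type*} (X : ℕ → Ω → ℝ) (s : Finset ι) (l : ι → ℝ) (c : ι → ℕ →₀ ℝ)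
    (ω : Ω) : linForm X (∑ i ∈ s, l i • c i) ω = ∑ i ∈ s, l i * linForm X (c i) ω := by
  simp [linForm, map_sum]

lemma linVec_sum {ι : Type*} (a : ℕ → ℝ) (s : Finset ι) (l : ι → ℝ) (c : ι → ℕ →₀ ℝ) :
    linVec a (∑ i ∈ s, l i • c i) = ∑ i ∈ s, l i • linVec a (c i) := by
  simp [linVec, map_sum]

/-- The covariance of fractional Brownian motion with `2H = p`. -/
noncomputable def fbmCov (p s t : ℝ) : ℝ := (s ^ p + t ^ p - |s - t| ^ p) / 2

/-- The coefficient of the drift of the limit process. -/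
noncomputable def limitDrift (F : Measure ℝ) (α ε : ℝ) : ℝ :=
  noiseVariance F * (IsLongMemoryModel.tiltLimit F α ε ^ 2 * constC α)

/-- The limit `√(2γ) B(t) - γ t^{2H}` of the increments, with `γ = ε² / (σ² C)`. -/
noncomputable def limitProc {Ω' : Type*} (F : Measure ℝ) (α ε : ℝ) (B : ℝ≥0 → Ω' → ℝ) (t : ℝ≥0)
    (ω : Ω') : ℝ :=
  √(2 * limitDrift F α ε) * B t ω - limitDrift F α ε * (t : ℝ) ^ (3 - 2 * α)

lemma IsFractionalBrownianMotion.integral_cexp {Ω' : Type*} [MeasurableSpace Ω'] {Q : Measure Ω'}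
    {H : ℝ} {B : ℝ≥0 → Ω' → ℝ} (hB : IsFractionalBrownianMotion H B Q) {ι : Type*} [Fintype ι]
    (t : ι → ℝ≥0) (l : ι → ℝ) :
    ∫ ω, Complex.exp ((∑ i, l i * B (t i) ω : ℝ) * Complex.I) ∂Q
      = Complex.exp (-((∑ i, ∑ j, l i * l j * fbmCov (2 * H) (t i) (t j)) / 2 : ℝ)) := by
  have hG : HasGaussianLaw (fun ω => ∑ i, l i * B (t i) ω) Q :=
    ((hB.gaussian.comp_right t).smul l).hasGaussianLaw_fun_sum (I := Finset.univ)
  have := hG.isProbabilityMeasure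
  have hint : ∀ i, Integrable (B (t i)) Q := fun i => (hB.gaussian.hasGaussianLaw_eval _).integrable
  have hL2 : ∀ i, MemLp (B (t i)) 2 Q := fun i => (hB.gaussian.hasGaussianLaw_eval _).memLp_two
  have hmean : ∫ ω, ∑ i, l i * B (t i) ω ∂Q = 0 := by
    rw [integral_finsetSum _ fun i _ => (hint i).const_mul _]
    simp [integral_const_mul, hB.mean_zero]
  have hvar : Var[fun ω => ∑ i, l i * B (t i) ω; Q]
      = ∑ i, ∑ j, l i * l j * fbmCov (2 * H) (t i) (t j) := by
    rw [variance_of_integral_eq_zero hG.aemeasurable hmean]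
    simp_rw [pow_two, Finset.sum_mul_sum]
    have hprod : ∀ i j, Integrable (fun ω => l i * B (t i) ω * (l j * B (t j) ω)) Q :=
      fun i j => ((hL2 i).const_mul _).integrable_mul ((hL2 j).const_mul _)
    rw [integral_finsetSum _ fun i _ => integrable_finsetSum _ fun j _ => hprod i j]
    refine Finset.sum_congr rfl fun i _ => ?_
    rw [integral_finsetSum _ fun j _ => hprod i j]
    refine Finset.sum_congr rfl fun j _ => ?_
    rw [fbmCov, ← hB.covariance, ← integral_const_mul]
    congr 1
    ext ω
    ring
  have h := hG.charFun_map_eq 1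
  rw [charFun_apply_real, integral_map hG.aemeasurable (by fun_prop)] at h
  have hin : ∀ x : ℝ, inner ℝ (1 : ℝ) x = x := fun x => by simp [inner]
  simp only [hin, Complex.ofReal_one, one_mul, hmean, hvar, Complex.ofReal_zero, zero_mul,
    zero_sub] at h
  rw [h]
  push_cast
  ring_nf

namespace IsLongMemoryModel

variable {Ω : Type*} [MeasurableSpace Ω] {P : Measure Ω} {F : Measure ℝ}
  {Z : ℤ → Ω → ℝ} {a : ℕ → ℝ} {α : ℝ}

lemma limitDrift_pos (M : IsLongMemoryModel P F Z a α) {ε : ℝ} (hε : 0 < ε) :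
    0 < limitDrift F α ε :=
  mul_pos M.variance_pos (mul_pos (pow_pos (M.tiltLimit_pos hε) 2)
    (constC_pos M.half_lt M.lt_one))

/-- Second moments of the increments under the density `tiltDensity`. -/
theorem exists_integral_tiltDensity_mul_sq_le (M : IsLongMemoryModel P F Z a α) {ε : ℝ}
    (hε : 0 < ε) (T : ℝ) :
    ∃ K : ℝ, 0 < K ∧ ∀ᶠ n : ℕ in atTop, ∀ i j : ℕ, (i : ℝ) ≤ T * (n : ℝ) ^ scalingExponent α →
      (j : ℝ) ≤ T * (n : ℝ) ^ scalingExponent α →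
      Integrable (fun ω => tiltDensity F Z a (tiltCoeff F a ε n) ω *
        linForm (movingAverage a Z) (incrCoeff F a ε n i j) ω ^ 2) P ∧
      ∫ ω, tiltDensity F Z a (tiltCoeff F a ε n) ω *
        linForm (movingAverage a Z) (incrCoeff F a ε n i j) ω ^ 2 ∂P
        ≤ K * (|(i : ℝ) - j| / (n : ℝ) ^ scalingExponent α) ^ (3 - 2 * α) := by
  have h₀ := M.half_lt
  have h₁ := M.lt_one
  have h32 : 0 < 3 - 2 * α := by linarith
  obtain ⟨b, hb, -⟩ := M.exists_isTiltSequence hε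
  obtain ⟨K₁, hK₁, hinc⟩ := M.exists_norm_incrCoeff_sq_le ε
  set R := √(K₁ * T ^ (3 - 2 * α)) with hR
  obtain ⟨ρ, K₀, hρ, hexp⟩ := hb.exists_integral_tiltDensity_mul_exp_le M (1 + R)
  set ρ' := min ρ 1 with hρ'
  have hρ'0 : 0 < ρ' := lt_min hρ one_pos
  refine ⟨4 * |K₀| * K₁ / ρ' ^ 2 + 1, by positivity, ?_⟩
  filter_upwards [hinc, hexp, eventually_gt_atTop 0] with n e1 e2 e3 i j hi hj
  have hn : (0 : ℝ) < (n : ℝ) ^ scalingExponent α := Real.rpow_pos_of_pos (by exact_mod_cast e3) _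
  set w := tiltDensity F Z a (tiltCoeff F a ε n) with hw
  set d := (|(i : ℝ) - j| / (n : ℝ) ^ scalingExponent α) ^ (3 - 2 * α) with hd
  -- The case i = j is treated apart because the rescaling below divides by the bound s for the
  -- norm, which is then 0.
  rcases eq_or_ne i j with rfl | hij
  · have : incrCoeff F a ε n i i = 0 := by simp [incrCoeff]
    simp only [this, linForm_zero]
    simp only [ne_eq, OfNat.ofNat_ne_zero, not_false_eq_true, zero_pow, mul_zero, integral_zero]
    exact ⟨integrable_zero _ _ _, by positivity⟩
  have hd0 : 0 < d := by
    refine Real.rpow_pos_of_pos (div_pos (abs_pos.mpr ?_) hn) _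
    rw [sub_ne_zero]
    exact_mod_cast hij
  set s := √(K₁ * d) with hs
  have hs0 : 0 < s := Real.sqrt_pos.mpr (by positivity)
  have hs2 : s ^ 2 = K₁ * d := Real.sq_sqrt (by positivity)
  have hnorm : ‖linVec a (incrCoeff F a ε n i j)‖ ≤ s := Real.le_sqrt_of_sq_le (e1 i j)
  have hnorm0 : ∀ k : ℕ, (k : ℝ) ≤ T * (n : ℝ) ^ scalingExponent α →
      ‖linVec a (incrCoeff F a ε n 0 k)‖ ≤ R := by
    intro k hk
    refine Real.le_sqrt_of_sq_le ((e1 0 k).trans ?_)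
    gcongr
    rw [div_le_iff₀ hn]
    simpa using hk
  -- Rescaled by ρ'/s, the increment has norm at most ρ', so that its coefficients and its inner
  -- product with the tilt meet the conditions of the exponential bound. Second moments then follow
  -- from x² ≤ 2(e^x + e^{-x}).
  have key : ∀ x : ℝ, |x| = ρ' / s →
      Integrable (fun ω => w ω * Real.exp (linForm (movingAverage a Z)
        (x • incrCoeff F a ε n i j) ω)) P ∧
      ∫ ω, w ω * Real.exp (linForm (movingAverage a Z) (x • incrCoeff F a ε n i j) ω) ∂P ≤ K₀ := by
    intro x hx
    have hle : ‖linVec a (x • incrCoeff F a ε n i j)‖ ≤ ρ' := by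
      rw [linVec_smul, norm_smul, Real.norm_eq_abs, hx, div_mul_eq_mul_div, div_le_iff₀ hs0]
      gcongr
    have hR0 : 0 ≤ R := Real.sqrt_nonneg _
    refine e2 _ (fun k => ?_) (hle.trans ((min_le_right _ _).trans (by linarith))) ?_
    · exact (lp.norm_apply_le_norm (by norm_num) _ k).trans (hle.trans (min_le_left _ _))
    · rw [linVec_smul, inner_smul_right, ← incrCoeff_sub F a ε n 0 i j, linVec_sub, inner_sub_right,
        M.inner_tiltCoeff_incrCoeff, M.inner_tiltCoeff_incrCoeff]
      refine (le_abs_self _).trans ?_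
      rw [abs_mul, hx]
      set p := ‖linVec a (incrCoeff F a ε n 0 i)‖
      set q := ‖linVec a (incrCoeff F a ε n 0 j)‖
      have hpq : |p - q| ≤ s := by
        rw [abs_sub_comm]
        refine (abs_norm_sub_norm_le _ _).trans ?_
        rw [← linVec_sub, incrCoeff_sub]
        exact hnorm
      have hp := hnorm0 i hi
      have hq := hnorm0 j hj
      -- The inner products with the tilt are half squared norms; a difference of squares is a
      -- difference times a sum, so it is of order s rather than of order 1, which compensates for
      -- the rescaling.
      have hpq' : |-(q ^ 2 / 2) - -(p ^ 2 / 2)| ≤ s * R := by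
        rw [show -(q ^ 2 / 2) - -(p ^ 2 / 2) = (p - q) * ((p + q) / 2) by ring, abs_mul,
          abs_of_nonneg (show 0 ≤ (p + q) / 2 by positivity)]
        gcongr
        linarith
      calc ρ' / s * |-(q ^ 2 / 2) - -(p ^ 2 / 2)| ≤ ρ' / s * (s * R) := by gcongr
        _ = ρ' * R := by field_simp
        _ ≤ 1 * R := by gcongr; exact min_le_right _ _
        _ ≤ 1 + R := by linarith
  have hxp := key (ρ' / s) (abs_of_pos (by positivity))
  have hxm := key (-(ρ' / s)) (by rw [abs_neg, abs_of_pos (by positivity)])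
  have hpt : ∀ ω, w ω * linForm (movingAverage a Z) (incrCoeff F a ε n i j) ω ^ 2 ≤
      2 * (s / ρ') ^ 2 * (w ω * Real.exp (linForm (movingAverage a Z)
        ((ρ' / s) • incrCoeff F a ε n i j) ω) + w ω * Real.exp (linForm (movingAverage a Z)
        ((-(ρ' / s)) • incrCoeff F a ε n i j) ω)) := by
    intro ω
    have hw0 : 0 ≤ w ω := tiltDensity_nonneg ..
    have h := sq_le_two_mul_exp_add_exp_neg
      ((ρ' / s) * linForm (movingAverage a Z) (incrCoeff F a ε n i j) ω)
    rw [linForm_smul, linForm_smul, neg_mul]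
    set x := linForm (movingAverage a Z) (incrCoeff F a ε n i j) ω
    have hx : x ^ 2 = (s / ρ') ^ 2 * ((ρ' / s) * x) ^ 2 := by field_simp
    rw [hx, ← mul_add]
    calc w ω * ((s / ρ') ^ 2 * (ρ' / s * x) ^ 2)
        ≤ w ω * ((s / ρ') ^ 2 * (2 * (Real.exp (ρ' / s * x) + Real.exp (-(ρ' / s * x))))) := by
          gcongr
      _ = _ := by ring
  have hint := (hxp.1.add hxm.1).const_mul (2 * (s / ρ') ^ 2)
  have hmeas := (M.aemeasurable_tiltDensity (tiltCoeff F a ε n)).mul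
    ((M.aemeasurable_linForm (incrCoeff F a ε n i j)).pow_const 2)
  have hI : Integrable (fun ω => w ω *
      linForm (movingAverage a Z) (incrCoeff F a ε n i j) ω ^ 2) P := by
    refine hint.mono' hmeas.aestronglyMeasurable (ae_of_all _ fun ω => ?_)
    rw [Real.norm_of_nonneg (mul_nonneg (tiltDensity_nonneg ..) (sq_nonneg _))]
    exact hpt ω
  refine ⟨hI, (integral_mono hI hint hpt).trans ?_⟩
  rw [integral_const_mul, integral_add' hxp.1 hxm.1]
  calc 2 * (s / ρ') ^ 2 * (∫ ω, w ω * Real.exp (linForm (movingAverage a Z)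
        ((ρ' / s) • incrCoeff F a ε n i j) ω) ∂P + ∫ ω, w ω * Real.exp (linForm (movingAverage a Z)
        ((-(ρ' / s)) • incrCoeff F a ε n i j) ω) ∂P)
      ≤ 2 * (s / ρ') ^ 2 * (|K₀| + |K₀|) := by
        gcongr
        · exact hxp.2.trans (le_abs_self _)
        · exact hxm.2.trans (le_abs_self _)
    _ = 4 * |K₀| * K₁ / ρ' ^ 2 * d := by rw [div_pow, hs2]; ring
    _ ≤ (4 * |K₀| * K₁ / ρ' ^ 2 + 1) * d := by nlinarith

/-- The index on the time scale `n^β` which corresponds to the time `t`. -/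
noncomputable def timeIndex (α : ℝ) (n : ℕ) (t : ℝ) : ℕ := ⌊(n : ℝ) ^ scalingExponent α * t⌋₊

lemma tendsto_timeIndex (M : IsLongMemoryModel P F Z a α) {t : ℝ} (ht : 0 ≤ t) :
    Tendsto (fun n : ℕ => (timeIndex α n t : ℝ) / (n : ℝ) ^ scalingExponent α) atTop (𝓝 t) := by
  have h := (tendsto_nat_floor_mul_div_atTop (R := ℝ) ht).comp
    (tendsto_rpow_natCast (scalingExponent_pos M.lt_one))
  refine h.congr fun n => ?_
  simp [timeIndex, mul_comm]

/-- Convergence of the characteristic functions of the tilted functional and of finitely many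
increments, under the density `tiltDensity`. -/
theorem tendsto_integral_tiltDensity_incr (M : IsLongMemoryModel P F Z a α) {ε : ℝ}
    (hε : 0 < ε) {Ω' : Type*} [MeasurableSpace Ω'] {Q : Measure Ω'} {B : ℝ≥0 → Ω' → ℝ}
    (hB : IsFractionalBrownianMotion (hurstIndex α) B Q)
    {ι : Type*} [Fintype ι] (t : ι → ℝ≥0) (l : ι → ℝ) (ξ : ℝ) :
    Tendsto (fun n => ∫ ω, (tiltDensity F Z a (tiltCoeff F a ε n) ω : ℂ) * Complex.exp
        ((ξ * tiltVar F Z a (tiltCoeff F a ε n) ω + ∑ i, l i * linForm (movingAverage a Z)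
          (incrCoeff F a ε n 0 (timeIndex α n (t i))) ω : ℝ) * Complex.I) ∂P) atTop
      (𝓝 ((√(Real.pi / (noiseVariance F / 2)) / 2 * Real.exp (-|ξ|) : ℝ) *
        ∫ ω, Complex.exp ((∑ i, l i * limitProc F α ε B (t i) ω : ℝ) * Complex.I) ∂Q)) := by
  have hp : 2 * hurstIndex α = 3 - 2 * α := by rw [hurstIndex]; ring
  obtain ⟨b, hb, hinc⟩ := M.exists_isTiltSequence hε
  set q : ℕ → ℕ →₀ ℝ := fun n => ∑ i, l i • incrCoeff F a ε n 0 (timeIndex α n (t i)) with hq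
  have hqr : ∀ n k, |linVec a (q n) k| ≤ (∑ i, |l i|) * (2 * b n) := by
    intro n k
    rw [hq, linVec_sum, lp.coeFn_sum, Finset.sum_apply, Finset.sum_mul]
    refine (Finset.abs_sum_le_sum_abs _ _).trans (Finset.sum_le_sum fun i _ => ?_)
    rw [lp.coeFn_smul, Pi.smul_apply, smul_eq_mul, abs_mul]
    gcongr
    exact hinc ..
  have hr : Tendsto (fun n => (∑ i, |l i|) * (2 * b n)) atTop (𝓝 0) := by
    simpa using (hb.tendsto_zero.const_mul 2).const_mul (∑ i, |l i|)
  set γ := tiltLimit F α ε ^ 2 * constC α with hγ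
  have hs : Tendsto (fun n => ‖linVec a (q n)‖ ^ 2) atTop
      (𝓝 (∑ i, ∑ j, l i * (l j * (γ * ((t i : ℝ) ^ (3 - 2 * α) + (t j : ℝ) ^ (3 - 2 * α)
        - |(t i : ℝ) - t j| ^ (3 - 2 * α)))))) := by
    have : ∀ n, ‖linVec a (q n)‖ ^ 2 = ∑ i, ∑ j, l i * (l j *
        inner ℝ (linVec a (incrCoeff F a ε n 0 (timeIndex α n (t i))))
          (linVec a (incrCoeff F a ε n 0 (timeIndex α n (t j))))) := by
      intro n
      rw [← real_inner_self_eq_norm_sq, hq, linVec_sum, sum_inner]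
      refine Finset.sum_congr rfl fun i _ => ?_
      rw [inner_sum]
      refine Finset.sum_congr rfl fun j _ => ?_
      rw [inner_smul_left, inner_smul_right, conj_trivial]
    simp_rw [this]
    exact tendsto_finsetSum _ fun i _ => tendsto_finsetSum _ fun j _ =>
      ((M.tendsto_inner_incrCoeff ε (t i).coe_nonneg (t j).coe_nonneg
        (M.tendsto_timeIndex (t i).coe_nonneg)
        (M.tendsto_timeIndex (t j).coe_nonneg)).const_mul _).const_mul _
  have hm : Tendsto (fun n => inner ℝ (linVec a (tiltCoeff F a ε n)) (linVec a (q n))) atTop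
      (𝓝 (∑ i, l i * -(γ * (t i : ℝ) ^ (3 - 2 * α)))) := by
    have : ∀ n, inner ℝ (linVec a (tiltCoeff F a ε n)) (linVec a (q n)) = ∑ i, l i *
        inner ℝ (linVec a (tiltCoeff F a ε n))
          (linVec a (incrCoeff F a ε n 0 (timeIndex α n (t i)))) := by
      intro n
      rw [hq, linVec_sum, inner_sum]
      exact Finset.sum_congr rfl fun i _ => inner_smul_right ..
    simp_rw [this]
    exact tendsto_finsetSum _ fun i _ =>
      (M.tendsto_inner_tiltCoeff_incrCoeff ε (t i).coe_nonneg
        (M.tendsto_timeIndex (t i).coe_nonneg)).const_mul _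
  have h := hb.tendsto_integral_tiltDensity M hqr hr hs hm ξ
  simp_rw [hq, linForm_sum] at h
  convert h using 2
  congr 1
  set c := limitDrift F α ε with hc
  have hc0 : 0 ≤ c := (M.limitDrift_pos hε).le
  -- The limit process is split into its deterministic drift and √(2c) B. The two factors give the
  -- imaginary part and the variance part of the limit exponent.
  have e1 : ∀ ω, Complex.exp ((∑ i, l i * limitProc F α ε B (t i) ω : ℝ) * Complex.I)
      = Complex.exp ((∑ i, l i * -(c * (t i : ℝ) ^ (3 - 2 * α)) : ℝ) * Complex.I) *
        Complex.exp ((∑ i, (l i * √(2 * c)) * B (t i) ω : ℝ) * Complex.I) := by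
    intro ω
    rw [← Complex.exp_add, ← add_mul, ← Complex.ofReal_add, ← Finset.sum_add_distrib]
    congr 4
    ext i
    rw [limitProc]
    ring
  simp_rw [e1]
  rw [integral_const_mul, hB.integral_cexp, ← Complex.exp_add, add_comm, hp]
  congr 1
  have e2 : ∀ i j, l i * √(2 * c) * (l j * √(2 * c)) = 2 * c * (l i * l j) := by
    intro i j
    calc _ = √(2 * c) ^ 2 * (l i * l j) := by ring
      _ = _ := by rw [Real.sq_sqrt (by positivity)]
  simp_rw [e2]
  congr 1
  · rw [← Complex.ofReal_neg]
    congr 2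
    rw [Finset.sum_div, Finset.mul_sum]
    refine Finset.sum_congr rfl fun i _ => ?_
    rw [Finset.sum_div, Finset.mul_sum]
    refine Finset.sum_congr rfl fun j _ => ?_
    rw [fbmCov, hc, limitDrift]
    ring
  · congr 2
    rw [Finset.mul_sum]
    refine Finset.sum_congr rfl fun i _ => ?_
    rw [hc, limitDrift]
    ring

end IsLongMemoryModel

/-! ### Laws under a density -/

section DensityLaw

variable {Ω E : Type*} [MeasurableSpace Ω] [MeasurableSpace E] {P : Measure Ω}

/-- The law of `V` under the probability measure with density proportional to `w`. -/
noncomputable def densityLaw (P : Measure Ω) (w : Ω → ℝ) (V : Ω → E) : Measure E :=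
  (P.withDensity fun ω => ENNReal.ofReal (w ω / ∫ ω', w ω' ∂P)).map V

lemma isProbabilityMeasure_densityLaw {w : Ω → ℝ} {V : Ω → E} (hw : Integrable w P) (h0 : 0 ≤ w)
    (hpos : 0 < ∫ ω, w ω ∂P) (hV : AEMeasurable V P) :
    IsProbabilityMeasure (densityLaw P w V) := by
  have h1 : IsProbabilityMeasure
      (P.withDensity fun ω => ENNReal.ofReal (w ω / ∫ ω', w ω' ∂P)) := by
    refine ⟨?_⟩
    rw [withDensity_apply _ MeasurableSet.univ, Measure.restrict_univ,
      ← ofReal_integral_eq_lintegral_ofReal (hw.div_const _)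
        (ae_of_all _ fun ω => div_nonneg (h0 ω) hpos.le), integral_div, div_self hpos.ne',
      ENNReal.ofReal_one]
  exact Measure.isProbabilityMeasure_map (hV.mono_ac (withDensity_absolutelyContinuous _ _))

lemma integral_densityLaw {G : Type*} [NormedAddCommGroup G] [NormedSpace ℝ G] {w : Ω → ℝ}
    {V : Ω → E} (hw : Integrable w P) (h0 : 0 ≤ w) (hpos : 0 < ∫ ω, w ω ∂P) (hV : AEMeasurable V P)
    {f : E → G} (hf : StronglyMeasurable f) :
    ∫ x, f x ∂(densityLaw P w V) = (∫ ω, w ω ∂P)⁻¹ • ∫ ω, w ω • f (V ω) ∂P := by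
  have hm : AEMeasurable (fun ω => ENNReal.ofReal (w ω / ∫ ω', w ω' ∂P)) P :=
    (hw.aemeasurable.div_const _).ennreal_ofReal
  rw [densityLaw, integral_map (hV.mono_ac (withDensity_absolutelyContinuous _ _))
    hf.aestronglyMeasurable, integral_withDensity_eq_integral_toReal_smul₀ hm
      (ae_of_all _ fun _ => ENNReal.ofReal_lt_top), ← integral_smul]
  congr 1
  ext ω
  rw [ENNReal.toReal_ofReal (div_nonneg (h0 ω) hpos.le), div_eq_inv_mul, mul_smul]

lemma densityLaw_real {w : Ω → ℝ} {V : Ω → E} (hw : Integrable w P) (h0 : 0 ≤ w)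
    (hpos : 0 < ∫ ω, w ω ∂P) (hV : AEMeasurable V P) {A : Set E} (hA : MeasurableSet A) :
    (densityLaw P w V).real A = (∫ ω, w ω ∂P)⁻¹ * ∫ ω in V ⁻¹' A, w ω ∂P := by
  have h := integral_densityLaw hw h0 hpos hV
    (f := A.indicator fun _ => (1 : ℝ)) (stronglyMeasurable_const.indicator hA)
  rw [integral_indicator_const _ hA, smul_eq_mul, mul_one, smul_eq_mul] at h
  rw [h, ← integral_indicator₀ (hV.nullMeasurableSet_preimage hA)]
  congr 2
  ext ω
  by_cases hω : V ω ∈ A <;> simp [Set.indicator, hω]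

end DensityLaw

/-- Multiplication of a weight by a positive bounded function. -/
lemma integrable_mul_bounded {Ω₀ E₀ : Type*} [MeasurableSpace Ω₀] {P₀ : Measure Ω₀}
    [TopologicalSpace E₀] [MeasurableSpace E₀] [BorelSpace E₀] {w₀ : Ω₀ → ℝ} {V₀ : Ω₀ → E₀}
    {g : E₀ →ᵇ ℝ} (hg : ∀ x, 0 < g x) (i1 : Integrable w₀ P₀) (i2 : AEMeasurable V₀ P₀)
    (i3 : 0 ≤ w₀) (i4 : 0 < ∫ ω, w₀ ω ∂P₀) :
    Integrable (fun ω => w₀ ω * g (V₀ ω)) P₀ ∧ 0 < ∫ ω, w₀ ω * g (V₀ ω) ∂P₀ := by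
  have hI : Integrable (fun ω => w₀ ω * g (V₀ ω)) P₀ :=
    i1.mul_bdd (c := ‖g‖) (g.continuous.measurable.comp_aemeasurable i2).aestronglyMeasurable
      (ae_of_all _ fun ω => g.norm_coe_le_norm _)
  refine ⟨hI, ?_⟩
  rw [integral_pos_iff_support_of_nonneg i3 i1] at i4
  rw [integral_pos_iff_support_of_nonneg (fun ω => mul_nonneg (i3 ω) (hg _).le) hI]
  convert i4 using 2
  ext ω
  simp [(hg (V₀ ω)).ne']

/-! ### Lévy's continuity theorem and the portmanteau theorem for weighted measures -/

section Levy

variable {Ω Ω₂ E : Type*} [MeasurableSpace Ω] [MeasurableSpace Ω₂] {P : Measure Ω}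
  {P₂ : Measure Ω₂}
  [NormedAddCommGroup E] [MeasurableSpace E] [BorelSpace E] {w : ℕ → Ω → ℝ} {V : ℕ → Ω → E} {w₂ : Ω₂ → ℝ} {V₂ : Ω₂ → E} {c : ℝ}

/-- Lévy's continuity theorem for weighted measures. -/
lemma tendsto_integral_mul_of_tendsto_charFun [InnerProductSpace ℝ E] [FiniteDimensional ℝ E]
    (h0 : ∀ n, 0 ≤ w n) (hw : ∀ n, Integrable (w n) P)
    (hV : ∀ n, AEMeasurable (V n) P) (h0' : 0 ≤ w₂) (hw₂ : Integrable w₂ P₂)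
    (hpos₂ : 0 < ∫ ω, w₂ ω ∂P₂) (hV₂ : AEMeasurable V₂ P₂) (hc : 0 < c)
    (hpos : ∀ n, 0 < ∫ ω, w n ω ∂P)
    (h : ∀ x : E, Tendsto (fun n => ∫ ω, (w n ω : ℂ) * Complex.exp ((inner ℝ (V n ω) x : ℝ)
      * Complex.I) ∂P) atTop (𝓝 (c * ∫ ω, (w₂ ω : ℂ) * Complex.exp ((inner ℝ (V₂ ω) x : ℝ)
      * Complex.I) ∂P₂))) (f : E →ᵇ ℝ) :
    Tendsto (fun n => ∫ ω, w n ω * f (V n ω) ∂P) atTop (𝓝 (c * ∫ ω, w₂ ω * f (V₂ ω) ∂P₂)) := by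
  -- The weights are not normalized; the convergence of their total masses is the case of
  -- characteristic functions at 0.
  have hmass : Tendsto (fun n => ∫ ω, w n ω ∂P) atTop (𝓝 (c * ∫ ω, w₂ ω ∂P₂)) := by
    have h1 := (Complex.continuous_re.tendsto _).comp (h 0)
    simp only [inner_zero_right, Complex.ofReal_zero, zero_mul, Complex.exp_zero, mul_one,
      integral_complex_ofReal, Complex.re_ofReal_mul, Complex.ofReal_re] at h1
    refine h1.congr fun n => ?_
    simp
  set μ : ℕ → ProbabilityMeasure E := fun n =>
    ⟨densityLaw P (w n) (V n), isProbabilityMeasure_densityLaw (hw n) (h0 n) (hpos n) (hV n)⟩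
  set μ₀ : ProbabilityMeasure E :=
    ⟨densityLaw P₂ w₂ V₂, isProbabilityMeasure_densityLaw hw₂ h0' hpos₂ hV₂⟩
  have hlim : Tendsto μ atTop (𝓝 μ₀) := by
    rw [ProbabilityMeasure.tendsto_iff_tendsto_charFun]
    intro x
    have hsm : StronglyMeasurable fun v : E => Complex.exp ((inner ℝ v x : ℝ) * Complex.I) :=
      Continuous.stronglyMeasurable (by fun_prop)
    have e1 : ∀ n, charFun (μ n : Measure E) x = (∫ ω, w n ω ∂P)⁻¹ • ∫ ω, (w n ω : ℂ) *
        Complex.exp ((inner ℝ (V n ω) x : ℝ) * Complex.I) ∂P := by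
      intro n
      rw [charFun_apply]
      refine (integral_densityLaw (hw n) (h0 n) (hpos n) (hV n) hsm).trans ?_
      simp only [Complex.real_smul]
    have e2 : charFun (μ₀ : Measure E) x = (c * ∫ ω, w₂ ω ∂P₂)⁻¹ • (c * ∫ ω, (w₂ ω : ℂ) *
        Complex.exp ((inner ℝ (V₂ ω) x : ℝ) * Complex.I) ∂P₂) := by
      rw [charFun_apply]
      refine (integral_densityLaw hw₂ h0' hpos₂ hV₂ hsm).trans ?_
      simp only [Complex.real_smul]
      push_cast
      rw [mul_inv, mul_comm (c : ℂ)⁻¹, mul_assoc,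
        inv_mul_cancel_left₀ (by exact_mod_cast hc.ne' : (c : ℂ) ≠ 0)]
    simp_rw [e1, e2]
    exact (hmass.inv₀ (by positivity)).smul (h x)
  have h2 := hmass.mul ((ProbabilityMeasure.tendsto_iff_forall_integral_tendsto.mp hlim) f)
  have e3 : ∫ x, f x ∂(μ₀ : Measure E) = (∫ ω, w₂ ω ∂P₂)⁻¹ • ∫ ω, w₂ ω • f (V₂ ω) ∂P₂ :=
    integral_densityLaw hw₂ h0' hpos₂ hV₂ f.continuous.stronglyMeasurable
  rw [e3] at h2
  have e4 : c * ∫ ω, w₂ ω * f (V₂ ω) ∂P₂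
      = (c * ∫ ω, w₂ ω ∂P₂) * ((∫ ω, w₂ ω ∂P₂)⁻¹ • ∫ ω, w₂ ω • f (V₂ ω) ∂P₂) := by
    simp only [smul_eq_mul]
    field_simp
  rw [e4]
  refine h2.congr fun n => ?_
  have e5 : ∫ x, f x ∂(μ n : Measure E) = (∫ ω, w n ω ∂P)⁻¹ • ∫ ω, w n ω • f (V n ω) ∂P :=
    integral_densityLaw (hw n) (h0 n) (hpos n) (hV n) f.continuous.stronglyMeasurable
  rw [e5]
  have := (hpos n).ne'
  simp only [smul_eq_mul]
  field_simp

/-- The portmanteau theorem for weighted measures. -/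
lemma tendsto_setIntegral_of_tendsto_integral_mul (h0 : ∀ n, 0 ≤ w n)
    (hw : ∀ n, Integrable (w n) P) (hV : ∀ n, AEMeasurable (V n) P) (h0' : 0 ≤ w₂)
    (hw₂ : Integrable w₂ P₂) (hpos₂ : 0 < ∫ ω, w₂ ω ∂P₂) (hV₂ : AEMeasurable V₂ P₂) (hc : 0 < c)
    (hpos : ∀ n, 0 < ∫ ω, w n ω ∂P)
    (h : ∀ f : E →ᵇ ℝ, Tendsto (fun n => ∫ ω, w n ω * f (V n ω) ∂P) atTop
      (𝓝 (c * ∫ ω, w₂ ω * f (V₂ ω) ∂P₂)))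
    {A : Set E} (hA : MeasurableSet A) (hAf : ∀ᵐ ω ∂P₂, V₂ ω ∉ frontier A) :
    Tendsto (fun n => ∫ ω in V n ⁻¹' A, w n ω ∂P) atTop (𝓝 (c * ∫ ω in V₂ ⁻¹' A, w₂ ω ∂P₂)) := by
  have hmass : Tendsto (fun n => ∫ ω, w n ω ∂P) atTop (𝓝 (c * ∫ ω, w₂ ω ∂P₂)) := by
    simpa using h 1
  set μ : ℕ → ProbabilityMeasure E := fun n =>
    ⟨densityLaw P (w n) (V n), isProbabilityMeasure_densityLaw (hw n) (h0 n) (hpos n) (hV n)⟩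
  set μ₀ : ProbabilityMeasure E :=
    ⟨densityLaw P₂ w₂ V₂, isProbabilityMeasure_densityLaw hw₂ h0' hpos₂ hV₂⟩
  have hlim : Tendsto μ atTop (𝓝 μ₀) := by
    rw [ProbabilityMeasure.tendsto_iff_forall_integral_tendsto]
    intro f
    have e1 : ∀ n, ∫ x, f x ∂(μ n : Measure E)
        = (∫ ω, w n ω ∂P)⁻¹ • ∫ ω, w n ω • f (V n ω) ∂P := fun n =>
      integral_densityLaw (hw n) (h0 n) (hpos n) (hV n) f.continuous.stronglyMeasurable
    have e2 : ∫ x, f x ∂(μ₀ : Measure E)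
        = (c * ∫ ω, w₂ ω ∂P₂)⁻¹ • (c * ∫ ω, w₂ ω • f (V₂ ω) ∂P₂) := by
      refine (integral_densityLaw hw₂ h0' hpos₂ hV₂ f.continuous.stronglyMeasurable).trans ?_
      simp only [smul_eq_mul]
      field_simp
    simp_rw [e1, e2]
    exact (hmass.inv₀ (by positivity)).smul (h f)
  have hfr : (μ₀ : Measure E) (frontier A) = 0 := by
    change densityLaw P₂ w₂ V₂ (frontier A) = 0
    rw [densityLaw, Measure.map_apply_of_aemeasurable
      (hV₂.mono_ac (withDensity_absolutelyContinuous _ _)) isClosed_frontier.measurableSet]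
    refine withDensity_absolutelyContinuous _ _ ?_
    exact measure_eq_zero_iff_ae_notMem.mpr hAf
  have h3 := (ENNReal.tendsto_toReal (measure_ne_top _ _)).comp
    (ProbabilityMeasure.tendsto_measure_of_null_frontier_of_tendsto' hlim hfr)
  have h4 := hmass.mul h3
  have e6 : ((μ₀ : Measure E) A).toReal = (∫ ω, w₂ ω ∂P₂)⁻¹ * ∫ ω in V₂ ⁻¹' A, w₂ ω ∂P₂ :=
    densityLaw_real hw₂ h0' hpos₂ hV₂ hA
  rw [e6] at h4
  have e4 : c * ∫ ω in V₂ ⁻¹' A, w₂ ω ∂P₂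
      = (c * ∫ ω, w₂ ω ∂P₂) * ((∫ ω, w₂ ω ∂P₂)⁻¹ * ∫ ω in V₂ ⁻¹' A, w₂ ω ∂P₂) := by
    field_simp
  rw [e4]
  refine h4.congr fun n => ?_
  have e5 : ((μ n : Measure E) A).toReal = (∫ ω, w n ω ∂P)⁻¹ * ∫ ω in V n ⁻¹' A, w n ω ∂P :=
    densityLaw_real (hw n) (h0 n) (hpos n) (hV n) hA
  have := (hpos n).ne'
  simp only [Function.comp, e5]
  field_simp

/-- Convergence of weighted probabilities of continuity sets from the convergence of
characteristic functions. -/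
theorem tendsto_setIntegral_of_tendsto_charFun [IsProbabilityMeasure P] [InnerProductSpace ℝ E]
    [FiniteDimensional ℝ E] (h0 : ∀ n, 0 ≤ w n)
    (hw : ∀ᶠ n in atTop, Integrable (w n) P) (hV : ∀ n, AEMeasurable (V n) P) (h0' : 0 ≤ w₂)
    (hw₂ : Integrable w₂ P₂) (hpos₂ : 0 < ∫ ω, w₂ ω ∂P₂) (hV₂ : AEMeasurable V₂ P₂) (hc : 0 < c)
    (h : ∀ x : E, Tendsto (fun n => ∫ ω, (w n ω : ℂ) * Complex.exp ((inner ℝ (V n ω) x : ℝ)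
      * Complex.I) ∂P) atTop (𝓝 (c * ∫ ω, (w₂ ω : ℂ) * Complex.exp ((inner ℝ (V₂ ω) x : ℝ)
      * Complex.I) ∂P₂))) (g : E →ᵇ ℝ) (hg : ∀ x, 0 < g x)
    {A : Set E} (hA : MeasurableSet A) (hAf : ∀ᵐ ω ∂P₂, V₂ ω ∉ frontier A) :
    Tendsto (fun n => ∫ ω in V n ⁻¹' A, w n ω * g (V n ω) ∂P) atTop
      (𝓝 (c * ∫ ω in V₂ ⁻¹' A, w₂ ω * g (V₂ ω) ∂P₂)) := by
  classical
  have hmass : Tendsto (fun n => ∫ ω, w n ω ∂P) atTop (𝓝 (c * ∫ ω, w₂ ω ∂P₂)) := by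
    have h1 := (Complex.continuous_re.tendsto _).comp (h 0)
    simp only [inner_zero_right, Complex.ofReal_zero, zero_mul, Complex.exp_zero, mul_one,
      integral_complex_ofReal, Complex.re_ofReal_mul, Complex.ofReal_re] at h1
    refine h1.congr fun n => ?_
    simp
  have hgood : ∀ᶠ n in atTop, Integrable (w n) P ∧ 0 < ∫ ω, w n ω ∂P :=
    hw.and (hmass.eventually_const_lt (by positivity))
  -- Integrability and positive mass hold only for large n. The remaining weights are replaced by 1,
  -- which does not affect limits.
  set w' : ℕ → Ω → ℝ := fun n =>
    if Integrable (w n) P ∧ 0 < ∫ ω, w n ω ∂P then w n else 1 with hw'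
  have heq : ∀ᶠ n in atTop, w' n = w n := by
    filter_upwards [hgood] with n hn
    simp only [hw', if_pos hn]
  have h0w : ∀ n, 0 ≤ w' n := by
    intro n
    simp only [hw']
    split_ifs
    · exact h0 n
    · exact zero_le_one
  have hgoodw : ∀ n, Integrable (w' n) P ∧ 0 < ∫ ω, w' n ω ∂P := by
    intro n
    simp only [hw']
    split_ifs with hn
    · exact hn
    · exact ⟨integrable_const _, by simp⟩
  have key : ∀ f : E →ᵇ ℝ, Tendsto (fun n => ∫ ω, w' n ω * f (V n ω) ∂P) atTop
      (𝓝 (c * ∫ ω, w₂ ω * f (V₂ ω) ∂P₂)) := by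
    refine tendsto_integral_mul_of_tendsto_charFun h0w (fun n => (hgoodw n).1) hV h0' hw₂ hpos₂
      hV₂ hc (fun n => (hgoodw n).2) fun x => (h x).congr' ?_
    filter_upwards [heq] with n hn
    rw [hn]
  have h5 := tendsto_setIntegral_of_tendsto_integral_mul (w := fun n ω => w' n ω * g (V n ω))
    (w₂ := fun ω => w₂ ω * g (V₂ ω)) (fun n ω => mul_nonneg (h0w n ω) (hg _).le)
    (fun n => (integrable_mul_bounded hg (hgoodw n).1 (hV n) (h0w n) (hgoodw n).2).1) hV
    (fun ω => mul_nonneg (h0' ω) (hg _).le) (integrable_mul_bounded hg hw₂ hV₂ h0' hpos₂).1 (integrable_mul_bounded hg hw₂ hV₂ h0' hpos₂).2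
    hV₂ hc (fun n => (integrable_mul_bounded hg (hgoodw n).1 (hV n) (h0w n) (hgoodw n).2).2) (fun f => ?_) hA hAf
  · refine h5.congr' ?_
    filter_upwards [heq] with n hn
    simp only [hn]
  -- Multiplying the weights by g turns the test function f into g f, so weak convergence is
  -- inherited by the new weights.
  · have := key (g * f)
    simpa only [BoundedContinuousFunction.coe_mul, Pi.mul_apply, mul_assoc] using this

end Levy

/-- The bounded function `e^{-|y|} (1 + y²)`. -/
noncomputable def expWeight (y : ℝ) : ℝ := Real.exp (-|y|) * (1 + y ^ 2)

lemma expWeight_pos (y : ℝ) : 0 < expWeight y := by unfold expWeight; positivity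

lemma expWeight_le (y : ℝ) : expWeight y ≤ 2 := by
  have h := Real.quadratic_le_exp_of_nonneg (abs_nonneg y)
  rw [sq_abs] at h
  rw [expWeight, Real.exp_neg, inv_mul_le_iff₀ (Real.exp_pos _)]
  linarith [abs_nonneg y]

lemma continuous_expWeight : Continuous expWeight := by unfold expWeight; fun_prop

/-! ### From the Cauchy weight to the exponential law -/

section Cauchy

variable {Ω ι : Type*} [MeasurableSpace Ω] [Fintype ι] {P : Measure Ω} [IsProbabilityMeasure P]
  {w Y : ℕ → Ω → ℝ} {D : ℕ → ι → Ω → ℝ} {ν : Measure (ι → ℝ)} [IsProbabilityMeasure ν] {c : ℝ}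

/-- On y ≥ 0 the function e^{-|y|} is the density of the standard exponential law, and off it that
law has no mass; this is how T_0 enters. -/
lemma setIntegral_exp_neg_abs (ν : Measure (ι → ℝ)) [IsProbabilityMeasure ν] (δ : ℝ) :
    ∫ p in {p : (ι → ℝ) × ℝ | 0 ≤ p.2 ∧ ∀ i, δ ≤ p.2 + p.1 i}, Real.exp (-|p.2|) ∂(ν.prod volume)
      = (ν.prod (expMeasure 1)).real {p | ∀ i, δ ≤ p.2 + p.1 i} := by
  have hS : MeasurableSet {p : (ι → ℝ) × ℝ | ∀ i, δ ≤ p.2 + p.1 i} := by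
    simp_rw [Set.ofPred_forall]
    exact MeasurableSet.iInter fun i => measurableSet_le measurable_const (by fun_prop)
  have hS' : MeasurableSet {p : (ι → ℝ) × ℝ | 0 ≤ p.2 ∧ ∀ i, δ ≤ p.2 + p.1 i} :=
    (measurableSet_le measurable_const measurable_snd).inter hS
  have hexp : expMeasure 1 = volume.withDensity (exponentialPDF 1) := rfl
  have hm : Measurable (exponentialPDF 1) := (measurable_exponentialPDFReal 1).ennreal_ofReal
  have : SFinite (volume.withDensity (exponentialPDF 1)) := by
    rw [← hexp]
    have := isProbabilityMeasure_expMeasure one_pos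
    infer_instance
  rw [integral_eq_lintegral_of_nonneg_ae (ae_of_all _ fun p => (Real.exp_pos _).le)
    (by fun_prop), measureReal_def, hexp, prod_withDensity_right hm, withDensity_apply _ hS,
    ← lintegral_indicator hS, ← lintegral_indicator hS']
  congr 2
  ext p
  by_cases h1 : p ∈ {p : (ι → ℝ) × ℝ | ∀ i, δ ≤ p.2 + p.1 i}
  · rw [Set.indicator_of_mem h1]
    by_cases h2 : 0 ≤ p.2
    · rw [Set.indicator_of_mem (show p ∈ {p : (ι → ℝ) × ℝ | 0 ≤ p.2 ∧ ∀ i, δ ≤ p.2 + p.1 i} from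
        ⟨h2, h1⟩), exponentialPDF_of_nonneg h2, abs_of_nonneg h2]
      simp
    · rw [Set.indicator_of_notMem fun h => h2 h.1, exponentialPDF_of_neg (not_le.mp h2)]
  · rw [Set.indicator_of_notMem h1, Set.indicator_of_notMem fun h => h1 h.2]

/-- For each fixed first coordinate only one value of the second is excluded. With this the
boundaries of the sets considered are null. -/
lemma ae_prod_add_ne {ι : Type*} (ν : Measure (ι → ℝ)) [SFinite ν] (f : (ι → ℝ) → ℝ) (hf : Measurable f) :
    ∀ᵐ p ∂(ν.prod (volume : Measure ℝ)), p.2 + f p.1 ≠ 0 := by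
  have hm : MeasurableSet {p : (ι → ℝ) × ℝ | p.2 + f p.1 ≠ 0} :=
    (measurableSet_eq_fun (by fun_prop) measurable_const).compl
  rw [Measure.ae_prod_iff_ae_ae hm]
  refine ae_of_all _ fun d => ?_
  filter_upwards [Measure.ae_ne volume (-(f d))] with y hy h
  exact hy (by linarith)

/-- Weighted probabilities for variables whose weighted laws converge to the product of the Cauchy
law and of `ν`. -/
theorem tendsto_setIntegral_expWeight (hc : 0 < c) (h0 : ∀ n, 0 ≤ w n)
    (hw : ∀ᶠ n in atTop, Integrable (w n) P) (hY : ∀ n, AEMeasurable (Y n) P)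
    (hD : ∀ n i, AEMeasurable (D n i) P)
    (h : ∀ (ξ : ℝ) (l : ι → ℝ), Tendsto (fun n => ∫ ω, (w n ω : ℂ) *
      Complex.exp ((ξ * Y n ω + ∑ i, l i * D n i ω : ℝ) * Complex.I) ∂P) atTop
      (𝓝 ((c * Real.exp (-|ξ|) : ℝ) *
        ∫ d, Complex.exp ((∑ i, l i * d i : ℝ) * Complex.I) ∂ν))) (δ : ℝ) :
    Tendsto (fun n => ∫ ω in {ω | 0 ≤ Y n ω ∧ ∀ i, δ ≤ Y n ω + D n i ω},
      w n ω * expWeight (Y n ω) ∂P) atTop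
      (𝓝 (c / Real.pi * (ν.prod (expMeasure 1)).real {p | ∀ i, δ ≤ p.2 + p.1 i})) := by
  -- The Euclidean norm on the product provides the inner product in which the characteristic
  -- functions are expressed.
  set V : ℕ → Ω → WithLp 2 (ℝ × EuclideanSpace ℝ ι) := fun n ω =>
    WithLp.toLp 2 (Y n ω, WithLp.toLp 2 fun i => D n i ω)
  set V₂ : (ι → ℝ) × ℝ → WithLp 2 (ℝ × EuclideanSpace ℝ ι) := fun p =>
    WithLp.toLp 2 (p.2, WithLp.toLp 2 p.1)
  set g : WithLp 2 (ℝ × EuclideanSpace ℝ ι) →ᵇ ℝ :=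
    BoundedContinuousFunction.ofNormedAddCommGroup (fun x => expWeight x.fst)
      (continuous_expWeight.comp (WithLp.continuous_fst ..)) 2 fun x => by
        rw [Real.norm_of_nonneg (expWeight_pos _).le]
        exact expWeight_le _
  set A : Set (WithLp 2 (ℝ × EuclideanSpace ℝ ι)) :=
    {x | 0 ≤ x.fst ∧ ∀ i, δ ≤ x.fst + x.snd i} with hA
  have hcf : Continuous fun x : WithLp 2 (ℝ × EuclideanSpace ℝ ι) => x.fst :=
    WithLp.continuous_fst ..
  have hcs : ∀ i, Continuous fun x : WithLp 2 (ℝ × EuclideanSpace ℝ ι) => x.snd i := fun i =>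
    (EuclideanSpace.proj (𝕜 := ℝ) i).continuous.comp (WithLp.continuous_snd ..)
  have hAc : IsClosed A := by
    simp only [hA, Set.ofPred_and, Set.ofPred_forall]
    exact (isClosed_le continuous_const hcf).inter
      (isClosed_iInter fun i => isClosed_le continuous_const (hcf.add (hcs i)))
  have hAo : IsOpen {x : WithLp 2 (ℝ × EuclideanSpace ℝ ι) |
      0 < x.fst ∧ ∀ i, δ < x.fst + x.snd i} := by
    simp only [Set.ofPred_and, Set.ofPred_forall]
    exact (isOpen_lt continuous_const hcf).inter
      (isOpen_iInter_of_finite fun i => isOpen_lt continuous_const (hcf.add (hcs i)))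
  have hVm : ∀ n, AEMeasurable (V n) P := fun n =>
    (WithLp.measurable_toLp 2 _).comp_aemeasurable ((hY n).prodMk
      ((WithLp.measurable_toLp 2 _).comp_aemeasurable (aemeasurable_pi_lambda _ (hD n))))
  have hV₂m : Measurable V₂ :=
    (WithLp.measurable_toLp 2 _).comp (measurable_snd.prodMk
      ((WithLp.measurable_toLp 2 _).comp measurable_fst))
  have hwint : Integrable (fun p : (ι → ℝ) × ℝ => (1 + p.2 ^ 2)⁻¹) (ν.prod volume) :=
    integrable_inv_one_add_sq.comp_snd ν
  have hmass : ∫ p : (ι → ℝ) × ℝ, (1 + p.2 ^ 2)⁻¹ ∂(ν.prod volume) = Real.pi := by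
    have := integral_prod_mul (μ := ν) (ν := volume) (fun _ => (1 : ℝ))
      (fun y : ℝ => (1 + y ^ 2)⁻¹)
    simpa [integral_univ_inv_one_add_sq] using this
  -- A boundary point satisfies all defining inequalities and at least one of them with equality;
  -- each equality is a null event because y has Lebesgue measure.
  have hfr : ∀ᵐ p ∂(ν.prod (volume : Measure ℝ)), V₂ p ∉ frontier A := by
    have e1 := ae_prod_add_ne ν (fun _ => 0) measurable_const
    have e2 : ∀ᵐ p ∂(ν.prod (volume : Measure ℝ)), ∀ i, p.2 + (p.1 i - δ) ≠ 0 :=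
      ae_all_iff.mpr fun i => ae_prod_add_ne ν (fun d => d i - δ) (by fun_prop)
    filter_upwards [e1, e2] with p h1 h2 hp
    rw [hAc.frontier_eq] at hp
    have hsub : {x : WithLp 2 (ℝ × EuclideanSpace ℝ ι) | 0 < x.fst ∧ ∀ i, δ < x.fst + x.snd i}
        ⊆ A := fun x hx => ⟨hx.1.le, fun i => (hx.2 i).le⟩
    refine hp.2 (interior_maximal hsub hAo ?_)
    refine ⟨lt_of_le_of_ne hp.1.1 fun h => h1 ?_, fun i =>
      lt_of_le_of_ne (hp.1.2 i) fun h => h2 i ?_⟩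
    · change 0 = p.2 at h
      simp [← h]
    · change δ = p.2 + p.1 i at h
      rw [h]
      ring
  have hmain := tendsto_setIntegral_of_tendsto_charFun (P := P) (P₂ := ν.prod volume) (w := w)
    (V := V) (w₂ := fun p => (1 + p.2 ^ 2)⁻¹) (V₂ := V₂) (c := c / Real.pi) h0 hw hVm
    (fun p => by positivity) hwint (by rw [hmass]; exact Real.pi_pos) hV₂m.aemeasurable
    (div_pos hc Real.pi_pos) (fun x => ?_) g (fun x => expWeight_pos _) hAc.measurableSet hfr
  · rw [← setIntegral_exp_neg_abs]
    refine hmain.trans (le_of_eq ?_)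
    congr 2
    refine setIntegral_congr_fun ?_ fun p _ => ?_
    · exact hV₂m hAc.measurableSet
    · change (1 + p.2 ^ 2)⁻¹ * (Real.exp (-|p.2|) * (1 + p.2 ^ 2)) = Real.exp (-|p.2|)
      have : 1 + p.2 ^ 2 ≠ 0 := by positivity
      field_simp
  · have hin : ∀ (y : ℝ) (d : ι → ℝ), inner ℝ (WithLp.toLp 2 (y, WithLp.toLp 2 d) :
        WithLp 2 (ℝ × EuclideanSpace ℝ ι)) x = x.fst * y + ∑ i, x.snd i * d i := by
      intro y d
      rw [WithLp.prod_inner_apply]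
      simp [inner]
    simp only [V, V₂, hin]
    -- The Cauchy kernel has mass π and Fourier transform π e^{-|ξ|}, which explains the constant
    -- c/π.
    convert h x.fst (fun i => x.snd i) using 2
    have e1 : ∀ p : (ι → ℝ) × ℝ, (((1 + p.2 ^ 2)⁻¹ : ℝ) : ℂ) *
        Complex.exp ((x.fst * p.2 + ∑ i, x.snd i * p.1 i : ℝ) * Complex.I) =
        Complex.exp ((∑ i, x.snd i * p.1 i : ℝ) * Complex.I) *
        (((1 + p.2 ^ 2)⁻¹ : ℝ) * Complex.exp (x.fst * p.2 * Complex.I)) := by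
      intro p
      rw [Complex.ofReal_add, add_mul, Complex.exp_add]
      push_cast
      ring
    simp_rw [e1]
    rw [integral_prod_mul (fun d : ι → ℝ => Complex.exp ((∑ i, x.snd i * d i : ℝ) * Complex.I))
      (fun y : ℝ => ((1 + y ^ 2)⁻¹ : ℝ) * Complex.exp (x.fst * y * Complex.I)),
      integral_inv_one_add_sq_mul_cexp]
    generalize ∫ d : ι → ℝ, Complex.exp ((∑ i, x.snd i * d i : ℝ) * Complex.I) ∂ν = J
    push_cast
    have : (Real.pi : ℂ) ≠ 0 := by exact_mod_cast Real.pi_ne_zero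
    field_simp

end Cauchy

lemma cond_measureReal {Ω : Type*} [MeasurableSpace Ω] {P : Measure Ω} {E S : Set Ω}
    (hS : NullMeasurableSet S P) : (cond P E).real S = P.real (S ∩ E) / P.real E := by
  rw [ProbabilityTheory.cond, measureReal_def, Measure.smul_apply, smul_eq_mul, ENNReal.toReal_mul,
    Measure.restrict_apply₀ (hS.mono_ac Measure.restrict_le_self.absolutelyContinuous),
    ENNReal.toReal_inv, measureReal_def, measureReal_def, div_eq_inv_mul]

/-! ### Conditioning on the large deviation event -/

namespace IsLongMemoryModel

/-- The process `θ_n ((X_j + ⋯ + X_{n+j-1}) - n ε)`. -/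
noncomputable def walk {Ω : Type*} (F : Measure ℝ) (Z : ℤ → Ω → ℝ) (a : ℕ → ℝ) (ε : ℝ) (n j : ℕ)
    (ω : Ω) : ℝ :=
  tiltVar F Z a (tiltCoeff F a ε n) ω + linForm (movingAverage a Z) (incrCoeff F a ε n 0 j) ω

lemma walk_zero {Ω : Type*} (F : Measure ℝ) (Z : ℤ → Ω → ℝ) (a : ℕ → ℝ) (ε : ℝ) (n : ℕ) (ω : Ω) :
    walk F Z a ε n 0 ω = tiltVar F Z a (tiltCoeff F a ε n) ω := by
  have : incrCoeff F a ε n 0 0 = 0 := by simp [incrCoeff]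
  rw [walk, this, linForm_zero, add_zero]

lemma walk_sub {Ω : Type*} (F : Measure ℝ) (Z : ℤ → Ω → ℝ) (a : ℕ → ℝ) (ε : ℝ) (n i j : ℕ) (ω : Ω) :
    walk F Z a ε n j ω - walk F Z a ε n i ω
      = linForm (movingAverage a Z) (incrCoeff F a ε n i j) ω := by
  rw [walk, walk, ← incrCoeff_sub F a ε n 0 i j, linForm_sub]
  ring

variable {Ω : Type*} [MeasurableSpace Ω] {P : Measure Ω} {F : Measure ℝ}
  {Z : ℤ → Ω → ℝ} {a : ℕ → ℝ} {α : ℝ}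

lemma aemeasurable_walk (M : IsLongMemoryModel P F Z a α) (ε : ℝ) (n j : ℕ) :
    AEMeasurable (walk F Z a ε n j) P :=
  (M.aemeasurable_tiltVar _).add (M.aemeasurable_linForm _)

lemma mem_largeDevEvent_iff (M : IsLongMemoryModel P F Z a α) {ε : ℝ} {n : ℕ} (hn : 0 < n)
    (hV : 0 < ‖blockVec a 0 n‖) (hθ : 0 < tiltRate F a ε n) (j : ℕ) (ω : Ω) :
    ω ∈ largeDevEvent (movingAverage a Z) j n ε ↔ 0 ≤ walk F Z a ε n j ω := by
  have hv := M.variance_pos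
  have hn' : (0 : ℝ) < n := by exact_mod_cast hn
  have h1 : walk F Z a ε n j ω = tiltRate F a ε n *
      ((∑ i ∈ Finset.Ico j (n + j), movingAverage a Z i ω) - n * ε) := by
    rw [walk, tiltVar, M.norm_linVec_tiltCoeff_sq hV, tiltCoeff, incrCoeff, linForm_smul,
      linForm_smul, linForm_sub, linForm_blockCoeff, linForm_blockCoeff]
    field_simp
    ring
  rw [h1, mul_nonneg_iff_of_pos_left hθ, sub_nonneg, largeDevEvent, Set.mem_ofPred_eq,
    one_div, le_inv_mul_iff₀ hn']

/-- The normalization of `tiltDensity`. -/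
noncomputable def tiltMass (F : Measure ℝ) (a : ℕ → ℝ) (ε : ℝ) (n : ℕ) : ℝ :=
  ‖linVec a (tiltCoeff F a ε n)‖ *
    Real.exp (noiseVariance F * ‖linVec a (tiltCoeff F a ε n)‖ ^ 2 / 2)

/-- For Y ≥ 0 the factors e^Y/(1+Y²) and e^{-|Y|}(1+Y²) cancel. Hence the weighted integral over an
event contained in Y ≥ 0 is a deterministic constant times its probability. -/
lemma tiltDensity_mul_expWeight {Ω : Type*} (F : Measure ℝ) (Z : ℤ → Ω → ℝ) (a : ℕ → ℝ) (ε : ℝ)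
    (n : ℕ) {ω : Ω} (h : 0 ≤ tiltVar F Z a (tiltCoeff F a ε n) ω) :
    tiltDensity F Z a (tiltCoeff F a ε n) ω * expWeight (tiltVar F Z a (tiltCoeff F a ε n) ω)
      = tiltMass F a ε n := by
  rw [tiltDensity, expWeight, abs_of_nonneg h, tiltMass, Real.exp_neg]
  have h1 := (Real.exp_pos (tiltVar F Z a (tiltCoeff F a ε n) ω)).ne'
  have h2 : 1 + tiltVar F Z a (tiltCoeff F a ε n) ω ^ 2 ≠ 0 := by positivity
  field_simp

lemma eventually_tiltMass_pos (M : IsLongMemoryModel P F Z a α) {ε : ℝ} (hε : 0 < ε) :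
    ∀ᶠ n in atTop, 0 < tiltMass F a ε n := by
  obtain ⟨b, hb, -⟩ := M.exists_isTiltSequence hε
  filter_upwards [hb.norm_tendsto.eventually_gt_atTop 0] with n hn
  exact mul_pos hn (Real.exp_pos _)

lemma eventually_mem_largeDevEvent_iff (M : IsLongMemoryModel P F Z a α) {ε : ℝ} (hε : 0 < ε) :
    ∀ᶠ n in atTop, ∀ j ω,
      ω ∈ largeDevEvent (movingAverage a Z) j n ε ↔ 0 ≤ walk F Z a ε n j ω := by
  filter_upwards [eventually_gt_atTop 0, M.eventually_norm_blockVec_pos hε,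
    M.eventually_tiltRate_pos hε] with n h1 h2 h3 j ω
  exact M.mem_largeDevEvent_iff h1 h2 h3 j ω

variable {Ω' : Type*} [MeasurableSpace Ω'] {Q : Measure Ω'} {B : ℝ≥0 → Ω' → ℝ} {T₀ : Ω' → ℝ}

/-- The limit of the mass of the density `tiltDensity`. -/
noncomputable def massLimit (F : Measure ℝ) : ℝ := √(Real.pi / (noiseVariance F / 2)) / 2

lemma massLimit_pos (M : IsLongMemoryModel P F Z a α) : 0 < massLimit F := by
  have hv := M.variance_pos
  have := Real.pi_pos
  unfold massLimit
  positivity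

lemma aemeasurable_limitProc (hB : IsFractionalBrownianMotion (hurstIndex α) B Q) (ε : ℝ)
    (t : ℝ≥0) : AEMeasurable (limitProc F α ε B t) Q :=
  ((hB.gaussian.aemeasurable t).const_mul _).sub_const _

/-- Probabilities for the sum of the limit process and of an independent exponential variable. -/
lemma measureReal_prod_expMeasure [IsProbabilityMeasure Q]
    (hB : IsFractionalBrownianMotion (hurstIndex α) B Q) (hT₀ : HasLaw T₀ (expMeasure 1) Q)
    (hBT : IndepFun (fun ω t => B t ω) T₀ Q) {ι : Type*} [Fintype ι] (t : ι → ℝ≥0) (ε δ : ℝ) :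
    ((Q.map fun ω i => limitProc F α ε B (t i) ω).prod (expMeasure 1)).real
      {p | ∀ i, δ ≤ p.2 + p.1 i} = Q.real {ω | ∀ i, δ ≤ T₀ ω + limitProc F α ε B (t i) ω} := by
  have hm : AEMeasurable (fun ω i => limitProc F α ε B (t i) ω) Q :=
    aemeasurable_pi_lambda _ fun i => aemeasurable_limitProc hB ε (t i)
  have hind : IndepFun (fun ω i => limitProc F α ε B (t i) ω) T₀ Q := by
    have : Measurable fun (x : ℝ≥0 → ℝ) (i : ι) =>
        √(2 * limitDrift F α ε) * x (t i) - limitDrift F α ε * (t i : ℝ) ^ (3 - 2 * α) := by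
      fun_prop
    exact hBT.comp this measurable_id
  have hS : MeasurableSet {p : (ι → ℝ) × ℝ | ∀ i, δ ≤ p.2 + p.1 i} := by
    simp_rw [Set.ofPred_forall]
    exact MeasurableSet.iInter fun i => measurableSet_le measurable_const (by fun_prop)
  rw [← hT₀.map_eq, ← (indepFun_iff_map_prod_eq_prod_map_map hm hT₀.aemeasurable).mp hind,
    map_measureReal_apply_of_aemeasurable (hm.prodMk hT₀.aemeasurable) hS]
  rfl

/-- A sharp large deviation estimate: after multiplication by `tiltMass`, the probability that E_0
occurs and that the walk exceeds δ at finitely many times converges. The normalization cancels in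
conditional probabilities. -/
lemma tendsto_tiltMass_mul (M : IsLongMemoryModel P F Z a α) {ε : ℝ} (hε : 0 < ε)
    [IsProbabilityMeasure Q]
    (hB : IsFractionalBrownianMotion (hurstIndex α) B Q) (hT₀ : HasLaw T₀ (expMeasure 1) Q)
    (hBT : IndepFun (fun ω t => B t ω) T₀ Q) {ι : Type*} [Fintype ι] (t : ι → ℝ≥0) (δ : ℝ) :
    Tendsto (fun n => tiltMass F a ε n * P.real {ω | 0 ≤ walk F Z a ε n 0 ω ∧
      ∀ i, δ ≤ walk F Z a ε n (timeIndex α n (t i)) ω}) atTop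
      (𝓝 (massLimit F / Real.pi *
        Q.real {ω | ∀ i, δ ≤ T₀ ω + limitProc F α ε B (t i) ω})) := by
  have := M.isProb
  have hm : AEMeasurable (fun ω i => limitProc F α ε B (t i) ω) Q :=
    aemeasurable_pi_lambda _ fun i => aemeasurable_limitProc hB ε (t i)
  have : IsProbabilityMeasure (Q.map fun ω i => limitProc F α ε B (t i) ω) :=
    Measure.isProbabilityMeasure_map hm
  obtain ⟨b, hb, -⟩ := M.exists_isTiltSequence hε
  obtain ⟨ρ, K, hρ, hint⟩ := hb.exists_integral_tiltDensity_mul_exp_le M 0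
  have hw : ∀ᶠ n in atTop, Integrable (tiltDensity F Z a (tiltCoeff F a ε n)) P := by
    filter_upwards [hint] with n hn
    have := (hn 0 (by simp [linVec_zero, hρ.le]) (by simp [linVec_zero])
      (by simp [linVec_zero])).1
    simpa [linForm_zero] using this
  have h := tendsto_setIntegral_expWeight (P := P)
    (w := fun n => tiltDensity F Z a (tiltCoeff F a ε n))
    (Y := fun n => tiltVar F Z a (tiltCoeff F a ε n))
    (D := fun n i => linForm (movingAverage a Z) (incrCoeff F a ε n 0 (timeIndex α n (t i))))
    (ν := Q.map fun ω i => limitProc F α ε B (t i) ω) M.massLimit_pos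
    (fun n ω => tiltDensity_nonneg ..) hw (fun n => M.aemeasurable_tiltVar _)
    (fun n i => M.aemeasurable_linForm _) (fun ξ l => ?_) δ
  · rw [measureReal_prod_expMeasure hB hT₀ hBT] at h
    refine h.congr fun n => ?_
    have hnull : NullMeasurableSet {ω | 0 ≤ walk F Z a ε n 0 ω ∧
        ∀ i, δ ≤ walk F Z a ε n (timeIndex α n (t i)) ω} P := by
      simp only [Set.ofPred_and, Set.ofPred_forall]
      exact (nullMeasurableSet_le aemeasurable_const (M.aemeasurable_walk ε n 0)).inter
        (NullMeasurableSet.iInter fun i =>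
          nullMeasurableSet_le aemeasurable_const (M.aemeasurable_walk ε n _))
    have hset : {ω | 0 ≤ tiltVar F Z a (tiltCoeff F a ε n) ω ∧ ∀ i, δ ≤
        tiltVar F Z a (tiltCoeff F a ε n) ω + linForm (movingAverage a Z)
          (incrCoeff F a ε n 0 (timeIndex α n (t i))) ω} = {ω | 0 ≤ walk F Z a ε n 0 ω ∧
        ∀ i, δ ≤ walk F Z a ε n (timeIndex α n (t i)) ω} := by
      simp only [walk_zero]
      rfl
    rw [hset, setIntegral_congr_ae₀ (g := fun _ => tiltMass F a ε n) hnull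
      (ae_of_all _ fun ω hω => ?_)]
    · rw [setIntegral_const, smul_eq_mul, mul_comm]
    · refine tiltDensity_mul_expWeight F Z a ε n ?_
      rw [← walk_zero]
      exact hω.1
  · have hcont : Continuous fun d : ι → ℝ =>
        Complex.exp ((∑ i, l i * d i : ℝ) * Complex.I) := by fun_prop
    rw [integral_map hm hcont.aestronglyMeasurable]
    exact M.tendsto_integral_tiltDensity_incr hε hB t l ξ

lemma tendsto_tiltMass_mul_measureReal (M : IsLongMemoryModel P F Z a α) {ε : ℝ} (hε : 0 < ε)
    [IsProbabilityMeasure Q]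
    (hB : IsFractionalBrownianMotion (hurstIndex α) B Q) (hT₀ : HasLaw T₀ (expMeasure 1) Q)
    (hBT : IndepFun (fun ω t => B t ω) T₀ Q) :
    Tendsto (fun n => tiltMass F a ε n * P.real (largeDevEvent (movingAverage a Z) 0 n ε)) atTop
      (𝓝 (massLimit F / Real.pi)) := by
  -- With an empty family of times the second condition is void, and the estimate concerns E_0
  -- alone.
  have h := M.tendsto_tiltMass_mul hε hB hT₀ hBT (ι := Fin 0) (fun _ => 0) 0
  simp only [IsEmpty.forall_iff, and_true] at h
  simp only [Set.ofPred_true, probReal_univ, mul_one] at h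
  refine h.congr' ?_
  filter_upwards [M.eventually_mem_largeDevEvent_iff hε] with n hn
  congr 2
  ext ω
  exact (hn 0 ω).symm

lemma nullMeasurableSet_le_walk (M : IsLongMemoryModel P F Z a α) {ι : Type*} [Countable ι]
    (ε δ : ℝ) (n : ℕ) (j : ι → ℕ) :
    NullMeasurableSet {ω | ∀ i, δ ≤ walk F Z a ε n (j i) ω} P := by
  simp only [Set.ofPred_forall]
  exact NullMeasurableSet.iInter fun i =>
    nullMeasurableSet_le aemeasurable_const (M.aemeasurable_walk ε n _)

/-- Convergence of the finite-dimensional distributions of `walk`, conditionally on the event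
`E_0`. -/
theorem tendsto_cond_walk (M : IsLongMemoryModel P F Z a α) {ε : ℝ} (hε : 0 < ε)
    [IsProbabilityMeasure Q]
    (hB : IsFractionalBrownianMotion (hurstIndex α) B Q) (hT₀ : HasLaw T₀ (expMeasure 1) Q)
    (hBT : IndepFun (fun ω t => B t ω) T₀ Q) {ι : Type*} [Fintype ι] (t : ι → ℝ≥0) (δ : ℝ) :
    Tendsto (fun n => (cond P (largeDevEvent (movingAverage a Z) 0 n ε)).real
      {ω | ∀ i, δ ≤ walk F Z a ε n (timeIndex α n (t i)) ω}) atTop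
      (𝓝 (Q.real {ω | ∀ i, δ ≤ T₀ ω + limitProc F α ε B (t i) ω})) := by
  have hc := div_pos M.massLimit_pos Real.pi_pos
  have h := (M.tendsto_tiltMass_mul hε hB hT₀ hBT t δ).div
    (M.tendsto_tiltMass_mul_measureReal hε hB hT₀ hBT) hc.ne'
  rw [mul_div_cancel_left₀ _ hc.ne'] at h
  refine h.congr' ?_
  filter_upwards [M.eventually_mem_largeDevEvent_iff hε, M.eventually_tiltMass_pos hε] with n h1 h2
  rw [Pi.div_apply, mul_div_mul_left _ _ h2.ne', cond_measureReal
    (M.nullMeasurableSet_le_walk ε δ n _)]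
  congr 2
  ext ω
  exact and_comm.trans (and_congr_right fun _ => (h1 0 ω).symm)

lemma eventually_measure_largeDevEvent_ne_zero (M : IsLongMemoryModel P F Z a α) {ε : ℝ}
    (hε : 0 < ε) [IsProbabilityMeasure Q]
    (hB : IsFractionalBrownianMotion (hurstIndex α) B Q) (hT₀ : HasLaw T₀ (expMeasure 1) Q)
    (hBT : IndepFun (fun ω t => B t ω) T₀ Q) :
    ∀ᶠ n in atTop, P (largeDevEvent (movingAverage a Z) 0 n ε) ≠ 0 := by
  have hc := div_pos M.massLimit_pos Real.pi_pos
  filter_upwards [(M.tendsto_tiltMass_mul_measureReal hε hB hT₀ hBT).eventually_const_lt hc]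
    with n hn h
  simp [measureReal_def, h] at hn

/-- Second moments of the increments of `walk`, conditionally on the event `E_0`. -/
theorem exists_integral_cond_sq_le (M : IsLongMemoryModel P F Z a α) {ε : ℝ} (hε : 0 < ε)
    [IsProbabilityMeasure Q]
    (hB : IsFractionalBrownianMotion (hurstIndex α) B Q) (hT₀ : HasLaw T₀ (expMeasure 1) Q)
    (hBT : IndepFun (fun ω t => B t ω) T₀ Q) (T : ℝ) :
    ∃ K : ℝ, 0 < K ∧ ∀ᶠ n : ℕ in atTop, ∀ i j : ℕ, (i : ℝ) ≤ T * (n : ℝ) ^ scalingExponent α →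
      (j : ℝ) ≤ T * (n : ℝ) ^ scalingExponent α →
      Integrable (fun ω => (walk F Z a ε n j ω - walk F Z a ε n i ω) ^ 2)
        (cond P (largeDevEvent (movingAverage a Z) 0 n ε)) ∧
      ∫ ω, (walk F Z a ε n j ω - walk F Z a ε n i ω) ^ 2
        ∂(cond P (largeDevEvent (movingAverage a Z) 0 n ε))
        ≤ K * (|(i : ℝ) - j| / (n : ℝ) ^ scalingExponent α) ^ (3 - 2 * α) := by
  have hc := div_pos M.massLimit_pos Real.pi_pos
  set c := massLimit F / Real.pi
  obtain ⟨K, hK, h⟩ := M.exists_integral_tiltDensity_mul_sq_le hε T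
  refine ⟨2 * K / (c / 2), by positivity, ?_⟩
  filter_upwards [h, M.eventually_mem_largeDevEvent_iff hε, M.eventually_tiltMass_pos hε,
    (M.tendsto_tiltMass_mul_measureReal hε hB hT₀ hBT).eventually_const_lt (half_lt_self hc)]
    with n h1 h2 h3 h4 i j hi hj
  obtain ⟨hI, hle⟩ := h1 i j hi hj
  simp_rw [walk_sub]
  set E := largeDevEvent (movingAverage a Z) 0 n ε with hE
  have hEm : NullMeasurableSet E P := by
    have : E = {ω | 0 ≤ walk F Z a ε n 0 ω} := by
      ext ω
      exact h2 0 ω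
    rw [this]
    exact nullMeasurableSet_le aemeasurable_const (M.aemeasurable_walk ε n 0)
  set x := linForm (movingAverage a Z) (incrCoeff F a ε n i j)
  set w := tiltDensity F Z a (tiltCoeff F a ε n)
  -- On E the constant is density times `expWeight`, and `expWeight` is at most 2. Since the
  -- constant times P(E) eventually exceeds c/2, bounds under the density become bounds under the
  -- conditional law.
  have hpt : ∀ ω ∈ E, tiltMass F a ε n * x ω ^ 2 ≤ 2 * (w ω * x ω ^ 2) := by
    intro ω hω
    rw [h2, walk_zero] at hω
    rw [← tiltDensity_mul_expWeight F Z a ε n hω]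
    have hw0 : 0 ≤ w ω := tiltDensity_nonneg ..
    calc w ω * expWeight _ * x ω ^ 2 ≤ w ω * 2 * x ω ^ 2 := by
          gcongr
          exact expWeight_le _
      _ = _ := by ring
  have hI2 : Integrable (fun ω => 2 * (w ω * x ω ^ 2)) (P.restrict E) :=
    (hI.const_mul 2).restrict
  have hmx : AEStronglyMeasurable (fun ω => x ω ^ 2) (P.restrict E) :=
    ((M.aemeasurable_linForm _).pow_const 2).aestronglyMeasurable.restrict
  have haep : ∀ᵐ ω ∂(P.restrict E), ω ∈ E := ae_restrict_mem₀ hEm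
  have hI3 : Integrable (fun ω => tiltMass F a ε n * x ω ^ 2) (P.restrict E) := by
    refine hI2.mono' (hmx.const_mul _) ?_
    filter_upwards [haep] with ω hω
    rw [Real.norm_of_nonneg (by positivity)]
    exact hpt ω hω
  have hI4 : Integrable (fun ω => x ω ^ 2) (P.restrict E) := by
    refine (hI3.const_mul (tiltMass F a ε n)⁻¹).congr (ae_of_all _ fun ω => ?_)
    exact inv_mul_cancel_left₀ h3.ne' _
  have hPE : 0 < P.real E := (pos_iff_pos_of_mul_pos ((half_pos hc).trans h4)).mp h3
  have hPE0 : P E ≠ 0 := fun h => by simp [measureReal_def, h] at hPE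
  refine ⟨?_, ?_⟩
  · rw [ProbabilityTheory.cond]
    exact hI4.smul_measure (ENNReal.inv_ne_top.mpr hPE0)
  · rw [ProbabilityTheory.cond, integral_smul_measure, ENNReal.toReal_inv, smul_eq_mul]
    change (P.real E)⁻¹ * _ ≤ _
    set d := (|(i : ℝ) - j| / (n : ℝ) ^ scalingExponent α) ^ (3 - 2 * α)
    have e1 : tiltMass F a ε n * ∫ ω in E, x ω ^ 2 ∂P ≤ 2 * (K * d) := by
      rw [← integral_const_mul]
      refine (integral_mono_ae hI3 hI2 ?_).trans ?_
      · filter_upwards [haep] with ω hω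
        exact hpt ω hω
      · rw [integral_const_mul]
        refine mul_le_mul_of_nonneg_left (le_trans ?_ hle) zero_le_two
        exact setIntegral_le_integral hI (ae_of_all _ fun ω =>
          mul_nonneg (tiltDensity_nonneg ..) (sq_nonneg _))
    have e2 : (P.real E)⁻¹ * ∫ ω in E, x ω ^ 2 ∂P = (tiltMass F a ε n * P.real E)⁻¹ *
        (tiltMass F a ε n * ∫ ω in E, x ω ^ 2 ∂P) := by
      field_simp
    rw [e2, inv_mul_le_iff₀ ((half_pos hc).trans h4)]
    refine e1.trans ?_
    have hd : 0 ≤ d := by positivity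
    calc 2 * (K * d) = c / 2 * (2 * K / (c / 2) * d) := by field_simp
      _ ≤ tiltMass F a ε n * P.real E * (2 * K / (c / 2) * d) := by gcongr

end IsLongMemoryModel

/-! ### A maximal inequality by chaining -/

section Chaining

variable {Ω : Type*} [MeasurableSpace Ω] {μ : Measure Ω}

/-- A dyadic maximal inequality for processes whose increments have moments of order `p > 1`. -/
lemma exists_dyadic_bound {p : ℝ} (hp : 0 ≤ p) (r : ℕ) :
    ∀ (W : ℕ → Ω → ℝ) (K : ℝ), 0 ≤ K →
    (∀ i j : ℕ, i ≤ 2 ^ r → j ≤ 2 ^ r → Integrable (fun ω => (W j ω - W i ω) ^ 2) μ ∧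
      ∫ ω, (W j ω - W i ω) ^ 2 ∂μ ≤ K * |(i : ℝ) - j| ^ p) →
    ∃ M : Ω → ℝ, Integrable M μ ∧ (∀ ω, ∀ j ≤ 2 ^ r, (W j ω - W 0 ω) ^ 2 ≤ M ω) ∧
      ∫ ω, M ω ∂μ ≤ K * ((2 : ℝ) ^ r) ^ p *
        (1 + ∑ k ∈ Finset.range r, ((2 : ℝ) ^ (-((p - 1) / 2))) ^ k) ^ 2 := by
  -- At level r the 2^r unit increments have total second moment at most q^{2r} times the main term
  -- K(2^{r+1})^p; thus level r adds q^r to the L² bound, a geometric series.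
  set q : ℝ := (2 : ℝ) ^ (-((p - 1) / 2)) with hq
  have hq0 : 0 < q := Real.rpow_pos_of_pos two_pos _
  induction r with
  | zero =>
    intro W K hK h
    obtain ⟨h1, h2⟩ := h 0 1 (by norm_num) (by norm_num)
    refine ⟨fun ω => (W 1 ω - W 0 ω) ^ 2, h1, fun ω j hj => ?_, ?_⟩
    · have : j = 0 ∨ j = 1 := by
        rw [pow_zero] at hj
        omega
      rcases this with rfl | rfl
      · simpa using sq_nonneg _
      · exact le_rfl
    · simpa using h2
  | succ r ih =>
    intro W K hK h
    set G : ℝ := 1 + ∑ k ∈ Finset.range r, q ^ k with hG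
    have hG0 : 0 < G := by positivity
    -- The induction hypothesis is used on the even points, where doubled distances cost a factor
    -- 2^p. An odd point is one unit step away from its even neighbour, and S dominates all squares
    -- of such steps.
    obtain ⟨M, hM1, hM2, hM3⟩ := ih (fun j => W (2 * j)) (K * 2 ^ p) (by positivity) fun i j hi hj => by
      obtain ⟨h1, h2⟩ := h (2 * i) (2 * j) (by rw [pow_succ]; omega) (by rw [pow_succ]; omega)
      refine ⟨h1, h2.trans (le_of_eq ?_)⟩
      rw [mul_assoc, ← Real.mul_rpow zero_le_two (abs_nonneg _)]
      congr 2
      push_cast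
      rw [← mul_sub, abs_mul, abs_of_pos (two_pos (α := ℝ))]
    have hodd : ∀ l ∈ Finset.range (2 ^ r), Integrable
        (fun ω => (W (2 * l + 1) ω - W (2 * l) ω) ^ 2) μ ∧
        ∫ ω, (W (2 * l + 1) ω - W (2 * l) ω) ^ 2 ∂μ ≤ K := by
      intro l hl
      rw [Finset.mem_range] at hl
      obtain ⟨h1, h2⟩ := h (2 * l) (2 * l + 1) (by rw [pow_succ]; omega) (by rw [pow_succ]; omega)
      refine ⟨h1, h2.trans (le_of_eq ?_)⟩
      push_cast
      simp
    set S : Ω → ℝ := fun ω => ∑ l ∈ Finset.range (2 ^ r), (W (2 * l + 1) ω - W (2 * l) ω) ^ 2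
    have hS1 : Integrable S μ := integrable_finsetSum _ fun l hl => (hodd l hl).1
    have hS2 : ∫ ω, S ω ∂μ ≤ 2 ^ r * K := by
      rw [integral_finsetSum _ fun l hl => (hodd l hl).1]
      refine (Finset.sum_le_sum fun l hl => (hodd l hl).2).trans ?_
      simp
    set x : ℝ := q ^ r
    have hx : 0 < x := pow_pos hq0 r
    -- These are the weights in (y+z)² ≤ (1+x/G)y² + (1+G/x)z². When the two means are at most AG²
    -- and Ax² they give exactly A(G+x)², so the bounds add in L².
    refine ⟨fun ω => (1 + x / G) * M ω + (1 + G / x) * S ω,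
      (hM1.const_mul _).add (hS1.const_mul _), fun ω j hj => ?_, ?_⟩
    · have hM0 : 0 ≤ M ω := (sq_nonneg _).trans (hM2 ω 0 (by positivity))
      have hS0 : 0 ≤ S ω := Finset.sum_nonneg fun l _ => sq_nonneg _
      have hb : ∀ y z : ℝ, y ^ 2 ≤ M ω → z ^ 2 ≤ S ω →
          (y + z) ^ 2 ≤ (1 + x / G) * M ω + (1 + G / x) * S ω := by
        intro y z hy hz
        have e : (1 + x / G) * y ^ 2 + (1 + G / x) * z ^ 2 - (y + z) ^ 2
            = (x * y - G * z) ^ 2 / (x * G) := by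
          field_simp
          ring
        have e2 : 0 ≤ (x * y - G * z) ^ 2 / (x * G) := by positivity
        have e3 : (1 + x / G) * y ^ 2 ≤ (1 + x / G) * M ω := by gcongr
        have e4 : (1 + G / x) * z ^ 2 ≤ (1 + G / x) * S ω := by gcongr
        linarith
      rcases Nat.even_or_odd' j with ⟨l, rfl | rfl⟩
      · have h1 := hM2 ω l (by rw [pow_succ] at hj; omega)
        have := hb (W (2 * l) ω - W 0 ω) 0 (by simpa using h1) (by simpa using hS0)
        simpa using this
      · have hl : l < 2 ^ r := by rw [pow_succ] at hj; omega
        have h1 := hM2 ω l hl.le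
        have h2 := Finset.single_le_sum (f := fun l => (W (2 * l + 1) ω - W (2 * l) ω) ^ 2)
          (fun l _ => sq_nonneg _) (Finset.mem_range.mpr hl)
        have := hb (W (2 * l) ω - W 0 ω) (W (2 * l + 1) ω - W (2 * l) ω) (by simpa using h1) h2
        convert this using 2
        ring
    · rw [integral_add (hM1.const_mul _) (hS1.const_mul _), integral_const_mul, integral_const_mul,
        Finset.sum_range_succ, ← add_assoc]
      have e1 : K * 2 ^ p * ((2 : ℝ) ^ r) ^ p = K * ((2 : ℝ) ^ (r + 1)) ^ p := by
        rw [pow_succ, Real.mul_rpow (by positivity) zero_le_two]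
        ring
      rw [e1] at hM3
      have e2 : (2 : ℝ) ^ r ≤ ((2 : ℝ) ^ (r + 1)) ^ p * x ^ 2 := by
        have hx2 : x ^ 2 = (2 : ℝ) ^ (-((p - 1) * r)) := by
          simp only [x, hq]
          rw [← Real.rpow_natCast, ← Real.rpow_natCast, ← Real.rpow_mul two_pos.le,
            ← Real.rpow_mul two_pos.le]
          congr 1
          push_cast
          ring
        rw [hx2, ← Real.rpow_natCast, ← Real.rpow_natCast, ← Real.rpow_mul two_pos.le,
          ← Real.rpow_add two_pos]
        refine Real.rpow_le_rpow_of_exponent_le one_le_two ?_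
        push_cast
        nlinarith
      set A := K * ((2 : ℝ) ^ (r + 1)) ^ p with hA
      have hS3 : ∫ ω, S ω ∂μ ≤ A * x ^ 2 := by
        refine hS2.trans ?_
        rw [hA, mul_assoc, mul_comm]
        gcongr
      calc (1 + x / G) * ∫ ω, M ω ∂μ + (1 + G / x) * ∫ ω, S ω ∂μ
          ≤ (1 + x / G) * (A * G ^ 2) + (1 + G / x) * (A * x ^ 2) := by gcongr
        _ = A * (G + x) ^ 2 := by field_simp; ring

/-- Oscillation bound on blocks of length `m`. -/
lemma exists_block_bound {p : ℝ} (hp : 1 < p) :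
    ∃ G : ℝ, 0 < G ∧ ∀ {Ω : Type*} [MeasurableSpace Ω] (μ : Measure Ω) [IsFiniteMeasure μ]
      (W : ℕ → Ω → ℝ) (K : ℝ) (i₀ m : ℕ) (δ : ℝ), 0 ≤ K → 0 < m → 0 < δ →
    (∀ i j : ℕ, i ≤ i₀ + 2 * m → j ≤ i₀ + 2 * m → Integrable (fun ω => (W j ω - W i ω) ^ 2) μ ∧
      ∫ ω, (W j ω - W i ω) ^ 2 ∂μ ≤ K * |(i : ℝ) - j| ^ p) →
    μ.real {ω | ∃ j ≤ m, δ < |W (i₀ + j) ω - W i₀ ω|} ≤ G * K * (m : ℝ) ^ p / δ ^ 2 := by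
  set q : ℝ := (2 : ℝ) ^ (-((p - 1) / 2)) with hq
  have hq0 : 0 < q := Real.rpow_pos_of_pos two_pos _
  have hq1 : q < 1 := Real.rpow_lt_one_of_one_lt_of_neg one_lt_two (by linarith)
  have hq2 : 0 < (1 - q)⁻¹ := inv_pos.mpr (by linarith)
  refine ⟨2 ^ p * (1 + (1 - q)⁻¹) ^ 2, by positivity, ?_⟩
  intro Ω _ μ _ W K i₀ m δ hK hm hδ h
  -- The block is enlarged to the next power of two, which is at most 2m; this is why moments are
  -- required up to i₀ + 2m.
  set r := Nat.clog 2 m with hr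
  have hr1 : m ≤ 2 ^ r := Nat.le_pow_clog one_lt_two m
  have hr2 : 2 ^ r ≤ 2 * m := by
    rcases Nat.lt_or_ge 1 m with h1 | h1
    · have h2 := Nat.pow_pred_clog_lt_self one_lt_two h1
      have h3 : 0 < r := Nat.clog_pos one_lt_two h1
      obtain ⟨s, hs⟩ := Nat.exists_eq_succ_of_ne_zero h3.ne'
      rw [← hr, hs, Nat.pred_succ] at h2
      rw [hs, pow_succ]
      omega
    · have : m = 1 := by omega
      subst this
      simp [hr]
  obtain ⟨M, hM1, hM2, hM3⟩ := exists_dyadic_bound (μ := μ) (p := p) (by linarith) r (fun j => W (i₀ + j)) K hK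
    fun i j hi hj => by
      have := h (i₀ + i) (i₀ + j) (by omega) (by omega)
      push_cast at this
      simpa using this
  have hM0 : 0 ≤ M := fun ω => (sq_nonneg _).trans (hM2 ω 0 (by positivity))
  have hG : 1 + ∑ k ∈ Finset.range r, q ^ k ≤ 1 + (1 - q)⁻¹ := by
    gcongr
    exact (summable_geometric_of_lt_one hq0.le hq1).sum_le_tsum _ (fun _ _ => by positivity)
      |>.trans (tsum_geometric_of_lt_one hq0.le hq1).le
  have h2m : ((2 : ℝ) ^ r) ^ p ≤ 2 ^ p * (m : ℝ) ^ p := by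
    rw [← Real.mul_rpow zero_le_two (Nat.cast_nonneg m)]
    refine Real.rpow_le_rpow (by positivity) ?_ (by linarith)
    exact_mod_cast hr2
  have hmark := mul_meas_ge_le_integral_of_nonneg (ae_of_all μ hM0) hM1 (δ ^ 2)
  have hsub : {ω | ∃ j ≤ m, δ < |W (i₀ + j) ω - W i₀ ω|} ⊆ {ω | δ ^ 2 ≤ M ω} := by
    rintro ω ⟨j, hj, hlt⟩
    refine le_trans ?_ (hM2 ω j (hj.trans hr1))
    rw [← sq_abs (W (i₀ + j) ω - _)]
    exact pow_le_pow_left₀ hδ.le hlt.le 2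
  rw [le_div_iff₀ (by positivity), mul_comm]
  calc δ ^ 2 * μ.real {ω | ∃ j ≤ m, δ < |W (i₀ + j) ω - W i₀ ω|}
      ≤ δ ^ 2 * μ.real {ω | δ ^ 2 ≤ M ω} := by
        exact mul_le_mul_of_nonneg_left (measureReal_mono hsub) (sq_nonneg _)
    _ ≤ ∫ ω, M ω ∂μ := hmark
    _ ≤ K * ((2 : ℝ) ^ r) ^ p * (1 + ∑ k ∈ Finset.range r, q ^ k) ^ 2 := hM3
    _ ≤ K * (2 ^ p * (m : ℝ) ^ p) * (1 + (1 - q)⁻¹) ^ 2 := by gcongr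
    _ = _ := by ring

end Chaining

/-! ### Positivity of paths along dense sequences of times -/

section Paths

/-- The times are strictly positive because the first non-occurrence time only looks at indices j ≥
1. Time 0 is recovered from the closure. -/
lemma exists_timeSeq {t : ℝ≥0} (ht : 0 < t) :
    ∃ s : ℕ → ℝ≥0, (∀ k, 0 < s k ∧ s k ≤ t) ∧ Set.Icc 0 t ⊆ closure (Set.range s) := by
  have hne : Nonempty (Set.Ioc 0 t) := ⟨⟨t, ht, le_rfl⟩⟩
  refine ⟨fun k => (TopologicalSpace.denseSeq (Set.Ioc 0 t) k : Set.Ioc 0 t),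
    fun k => (TopologicalSpace.denseSeq (Set.Ioc 0 t) k).2, ?_⟩
  rw [← closure_Ioc ht.ne]
  refine closure_minimal (fun x hx => ?_) isClosed_closure
  have h1 := TopologicalSpace.denseRange_denseSeq (Set.Ioc 0 t) ⟨x, hx⟩
  have h2 := image_closure_subset_closure_image (continuous_subtype_val (p := (· ∈ Set.Ioc 0 t)))
    ⟨_, h1, rfl⟩
  rw [← Set.range_comp] at h2
  exact h2

variable {Ω' : Type*} [MeasurableSpace Ω'] {Q : Measure Ω'} {D : ℝ≥0 → Ω' → ℝ} {T₀ : Ω' → ℝ}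

lemma le_of_forall_timeSeq {f : ℝ≥0 → ℝ} (hf : Continuous f) {t : ℝ≥0} {s : ℕ → ℝ≥0}
    (hs : Set.Icc 0 t ⊆ closure (Set.range s)) {δ : ℝ} (h : ∀ k, δ ≤ f (s k)) {u : ℝ≥0}
    (hu : u ≤ t) : δ ≤ f u := by
  have hc : IsClosed {u | δ ≤ f u} := isClosed_le continuous_const hf
  refine closure_minimal ?_ hc (hs ⟨zero_le, hu⟩)
  rintro _ ⟨k, rfl⟩
  exact h k

lemma exists_pos_le_of_forall_pos {f : ℝ≥0 → ℝ} (hf : Continuous f) {t : ℝ≥0}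
    (h : ∀ u ≤ t, 0 < f u) : ∃ N : ℕ, ∀ u ≤ t, 1 / ((N : ℝ) + 1) ≤ f u := by
  obtain ⟨v, hv, hmin⟩ := (isCompact_Icc (a := (0 : ℝ≥0)) (b := t)).exists_isMinOn
    ⟨0, le_rfl, zero_le⟩ hf.continuousOn
  obtain ⟨N, hN⟩ := exists_nat_one_div_lt (h v hv.2)
  exact ⟨N, fun u hu => hN.le.trans (hmin ⟨zero_le, hu⟩)⟩

lemma nullMeasurableSet_forall_le {ι : Type*} [Countable ι] (hT : AEMeasurable T₀ Q)
    (hD : ∀ t, AEMeasurable (D t) Q) (s : ι → ℝ≥0) (δ : ℝ) :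
    NullMeasurableSet {ω | ∀ k, δ ≤ T₀ ω + D (s k) ω} Q := by
  simp only [Set.ofPred_forall]
  exact NullMeasurableSet.iInter fun k => nullMeasurableSet_le aemeasurable_const (hT.add (hD _))

/-- The process stays positive iff it is bounded below on a dense sequence. -/
lemma ae_forall_pos_iff (hDc : ∀ᵐ ω ∂Q, Continuous fun t => D t ω) {t : ℝ≥0}
    {s : ℕ → ℝ≥0} (hst : ∀ k, s k ≤ t) (hs : Set.Icc 0 t ⊆ closure (Set.range s)) :
    ∀ᵐ ω ∂Q, (∀ u ≤ t, 0 < T₀ ω + D u ω) ↔ ∃ N : ℕ, ∀ k, 1 / ((N : ℝ) + 1) ≤ T₀ ω + D (s k) ω := by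
  filter_upwards [hDc] with ω hω
  have hf : Continuous fun u => T₀ ω + D u ω := continuous_const.add hω
  refine ⟨fun h => ?_, ?_⟩
  · obtain ⟨N, hN⟩ := exists_pos_le_of_forall_pos hf h
    exact ⟨N, fun k => hN _ (hst k)⟩
  · rintro ⟨N, hN⟩ u hu
    exact lt_of_lt_of_le (by positivity) (le_of_forall_timeSeq hf hs hN hu)

instance : NullSingletonClass (expMeasure 1) := by
  have : expMeasure 1 ≪ volume := withDensity_absolutelyContinuous _ _
  exact ⟨fun x => this (measure_singleton x)⟩

/-- An independent exponential variable does not hit the infimum of a sequence. -/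
lemma ae_forall_nonneg_imp_exists [IsProbabilityMeasure Q] {f : Ω' → ℕ → ℝ}
    (hf : AEMeasurable f Q) (hT₀ : HasLaw T₀ (expMeasure 1) Q) (hind : IndepFun f T₀ Q) :
    ∀ᵐ ω ∂Q, (∀ k, 0 ≤ T₀ ω + f ω k) → ∃ N : ℕ, ∀ k, 1 / ((N : ℝ) + 1) ≤ T₀ ω + f ω k := by
  set S : Set ((ℕ → ℝ) × ℝ) :=
    {p | (∀ k, 0 ≤ p.2 + p.1 k) → ∃ N : ℕ, ∀ k, 1 / ((N : ℝ) + 1) ≤ p.2 + p.1 k} with hS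
  have hSm : MeasurableSet S := by
    have h1 : ∀ δ : ℝ, MeasurableSet {p : (ℕ → ℝ) × ℝ | ∀ k, δ ≤ p.2 + p.1 k} := fun δ => by
      simp only [Set.ofPred_forall]
      exact MeasurableSet.iInter fun k => measurableSet_le measurable_const (by fun_prop)
    have : S = {p : (ℕ → ℝ) × ℝ | ∀ k, 0 ≤ p.2 + p.1 k}ᶜ ∪
        ⋃ N : ℕ, {p : (ℕ → ℝ) × ℝ | ∀ k, 1 / ((N : ℝ) + 1) ≤ p.2 + p.1 k} := by
      ext p
      simp only [hS, Set.mem_ofPred_eq, Set.mem_union, Set.mem_compl_iff, Set.mem_iUnion]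
      tauto
    rw [this]
    exact (h1 0).compl.union (MeasurableSet.iUnion fun N => h1 _)
  have := isProbabilityMeasure_expMeasure one_pos
  have hprob : IsProbabilityMeasure (Q.map f) := Measure.isProbabilityMeasure_map hf
  have hae : ∀ᵐ p ∂((Q.map f).prod (expMeasure 1)), p ∈ S := by
    refine (Measure.ae_prod_iff_ae_ae hSm).mpr (ae_of_all _ fun g => ?_)
    -- For a fixed path g, a bad value y must be minus the infimum of g, so there is at most one.
    have hsub : {y : ℝ | (g, y) ∉ S}.Subsingleton := by
      have hlt : ∀ y y', (g, y) ∉ S → (g, y') ∉ S → ¬ y < y' := by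
        intro y y' hy hy' h
        simp only [hS, Set.mem_ofPred_eq, Classical.not_imp, not_exists, not_forall, not_le] at hy hy'
        obtain ⟨N, hN⟩ := exists_nat_one_div_lt (sub_pos.mpr h)
        obtain ⟨k, hk⟩ := hy'.2 N
        have := hy.1 k
        linarith
      intro y hy y' hy'
      exact le_antisymm (not_lt.mp (hlt y' y hy' hy)) (not_lt.mp (hlt y y' hy hy'))
    rw [ae_iff]
    exact hsub.measure_zero _
  rw [← hT₀.map_eq, ← (indepFun_iff_map_prod_eq_prod_map_map hf hT₀.aemeasurable).mp hind] at hae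
  exact ae_of_ae_map (hf.prodMk hT₀.aemeasurable) hae

end Paths

/-- The block of length `x / k + 1` which contains `j ≤ x`. -/
lemma exists_block {x : ℝ} {k j : ℕ} (hk : 0 < k) (hj : (j : ℝ) ≤ x) :
    ∃ i < k, ⌊x * (i / k)⌋₊ ≤ j ∧ j - ⌊x * (i / k)⌋₊ ≤ ⌊x / k⌋₊ + 1 := by
  have hk' : (0 : ℝ) < k := by exact_mod_cast hk
  have hj0 : (0 : ℝ) ≤ j := Nat.cast_nonneg j
  have key : ∃ i < k, x * (i / k) ≤ j ∧ (j : ℝ) ≤ x * (i / k) + x / k := by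
    rcases (hj0.trans hj).eq_or_lt with h0 | hx
    · exact ⟨0, hk, by simp, by simpa [← h0] using hj⟩
    have h1 : (j : ℝ) * k / x ≤ k := by
      rw [div_le_iff₀ hx, mul_comm]
      gcongr
    -- At the right end point j = x the floor of jk/x would be k, so the last block i = k - 1 is
    -- taken instead.
    rcases h1.eq_or_lt with h2 | h2
    · refine ⟨k - 1, by omega, ?_, ?_⟩
      all_goals
        rw [Nat.cast_sub hk, Nat.cast_one]
        have : (j : ℝ) = x := by
          field_simp at h2
          linarith
        rw [this]
        have e : x * ((k - 1) / k) = x - x / k := by field_simp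
        rw [e]
        have := div_pos hx hk'
        linarith
    · have h3 : (0 : ℝ) ≤ j * k / x := by positivity
      refine ⟨⌊(j : ℝ) * k / x⌋₊, (Nat.floor_lt h3).mpr h2, ?_, ?_⟩
      · have := Nat.floor_le h3
        rw [le_div_iff₀ hx] at this
        rw [← mul_div_assoc, div_le_iff₀ hk']
        linarith
      · have := (Nat.lt_floor_add_one ((j : ℝ) * k / x)).le
        rw [div_le_iff₀ hx] at this
        rw [← mul_div_assoc, ← add_div, le_div_iff₀ hk']
        linarith
  obtain ⟨i, hi, h1, h2⟩ := key
  have hx0 : 0 ≤ x := hj0.trans hj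
  refine ⟨i, hi, Nat.floor_le_of_le h1, ?_⟩
  rw [tsub_le_iff_right]
  have h3 := Nat.lt_floor_add_one (x * (i / k))
  have h4 := Nat.lt_floor_add_one (x / k)
  have h5 : (j : ℝ) < ((⌊x / k⌋₊ + 1 + ⌊x * (i / k)⌋₊ + 1 : ℕ) : ℝ) := by
    push_cast
    linarith
  have h6 : j < ⌊x / k⌋₊ + 1 + ⌊x * (i / k)⌋₊ + 1 := by exact_mod_cast h5
  omega

/-! ### Tails of the first non-occurrence time -/

namespace IsLongMemoryModel

variable {Ω : Type*} [MeasurableSpace Ω] {P : Measure Ω} {F : Measure ℝ}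
  {Z : ℤ → Ω → ℝ} {a : ℕ → ℝ} {α : ℝ}
  {Ω' : Type*} [MeasurableSpace Ω'] {Q : Measure Ω'} {B : ℝ≥0 → Ω' → ℝ} {T₀ : Ω' → ℝ}

lemma ae_continuous_limitProc (M : IsLongMemoryModel P F Z a α)
    (hB : IsFractionalBrownianMotion (hurstIndex α) B Q) (ε : ℝ) :
    ∀ᵐ ω ∂Q, Continuous fun t => limitProc F α ε B t ω := by
  have h₁ := M.lt_one
  filter_upwards [hB.continuous_paths] with ω hω
  have : Continuous fun t : ℝ≥0 => (t : ℝ) ^ (3 - 2 * α) :=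
    (Real.continuous_rpow_const (by linarith)).comp NNReal.continuous_coe
  unfold limitProc
  fun_prop

/-- Continuity gives the first description and the absence of atoms of T_0 the second. The first,
with a margin, serves the lower bound for the tails; the second, a countable intersection of closed
conditions, serves the upper bound. -/
lemma ae_exists_le_iff [IsProbabilityMeasure Q] (M : IsLongMemoryModel P F Z a α)
    (hB : IsFractionalBrownianMotion (hurstIndex α) B Q) (hT₀ : HasLaw T₀ (expMeasure 1) Q)
    (hBT : IndepFun (fun ω t => B t ω) T₀ Q) (ε : ℝ) {t : ℝ≥0}
    {s : ℕ → ℝ≥0} (hst : ∀ k, s k ≤ t) (hs : Set.Icc 0 t ⊆ closure (Set.range s)) :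
    ∀ᵐ ω ∂Q, ((∀ u ≤ t, 0 < T₀ ω + limitProc F α ε B u ω) ↔
        ∃ N : ℕ, ∀ k, 1 / ((N : ℝ) + 1) ≤ T₀ ω + limitProc F α ε B (s k) ω) ∧
      ((∀ u ≤ t, 0 < T₀ ω + limitProc F α ε B u ω) ↔
        ∀ k, 0 ≤ T₀ ω + limitProc F α ε B (s k) ω) := by
  have hm : AEMeasurable (fun ω (k : ℕ) => limitProc F α ε B (s k) ω) Q :=
    aemeasurable_pi_lambda _ fun k => aemeasurable_limitProc hB ε (s k)
  have hind : IndepFun (fun ω (k : ℕ) => limitProc F α ε B (s k) ω) T₀ Q := by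
    have : Measurable fun (x : ℝ≥0 → ℝ) (k : ℕ) =>
        √(2 * limitDrift F α ε) * x (s k) - limitDrift F α ε * (s k : ℝ) ^ (3 - 2 * α) := by
      fun_prop
    exact hBT.comp this measurable_id
  filter_upwards [ae_forall_pos_iff (T₀ := T₀) (M.ae_continuous_limitProc hB ε) hst hs,
    ae_forall_nonneg_imp_exists hm hT₀ hind] with ω h1 h2
  exact ⟨h1, fun h k => (h _ (hst k)).le, fun h => h1.mpr (h2 h)⟩

/-- Nonnegativity for all indices implies nonnegativity at finitely many times, where the limit is
known. Letting these times exhaust a dense sequence decreases the limit to the required probability.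
-/
lemma limsup_cond_le (M : IsLongMemoryModel P F Z a α) {ε : ℝ} (hε : 0 < ε)
    [IsProbabilityMeasure Q]
    (hB : IsFractionalBrownianMotion (hurstIndex α) B Q) (hT₀ : HasLaw T₀ (expMeasure 1) Q)
    (hBT : IndepFun (fun ω t => B t ω) T₀ Q) {t : ℝ≥0} (ht : 0 < t) {c : ℝ}
    (hc : Q.real {ω | ∀ u ≤ t, 0 < T₀ ω + limitProc F α ε B u ω} < c) :
    ∀ᶠ n : ℕ in atTop, (cond P (largeDevEvent (movingAverage a Z) 0 n ε)).real
      {ω | ∀ j : ℕ, 1 ≤ j → (j : ℝ) ≤ (n : ℝ) ^ scalingExponent α * t →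
        0 ≤ walk F Z a ε n j ω} < c := by
  obtain ⟨s, hs1, hs2⟩ := exists_timeSeq ht
  set A : ℕ → Set Ω' := fun N => {ω | ∀ i : Fin N, 0 ≤ T₀ ω + limitProc F α ε B (s i) ω} with hA
  have hlim : Tendsto (fun N => Q.real (A N)) atTop
      (𝓝 (Q.real {ω | ∀ u ≤ t, 0 < T₀ ω + limitProc F α ε B u ω})) := by
    have h1 : Q.real {ω | ∀ u ≤ t, 0 < T₀ ω + limitProc F α ε B u ω} = Q.real (⋂ N, A N) := by
      refine measureReal_congr (eventuallyEq_set.mpr ?_)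
      filter_upwards [M.ae_exists_le_iff hB hT₀ hBT ε (fun k => (hs1 k).2) hs2] with ω hω
      refine hω.2.trans ?_
      refine Iff.trans ?_ Set.mem_iInter.symm
      exact ⟨fun h N i => h i, fun h k => h (k + 1) ⟨k, Nat.lt_succ_self k⟩⟩
    rw [h1]
    refine (ENNReal.tendsto_toReal (measure_ne_top _ _)).comp (tendsto_measure_iInter_atTop
      (fun N => nullMeasurableSet_forall_le hT₀.aemeasurable (aemeasurable_limitProc hB ε) _ 0)
      (fun N N' hN ω hω i => hω ⟨i, i.2.trans_le hN⟩) ⟨0, measure_ne_top _ _⟩)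
  obtain ⟨N, hN⟩ := (hlim.eventually_lt_const hc).exists
  have hwalk := (M.tendsto_cond_walk hε hB hT₀ hBT (fun i : Fin N => s i) 0).eventually_lt_const hN
  have hidx : ∀ᶠ n : ℕ in atTop, ∀ i : Fin N, 1 ≤ timeIndex α n (s i) := by
    rw [eventually_all]
    intro i
    have h1 := (tendsto_rpow_natCast (scalingExponent_pos M.lt_one)).atTop_mul_const
      (show (0 : ℝ) < s i from (hs1 i).1)
    filter_upwards [h1.eventually_ge_atTop 1] with n hn
    exact Nat.le_floor (by simpa using hn)
  filter_upwards [hwalk, hidx, M.eventually_measure_largeDevEvent_ne_zero hε hB hT₀ hBT]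
    with n h1 h2 h3
  have := M.isProb
  have := cond_isProbabilityMeasure h3
  have hsub : {ω | ∀ j : ℕ, 1 ≤ j → (j : ℝ) ≤ (n : ℝ) ^ scalingExponent α * t →
      0 ≤ walk F Z a ε n j ω} ⊆ {ω | ∀ i : Fin N, 0 ≤ walk F Z a ε n (timeIndex α n (s i)) ω} := by
    intro ω hω i
    refine hω _ (h2 i) ((Nat.floor_le (by positivity)).trans ?_)
    gcongr
    exact (hs1 i).2
  exact lt_of_le_of_lt (measureReal_mono hsub) h1

/-- Each of the k blocks has an oscillation above δ with probability of order k^{-p}, p = 3 - 2α, so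
the union has probability of order k^{1-p}, small for large k since p > 1. -/
lemma exists_tendsto_osc (M : IsLongMemoryModel P F Z a α) {ε : ℝ} (hε : 0 < ε)
    [IsProbabilityMeasure Q]
    (hB : IsFractionalBrownianMotion (hurstIndex α) B Q) (hT₀ : HasLaw T₀ (expMeasure 1) Q)
    (hBT : IndepFun (fun ω t => B t ω) T₀ Q) {t : ℝ≥0} (ht : 0 < t) {δ η : ℝ} (hδ : 0 < δ)
    (hη : 0 < η) :
    ∃ k : ℕ, 0 < k ∧ ∀ᶠ n : ℕ in atTop,
      (cond P (largeDevEvent (movingAverage a Z) 0 n ε)).real {ω | ∃ i : Fin k,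
        ∃ j ≤ ⌊(n : ℝ) ^ scalingExponent α * t / k⌋₊ + 1,
        δ < |walk F Z a ε n (timeIndex α n (t * (i / k)) + j) ω
          - walk F Z a ε n (timeIndex α n (t * (i / k))) ω|} < η := by
  have h₁ := M.lt_one
  have hp : 1 < 3 - 2 * α := by linarith
  obtain ⟨G, hG, hblock⟩ := exists_block_bound hp
  -- With x = n^β ≥ 1, the indices up to i₀ + 2m are at most xt + 2(xt/k + 1) ≤ (3t+2)x.
  obtain ⟨K, hK, hsq⟩ := M.exists_integral_cond_sq_le hε hB hT₀ hBT (3 * t + 2)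
  have ht' : (0 : ℝ) < t := ht
  set p := 3 - 2 * α
  have hlim : Tendsto (fun k : ℕ => (k : ℝ) * (G * (K * (2 * (t / k)) ^ p) / δ ^ 2)) atTop
      (𝓝 0) := by
    have h1 := (tendsto_rpow_neg_natCast (show 0 < p - 1 by linarith)).const_mul
      (G * (K * (2 * (t : ℝ)) ^ p) / δ ^ 2)
    rw [mul_zero] at h1
    refine h1.congr' ?_
    filter_upwards [eventually_gt_atTop 0] with k hk
    have hk' : (0 : ℝ) < k := by exact_mod_cast hk
    rw [← mul_div_assoc 2, Real.div_rpow (by positivity) hk'.le, neg_sub, Real.rpow_sub hk',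
      Real.rpow_one]
    field_simp
  obtain ⟨k, hk1, hk0⟩ := ((hlim.eventually_lt_const hη).and (eventually_gt_atTop 0)).exists
  refine ⟨k, hk0, ?_⟩
  have hk' : (0 : ℝ) < k := by exact_mod_cast hk0
  have hβ := tendsto_rpow_natCast (scalingExponent_pos h₁)
  -- The condition n^β ≥ k/t makes the blocks at least one unit long, so that rounding at most
  -- doubles their length.
  filter_upwards [hsq, hβ.eventually_ge_atTop 1, hβ.eventually_ge_atTop (k / t),
    M.eventually_measure_largeDevEvent_ne_zero hε hB hT₀ hBT] with n h1 h2 h3 h4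
  have := M.isProb
  have := cond_isProbabilityMeasure h4
  set x := (n : ℝ) ^ scalingExponent α with hx
  set μ := cond P (largeDevEvent (movingAverage a Z) 0 n ε)
  set m := ⌊x * t / k⌋₊ + 1 with hm
  have hx0 : 0 < x := by linarith
  have hmle : (m : ℝ) ≤ x * t / k + 1 := by
    rw [hm]
    push_cast
    gcongr
    exact Nat.floor_le (by positivity)
  have hmle2 : (m : ℝ) ≤ x * (2 * (t / k)) := by
    have : 1 ≤ x * t / k := by
      rw [le_div_iff₀ hk', one_mul]
      rwa [div_le_iff₀ ht'] at h3
    calc (m : ℝ) ≤ x * t / k + x * t / k := by linarith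
      _ = _ := by ring
  have hk1' : (1 : ℝ) ≤ k := by exact_mod_cast hk0
  have hb : ∀ i : Fin k, μ.real {ω | ∃ j ≤ m, δ < |walk F Z a ε n
      (timeIndex α n (t * (i / k)) + j) ω - walk F Z a ε n (timeIndex α n (t * (i / k))) ω|}
      ≤ G * (K * (2 * (t / k)) ^ p) / δ ^ 2 := by
    intro i
    set i₀ := timeIndex α n (t * (i / k))
    have hi₀ : (i₀ : ℝ) ≤ x * t := by
      refine (Nat.floor_le (by positivity)).trans ?_
      have : (i : ℝ) / k ≤ 1 := by
        rw [div_le_one hk']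
        exact_mod_cast i.2.le
      calc x * (t * (i / k)) ≤ x * (t * 1) := by gcongr
        _ = x * t := by rw [mul_one]
    have hbound : ∀ j : ℕ, j ≤ i₀ + 2 * m → (j : ℝ) ≤ (3 * t + 2) * x := by
      intro j hj
      have hj' : (j : ℝ) ≤ i₀ + 2 * m := by exact_mod_cast hj
      have : x * t / k ≤ x * t := div_le_self (by positivity) hk1'
      nlinarith
    have h := hblock μ (fun j => walk F Z a ε n j) (K / x ^ p) i₀ m δ (by positivity)
      (Nat.succ_pos _) hδ fun i j hi hj => by
        obtain ⟨g1, g2⟩ := h1 i j (hbound i hi) (hbound j hj)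
        refine ⟨g1, g2.trans (le_of_eq ?_)⟩
        rw [Real.div_rpow (abs_nonneg _) hx0.le]
        ring
    refine h.trans ?_
    have e : G * (K / x ^ p) * (m : ℝ) ^ p = G * (K * (m / x) ^ p) := by
      rw [Real.div_rpow (Nat.cast_nonneg m) hx0.le]
      ring
    rw [e]
    gcongr
    rw [div_le_iff₀ hx0, mul_comm]
    exact hmle2
  refine lt_of_le_of_lt ?_ hk1
  rw [Set.ofPred_exists]
  refine (measureReal_iUnion_fintype_le _).trans ((Finset.sum_le_sum fun i _ => hb i).trans ?_)
  simp

/-- If the walk is at least δ at the grid points and moves by at most δ within each block, it is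
nonnegative throughout. The oscillation event is made to cost half of the gap between c and the
probability with margin δ. -/
lemma le_liminf_cond (M : IsLongMemoryModel P F Z a α) {ε : ℝ} (hε : 0 < ε)
    [IsProbabilityMeasure Q]
    (hB : IsFractionalBrownianMotion (hurstIndex α) B Q) (hT₀ : HasLaw T₀ (expMeasure 1) Q)
    (hBT : IndepFun (fun ω t => B t ω) T₀ Q) {t : ℝ≥0} (ht : 0 < t) {c : ℝ}
    (hc : c < Q.real {ω | ∀ u ≤ t, 0 < T₀ ω + limitProc F α ε B u ω}) :
    ∀ᶠ n : ℕ in atTop, c < (cond P (largeDevEvent (movingAverage a Z) 0 n ε)).real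
      {ω | ∀ j : ℕ, 1 ≤ j → (j : ℝ) ≤ (n : ℝ) ^ scalingExponent α * t →
        0 ≤ walk F Z a ε n j ω} := by
  obtain ⟨s, hs1, hs2⟩ := exists_timeSeq ht
  set A : ℕ → Set Ω' := fun N =>
    {ω | ∀ k, 1 / ((N : ℝ) + 1) ≤ T₀ ω + limitProc F α ε B (s k) ω} with hA
  have hlim : Tendsto (fun N => Q.real (A N)) atTop
      (𝓝 (Q.real {ω | ∀ u ≤ t, 0 < T₀ ω + limitProc F α ε B u ω})) := by
    have h1 : Q.real {ω | ∀ u ≤ t, 0 < T₀ ω + limitProc F α ε B u ω} = Q.real (⋃ N, A N) := by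
      refine measureReal_congr (eventuallyEq_set.mpr ?_)
      filter_upwards [M.ae_exists_le_iff hB hT₀ hBT ε (fun k => (hs1 k).2) hs2] with ω hω
      refine hω.1.trans ?_
      refine Iff.trans ?_ Set.mem_iUnion.symm
      exact ⟨fun ⟨N, hN⟩ => ⟨N, hN⟩, fun ⟨N, hN⟩ => ⟨N, hN⟩⟩
    rw [h1]
    refine (ENNReal.tendsto_toReal (measure_ne_top _ _)).comp
      (tendsto_measure_iUnion_atTop fun N N' hN ω hω k => le_trans ?_ (hω k))
    exact Nat.one_div_le_one_div hN
  obtain ⟨N, hN⟩ := (hlim.eventually_const_lt hc).exists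
  set δ : ℝ := 1 / ((N : ℝ) + 1) with hδdef
  have hδ : 0 < δ := by positivity
  obtain ⟨k, hk0, hosc⟩ := M.exists_tendsto_osc hε hB hT₀ hBT ht hδ
    (half_pos (sub_pos.mpr hN))
  have hk' : (0 : ℝ) < k := by exact_mod_cast hk0
  set τ : Fin k → ℝ≥0 := fun i => t * ((i : ℕ) / (k : ℕ)) with hτ
  have hτle : ∀ i, τ i ≤ t := fun i => by
    refine mul_le_of_le_one_right' (div_le_one_of_le₀ ?_ zero_le)
    exact_mod_cast i.2.le
  -- The grid points, 0 among them, need not belong to the dense sequence; the margin reaches them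
  -- by continuity.
  have hQ : Q.real (A N) ≤ Q.real {ω | ∀ i, δ ≤ T₀ ω + limitProc F α ε B (τ i) ω} := by
    refine ENNReal.toReal_mono (measure_ne_top _ _) (measure_mono_ae ?_)
    filter_upwards [M.ae_continuous_limitProc hB ε] with ω hω h i
    exact le_of_forall_timeSeq (continuous_const.add hω) hs2 h (hτle i)
  have hwalk := (M.tendsto_cond_walk hε hB hT₀ hBT τ δ).eventually_const_lt
    (show c + (Q.real (A N) - c) / 2 < _ by linarith)
  filter_upwards [hwalk, hosc, M.eventually_measure_largeDevEvent_ne_zero hε hB hT₀ hBT]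
    with n h1 h2 h3
  have := M.isProb
  have := cond_isProbabilityMeasure h3
  have hcast : ∀ i : Fin k, ((τ i : ℝ≥0) : ℝ) = t * (i / k) := fun i => by simp [hτ]
  simp only [hcast] at h1
  have hsub : {ω | ∀ i : Fin k, δ ≤ walk F Z a ε n (timeIndex α n (t * (i / k))) ω} ⊆
      {ω | ∀ j : ℕ, 1 ≤ j → (j : ℝ) ≤ (n : ℝ) ^ scalingExponent α * t →
        0 ≤ walk F Z a ε n j ω} ∪ {ω | ∃ i : Fin k,
        ∃ j ≤ ⌊(n : ℝ) ^ scalingExponent α * t / k⌋₊ + 1,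
        δ < |walk F Z a ε n (timeIndex α n (t * (i / k)) + j) ω
          - walk F Z a ε n (timeIndex α n (t * (i / k))) ω|} := by
    intro ω hω
    by_contra hcon
    rw [Set.mem_union, not_or] at hcon
    refine hcon.1 fun j _ hj => ?_
    obtain ⟨i, hi, g1, g2⟩ := exists_block hk0 hj
    have e : timeIndex α n (t * (i / k)) = ⌊(n : ℝ) ^ scalingExponent α * t * (i / k)⌋₊ := by
      rw [timeIndex, mul_assoc]
    have h5 : ¬ δ < |walk F Z a ε n (timeIndex α n (t * (i / k)) +
        (j - timeIndex α n (t * (i / k)))) ω - walk F Z a ε n (timeIndex α n (t * (i / k))) ω| :=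
      fun h => hcon.2 ⟨⟨i, hi⟩, _, by rw [e]; exact g2, h⟩
    rw [Nat.add_sub_cancel' (by rw [e]; exact g1), not_lt, abs_le] at h5
    have h6 := hω ⟨i, hi⟩
    simp only at h6
    linarith [h5.1]
  have h7 := (measureReal_mono hsub).trans (measureReal_union_le
    (μ := cond P (largeDevEvent (movingAverage a Z) 0 n ε)) _ _)
  linarith

/-- Convergence of the tails of the first non-occurrence times. -/
theorem tendsto_cond_forall_nonneg (M : IsLongMemoryModel P F Z a α) {ε : ℝ} (hε : 0 < ε)
    [IsProbabilityMeasure Q]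
    (hB : IsFractionalBrownianMotion (hurstIndex α) B Q) (hT₀ : HasLaw T₀ (expMeasure 1) Q)
    (hBT : IndepFun (fun ω t => B t ω) T₀ Q) {t : ℝ≥0} (ht : 0 < t) :
    Tendsto (fun n : ℕ => (cond P (largeDevEvent (movingAverage a Z) 0 n ε)).real
      {ω | ∀ j : ℕ, 1 ≤ j → (j : ℝ) ≤ (n : ℝ) ^ scalingExponent α * t →
        0 ≤ walk F Z a ε n j ω}) atTop
      (𝓝 (Q.real {ω | ∀ u ≤ t, 0 < T₀ ω + limitProc F α ε B u ω})) :=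
  tendsto_order.mpr ⟨fun _ hc => M.le_liminf_cond hε hB hT₀ hBT ht hc,
    fun _ hc => M.limsup_cond_le hε hB hT₀ hBT ht hc⟩

end IsLongMemoryModel

/-! ### The hitting time of the limit process -/

section HittingTime

/-- For the strict inequality, positivity at t extends to an interval to the right of t, so the
infimum is bounded away from t. -/
lemma coe_lt_iInf_iff {f : ℝ≥0 → ℝ} (hf : Continuous f) (t : ℝ≥0) :
    (t : ℝ≥0∞) < ⨅ (u : ℝ≥0) (_ : f u ≤ 0), (u : ℝ≥0∞) ↔ ∀ u ≤ t, 0 < f u := by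
  refine ⟨fun h u hu => ?_, fun h => ?_⟩
  · by_contra hfu
    have h1 := h.trans_le (iInf₂_le (f := fun (v : ℝ≥0) (_ : f v ≤ 0) => (v : ℝ≥0∞)) u
      (not_lt.mp hfu))
    exact absurd h1 (not_lt.mpr (ENNReal.coe_le_coe.mpr hu))
  · have hev : {u | 0 < f u} ∈ 𝓝 t := hf.continuousAt.eventually_const_lt (h t le_rfl)
    obtain ⟨v, hv, hsub⟩ := exists_Ico_subset_of_mem_nhds hev ⟨t + 1, by simp⟩
    refine (ENNReal.coe_lt_coe.mpr hv).trans_le (le_iInf₂ fun u hu => ?_)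
    rw [ENNReal.coe_le_coe]
    by_contra! huv
    rcases le_total u t with hut | htu
    · exact absurd (h u hut) (not_lt.mpr hu)
    · exact absurd (hsub ⟨htu, huv⟩ : 0 < f u) (not_lt.mpr hu)

lemma aemeasurable_of_nullMeasurableSet_Ioi {Ω : Type*} [MeasurableSpace Ω] {P : Measure Ω}
    {f : Ω → ℝ≥0∞} (h : ∀ t : ℝ≥0, NullMeasurableSet {ω | (t : ℝ≥0∞) < f ω} P) :
    AEMeasurable f P := by
  have h1 : ∀ x : ℝ≥0∞, NullMeasurableSet (f ⁻¹' Set.Ioi x) P := fun x => by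
    induction x with
    | top => simp
    | coe t => exact h t
  have h2 : Measurable (α := NullMeasurableSpace Ω P) f := measurable_of_Ioi h1
  exact NullMeasurable.aemeasurable fun s hs => h2 hs

lemma ae_pos_expMeasure : ∀ᵐ x ∂(expMeasure 1), 0 < x := by
  have h : expMeasure 1 (Set.Iio 0) = 0 := by
    rw [expMeasure, gammaMeasure, withDensity_apply _ measurableSet_Iio]
    exact lintegral_gammaPDF_of_nonpos le_rfl
  have h' : expMeasure 1 {0} = 0 := measure_singleton 0
  have h1 : ∀ᵐ x ∂(expMeasure 1), x ∉ Set.Iio (0 : ℝ) := measure_eq_zero_iff_ae_notMem.mp h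
  have h2 : ∀ᵐ x ∂(expMeasure 1), x ∉ ({0} : Set ℝ) := measure_eq_zero_iff_ae_notMem.mp h'
  filter_upwards [h1, h2] with x hx hx'
  exact lt_of_le_of_ne (not_lt.mp hx) (Ne.symm hx')

variable {Ω' : Type*} [MeasurableSpace Ω'] {Q : Measure Ω'} {B : ℝ≥0 → Ω' → ℝ} {T₀ : Ω' → ℝ}
  {H : ℝ}

lemma IsFractionalBrownianMotion.integrable_sq (hB : IsFractionalBrownianMotion H B Q) (t : ℝ≥0) :
    Integrable (fun ω => B t ω ^ 2) Q :=
  (hB.gaussian.hasGaussianLaw_eval t).memLp_two.integrable_sq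

lemma IsFractionalBrownianMotion.integral_sq (hB : IsFractionalBrownianMotion H B Q) (hH : 0 < H)
    (t : ℝ≥0) : ∫ ω, B t ω ^ 2 ∂Q = (t : ℝ) ^ (2 * H) := by
  have h := hB.covariance t t
  rw [sub_self, abs_zero, Real.zero_rpow (by positivity)] at h
  simp only [← pow_two] at h
  rw [h]
  ring

lemma IsFractionalBrownianMotion.ae_zero (hB : IsFractionalBrownianMotion H B Q) (hH : 0 < H) :
    ∀ᵐ ω ∂Q, B 0 ω = 0 := by
  have h := hB.integral_sq hH 0
  rw [NNReal.coe_zero, Real.zero_rpow (by positivity),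
    integral_eq_zero_iff_of_nonneg (fun ω => sq_nonneg _) (hB.integrable_sq 0)] at h
  filter_upwards [h] with ω hω
  exact pow_eq_zero_iff two_ne_zero |>.mp hω

/-- The law of large numbers along the integers. -/
lemma IsFractionalBrownianMotion.ae_tendsto_div (hB : IsFractionalBrownianMotion H B Q)
    (hH : 1 / 2 < H) :
    ∀ᵐ ω ∂Q, Tendsto (fun n : ℕ => B n ω / (n : ℝ) ^ (2 * H)) atTop (𝓝 0) := by
  have hH' : 0 < H := by linarith
  have hmeas : ∀ n : ℕ, AEMeasurable
      (fun ω => ENNReal.ofReal ((B n ω / (n : ℝ) ^ (2 * H)) ^ 2)) Q := fun n =>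
    (((hB.gaussian.aemeasurable n).div_const _).pow_const 2).ennreal_ofReal
  -- The second moment of B(n)/n^{2H} is n^{-2H}, summable because 2H > 1, so the series of squares
  -- converges almost surely. For n = 0 both sides vanish by the convention for division by zero.
  have hint : ∀ n : ℕ, ∫⁻ ω, ENNReal.ofReal ((B n ω / (n : ℝ) ^ (2 * H)) ^ 2) ∂Q
      ≤ ENNReal.ofReal (1 / (n : ℝ) ^ (2 * H)) := fun n => by
    have hi : Integrable (fun ω => (B n ω / (n : ℝ) ^ (2 * H)) ^ 2) Q := by
      simp only [div_pow]
      exact (hB.integrable_sq n).div_const _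
    rw [← ofReal_integral_eq_lintegral_ofReal hi (ae_of_all _ fun ω => sq_nonneg _)]
    refine ENNReal.ofReal_le_ofReal ?_
    simp only [div_pow]
    rw [integral_div, hB.integral_sq hH', NNReal.coe_natCast]
    rcases eq_or_ne ((n : ℝ) ^ (2 * H)) 0 with h0 | h0
    · simp [h0]
    · exact le_of_eq (by field_simp)
  have hsum : ∑' n : ℕ, ∫⁻ ω, ENNReal.ofReal ((B n ω / (n : ℝ) ^ (2 * H)) ^ 2) ∂Q ≠ ∞ := by
    refine ne_top_of_le_ne_top ?_ (ENNReal.tsum_le_tsum hint)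
    exact (Real.summable_one_div_nat_rpow.mpr (by linarith)).tsum_ofReal_ne_top
  rw [← lintegral_tsum hmeas] at hsum
  filter_upwards [ae_lt_top' (AEMeasurable.tsum hmeas) hsum] with ω hω
  have h1 := ENNReal.tendsto_atTop_zero_of_tsum_ne_top hω.ne
  have h2 := (ENNReal.tendsto_toReal ENNReal.zero_ne_top).comp h1
  have h3 : Tendsto (fun n : ℕ => (B n ω / (n : ℝ) ^ (2 * H)) ^ 2) atTop (𝓝 0) := by
    refine h2.congr fun n => ?_
    simp [ENNReal.toReal_ofReal (sq_nonneg (B n ω / (n : ℝ) ^ (2 * H)))]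
  have h4 := h3.sqrt
  simp only [Real.sqrt_sq_eq_abs, Real.sqrt_zero] at h4
  exact (tendsto_zero_iff_abs_tendsto_zero _).mpr h4

end HittingTime

namespace IsLongMemoryModel

variable {Ω : Type*} [MeasurableSpace Ω] {P : Measure Ω} {F : Measure ℝ}
  {Z : ℤ → Ω → ℝ} {a : ℕ → ℝ} {α : ℝ}
  {Ω' : Type*} [MeasurableSpace Ω'] {Q : Measure Ω'} {B : ℝ≥0 → Ω' → ℝ} {T₀ : Ω' → ℝ}

lemma sqrt_two_mul_limitDrift (M : IsLongMemoryModel P F Z a α) {ε : ℝ} (hε : 0 < ε) :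
    √(2 * limitDrift F α ε) = √2 * ε / (√(noiseVariance F) * √(constC α)) := by
  have hC := constC_pos M.half_lt M.lt_one
  have hv := M.variance_pos
  have h : 2 * limitDrift F α ε = 2 * (ε ^ 2 / (noiseVariance F * constC α)) := by
    rw [limitDrift, tiltLimit]
    field_simp
  rw [h, Real.sqrt_mul zero_le_two, Real.sqrt_div (sq_nonneg ε), Real.sqrt_sq hε.le,
    Real.sqrt_mul hv.le, mul_div_assoc]

/-- Multiplying the defining inequality by √(2γ) > 0 with γ = ε²/(σ²C_α) turns the barrier into
γt^{2H} - T_0. -/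
lemma hittingTime_eq {Ω₁ : Type*} {B : ℝ≥0 → Ω₁ → ℝ} {T₀ : Ω₁ → ℝ}
    (M : IsLongMemoryModel P F Z a α) {ε : ℝ} (hε : 0 < ε) (ω : Ω₁) :
    hittingTime α (noiseVariance F) ε B T₀ ω
      = ⨅ (t : ℝ≥0) (_ : T₀ ω + limitProc F α ε B t ω ≤ 0), (t : ℝ≥0∞) := by
  have hC := constC_pos M.half_lt M.lt_one
  have hv := M.variance_pos
  have hsC := Real.sqrt_pos.mpr hC
  have hsv := Real.sqrt_pos.mpr hv
  have hs := M.sqrt_two_mul_limitDrift hε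
  have hs2 : (0 : ℝ) < √2 := by positivity
  have hpos : 0 < √(2 * limitDrift F α ε) := by
    rw [hs]
    positivity
  have hd : limitDrift F α ε = ε ^ 2 / (noiseVariance F * constC α) := by
    rw [limitDrift, tiltLimit]
    field_simp
  refine iInf_congr fun t => iInf_congr_Prop ?_ fun _ => rfl
  have e1 : (2 * constC α) ^ (-(1 / 2) : ℝ) = (√2 * √(constC α))⁻¹ := by
    rw [Real.rpow_neg (by positivity), ← Real.sqrt_eq_rpow, Real.sqrt_mul zero_le_two]
  have e2 : (constC α / 2) ^ (1 / 2 : ℝ) = √(constC α) / √2 := by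
    rw [← Real.sqrt_eq_rpow, Real.sqrt_div hC.le]
  have e3 : 2 * hurstIndex α = 3 - 2 * α := by
    rw [hurstIndex]
    ring
  rw [e1, e2, e3, limitProc, ← mul_le_mul_iff_of_pos_left hpos]
  have e4 : √(2 * limitDrift F α ε) * ((√2 * √(constC α))⁻¹ * (√(noiseVariance F))⁻¹ * ε *
      (t : ℝ) ^ (3 - 2 * α) - √(constC α) / √2 * √(noiseVariance F) * ε⁻¹ * T₀ ω)
      = limitDrift F α ε * (t : ℝ) ^ (3 - 2 * α) - T₀ ω := by
    have e5 : noiseVariance F * constC α = √(noiseVariance F) ^ 2 * √(constC α) ^ 2 := by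
      rw [Real.sq_sqrt hv.le, Real.sq_sqrt hC.le]
    rw [hs, hd, e5]
    field_simp
  rw [e4]
  constructor <;> intro h <;> linarith

lemma ae_lt_hittingTime_iff (M : IsLongMemoryModel P F Z a α) {ε : ℝ} (hε : 0 < ε)
    (hB : IsFractionalBrownianMotion (hurstIndex α) B Q) :
    ∀ᵐ ω ∂Q, ∀ t : ℝ≥0, (t : ℝ≥0∞) < hittingTime α (noiseVariance F) ε B T₀ ω ↔
      ∀ u ≤ t, 0 < T₀ ω + limitProc F α ε B u ω := by
  filter_upwards [M.ae_continuous_limitProc hB ε] with ω hω t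
  rw [M.hittingTime_eq hε]
  exact coe_lt_iInf_iff (continuous_const.add hω) t

lemma half_lt_hurstIndex (M : IsLongMemoryModel P F Z a α) : 1 / 2 < hurstIndex α := by
  have := M.lt_one
  rw [hurstIndex]
  linarith

/-- At time 0 the limit process equals T_0 > 0, because B(0) = 0 almost surely. -/
lemma ae_hittingTime_pos (M : IsLongMemoryModel P F Z a α) {ε : ℝ} (hε : 0 < ε)
    (hB : IsFractionalBrownianMotion (hurstIndex α) B Q) (hT₀ : HasLaw T₀ (expMeasure 1) Q) :
    ∀ᵐ ω ∂Q, 0 < hittingTime α (noiseVariance F) ε B T₀ ω := by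
  have hT : ∀ᵐ ω ∂Q, 0 < T₀ ω := by
    have := ae_pos_expMeasure
    rw [← hT₀.map_eq] at this
    exact ae_of_ae_map hT₀.aemeasurable this
  have hp : 3 - 2 * α ≠ 0 := by linarith [M.lt_one]
  filter_upwards [M.ae_lt_hittingTime_iff (T₀ := T₀) hε hB, hT,
    hB.ae_zero (by linarith [M.half_lt_hurstIndex])] with ω h1 h2 h3
  rw [← ENNReal.coe_zero, h1 0]
  intro u hu
  obtain rfl : u = 0 := le_antisymm hu zero_le
  simpa [limitProc, h3, Real.zero_rpow hp] using h2

/-- Along the integers B(n) and T_0 are negligible compared with n^{2H}, so the negative drift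
forces a crossing. -/
lemma ae_hittingTime_lt_top (M : IsLongMemoryModel P F Z a α) {ε : ℝ} (hε : 0 < ε)
    (hB : IsFractionalBrownianMotion (hurstIndex α) B Q) :
    ∀ᵐ ω ∂Q, hittingTime α (noiseVariance F) ε B T₀ ω < ∞ := by
  have hp : 0 < 3 - 2 * α := by linarith [M.lt_one]
  have h2H : 2 * hurstIndex α = 3 - 2 * α := by
    rw [hurstIndex]
    ring
  filter_upwards [hB.ae_tendsto_div M.half_lt_hurstIndex] with ω hω
  rw [h2H] at hω
  have hpow : Tendsto (fun n : ℕ => (n : ℝ) ^ (3 - 2 * α)) atTop atTop :=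
    (tendsto_rpow_atTop hp).comp tendsto_natCast_atTop_atTop
  have hlim : Tendsto (fun n : ℕ => T₀ ω / (n : ℝ) ^ (3 - 2 * α)
      + √(2 * limitDrift F α ε) * (B n ω / (n : ℝ) ^ (3 - 2 * α))) atTop (𝓝 0) := by
    simpa using (hpow.const_div_atTop (T₀ ω)).add (hω.const_mul √(2 * limitDrift F α ε))
  obtain ⟨n, hn, hn0⟩ := ((hlim.eventually_lt_const (M.limitDrift_pos hε)).and
    (eventually_gt_atTop 0)).exists
  rw [M.hittingTime_eq hε]
  refine (iInf₂_le (n : ℝ≥0) ?_).trans_lt ENNReal.coe_lt_top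
  have hnp : 0 < (n : ℝ) ^ (3 - 2 * α) := Real.rpow_pos_of_pos (by exact_mod_cast hn0) _
  rw [← mul_div_assoc, ← add_div, div_lt_iff₀ hnp] at hn
  rw [limitProc, NNReal.coe_natCast]
  linarith

lemma aemeasurable_hittingTime (M : IsLongMemoryModel P F Z a α) {ε : ℝ} (hε : 0 < ε)
    [IsProbabilityMeasure Q]
    (hB : IsFractionalBrownianMotion (hurstIndex α) B Q) (hT₀ : HasLaw T₀ (expMeasure 1) Q)
    (hBT : IndepFun (fun ω t => B t ω) T₀ Q) :
    AEMeasurable (hittingTime α (noiseVariance F) ε B T₀) Q := by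
  refine aemeasurable_of_nullMeasurableSet_Ioi fun t => ?_
  -- Dense positive times exist only for t > 0; for t = 0 the set has full measure.
  rcases eq_or_ne t 0 with rfl | ht
  · refine NullMeasurableSet.congr (s := Set.univ) MeasurableSet.univ.nullMeasurableSet ?_
    refine eventuallyEq_set.mpr ?_
    filter_upwards [M.ae_hittingTime_pos hε hB hT₀] with ω hω
    simpa using hω
  · obtain ⟨s, hs1, hs2⟩ := exists_timeSeq (pos_iff_ne_zero.mpr ht)
    refine NullMeasurableSet.congr (nullMeasurableSet_forall_le hT₀.aemeasurable
      (aemeasurable_limitProc (F := F) hB ε) s 0) ?_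
    refine eventuallyEq_set.mpr ?_
    filter_upwards [M.ae_lt_hittingTime_iff (T₀ := T₀) hε hB,
      M.ae_exists_le_iff hB hT₀ hBT ε (fun k => (hs1 k).2) hs2] with ω h1 h2
    exact h2.2.symm.trans (h1 t).symm

end IsLongMemoryModel

/-! ### The first index at which the large deviation event fails -/

section FirstNonOccurrence

variable {Ω : Type*} {X : ℕ → Ω → ℝ} {n : ℕ} {ε β : ℝ}

/-- The strict inequality holds at integer y too: if no index up to y fails, the first failure is at
least ⌊y⌋ + 1 > y. The value ∞ needs no separate case. -/
lemma ofReal_lt_firstNonOccurrence_iff {y : ℝ} (hy : 0 ≤ y) (ω : Ω) :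
    ENNReal.ofReal y < (firstNonOccurrence X n ε ω : ℝ≥0∞) ↔
      ∀ j : ℕ, 1 ≤ j → (j : ℝ) ≤ y → ω ∈ largeDevEvent X j n ε := by
  refine ⟨fun h j hj hjy => ?_, fun h => ?_⟩
  · by_contra hE
    have h1 : firstNonOccurrence X n ε ω ≤ (j : ℕ∞) :=
      (iInf₂_le j hj).trans (iInf_le _ hE)
    have h2 : (firstNonOccurrence X n ε ω : ℝ≥0∞) ≤ (j : ℝ≥0∞) := by
      exact_mod_cast ENat.toENNReal_le.mpr h1
    have h3 : (j : ℝ≥0∞) ≤ ENNReal.ofReal y := by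
      rw [← ENNReal.ofReal_natCast]
      exact ENNReal.ofReal_le_ofReal hjy
    exact absurd h (not_lt.mpr (h2.trans h3))
  · have h1 : ((⌊y⌋₊ + 1 : ℕ) : ℕ∞) ≤ firstNonOccurrence X n ε ω := by
      refine le_iInf fun j => le_iInf fun hj => le_iInf fun hE => ?_
      have : y < j := by
        by_contra! hjy
        exact hE (h j hj hjy)
      exact_mod_cast (Nat.floor_lt hy).mpr this
    have h2 : ((⌊y⌋₊ + 1 : ℕ) : ℝ≥0∞) ≤ (firstNonOccurrence X n ε ω : ℝ≥0∞) := by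
      exact_mod_cast ENat.toENNReal_le.mpr h1
    refine lt_of_lt_of_le ?_ h2
    rw [← ENNReal.ofReal_natCast, ENNReal.ofReal_lt_ofReal_iff (by positivity)]
    exact_mod_cast Nat.lt_floor_add_one y

lemma coe_lt_scaledFirstNonOccurrence_iff (hn : 0 < n) (t : ℝ≥0) (ω : Ω) :
    (t : ℝ≥0∞) < scaledFirstNonOccurrence X β n ε ω ↔
      ∀ j : ℕ, 1 ≤ j → (j : ℝ) ≤ (n : ℝ) ^ β * t → ω ∈ largeDevEvent X j n ε := by
  have hn' : (0 : ℝ) < n := by exact_mod_cast hn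
  have hc : 0 < (n : ℝ) ^ β := Real.rpow_pos_of_pos hn' _
  rw [← ofReal_lt_firstNonOccurrence_iff (by positivity), scaledFirstNonOccurrence,
    Real.rpow_neg hn'.le, ENNReal.ofReal_inv_of_pos hc, ENNReal.ofReal_mul hc.le,
    ENNReal.ofReal_coe_nnreal, mul_comm _ (firstNonOccurrence X n ε ω : ℝ≥0∞), ← div_eq_mul_inv,
    ENNReal.lt_div_iff_mul_lt (Or.inl (by simpa using hc)) (Or.inl ENNReal.ofReal_ne_top), mul_comm]

end FirstNonOccurrence

namespace IsLongMemoryModel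

variable {Ω : Type*} [MeasurableSpace Ω] {P : Measure Ω} {F : Measure ℝ}
  {Z : ℤ → Ω → ℝ} {a : ℕ → ℝ} {α : ℝ}

lemma nullMeasurableSet_largeDevEvent (M : IsLongMemoryModel P F Z a α) (j n : ℕ) (ε : ℝ) :
    NullMeasurableSet (largeDevEvent (movingAverage a Z) j n ε) P :=
  nullMeasurableSet_le aemeasurable_const
    ((Finset.aemeasurable_fun_sum _ fun i _ => M.aemeasurable_movingAverage i).const_mul _)

lemma aemeasurable_scaledFirstNonOccurrence (M : IsLongMemoryModel P F Z a α) (ε : ℝ) (n : ℕ) :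
    AEMeasurable (scaledFirstNonOccurrence (movingAverage a Z) (scalingExponent α) n ε) P := by
  -- For n = 0 the factor 0^{-β} is 0 by convention and the variable is constant.
  rcases Nat.eq_zero_or_pos n with rfl | hn
  · have hβ : -scalingExponent α ≠ 0 := by
      have := M.lt_one
      rw [scalingExponent, neg_ne_zero]
      exact div_ne_zero (by linarith) (by linarith)
    have : scaledFirstNonOccurrence (movingAverage a Z) (scalingExponent α) 0 ε
        = fun _ => (0 : ℝ≥0∞) := by
      ext ω
      simp [scaledFirstNonOccurrence, Real.zero_rpow hβ]
    rw [this]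
    exact aemeasurable_const
  · refine aemeasurable_of_nullMeasurableSet_Ioi fun t => ?_
    simp only [coe_lt_scaledFirstNonOccurrence_iff hn, Set.ofPred_forall]
    exact NullMeasurableSet.iInter fun j => NullMeasurableSet.iInter fun _ =>
      NullMeasurableSet.iInter fun _ => M.nullMeasurableSet_largeDevEvent j n ε

end IsLongMemoryModel

/-- Weak convergence on `[0, ∞]` follows from the convergence of the tails. -/
theorem weaklyConverges_of_tendsto_Ioi {μ : ℕ → Measure ℝ≥0∞} {ν : Measure ℝ≥0∞}
    [IsProbabilityMeasure ν] (hμ : ∀ᶠ n in atTop, IsProbabilityMeasure (μ n))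
    (h : ∀ t : ℝ≥0, 0 < t →
      Tendsto (fun n => (μ n).real (Set.Ioi t)) atTop (𝓝 (ν.real (Set.Ioi t)))) :
    WeaklyConverges μ ν := by
  classical
  -- The sets ∅ and univ stand for the end points ∞ and 0. As the family is a chain, it is closed
  -- under finite intersections and unions.
  set 𝒯 : Set (Set ℝ≥0∞) := {T | T = ∅ ∨ T = Set.univ ∨ ∃ t : ℝ≥0, 0 < t ∧ T = Set.Ioi (t : ℝ≥0∞)}
    with h𝒯
  have hchain : ∀ S ∈ 𝒯, ∀ T ∈ 𝒯, S ⊆ T ∨ T ⊆ S := by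
    rintro S (rfl | rfl | ⟨s, -, rfl⟩) T (rfl | rfl | ⟨t, -, rfl⟩)
    on_goal 9 => exact (le_total (t : ℝ≥0∞) s).imp Set.Ioi_subset_Ioi Set.Ioi_subset_Ioi
    all_goals simp
  have hinter : ∀ S ∈ 𝒯, ∀ T ∈ 𝒯, S ∩ T ∈ 𝒯 := fun S hS T hT => by
    rcases hchain S hS T hT with h | h
    · rwa [Set.inter_eq_left.mpr h]
    · rwa [Set.inter_eq_right.mpr h]
  have hunion : ∀ S ∈ 𝒯, ∀ T ∈ 𝒯, S ∪ T ∈ 𝒯 := fun S hS T hT => by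
    rcases hchain S hS T hT with h | h
    · rwa [Set.union_eq_right.mpr h]
    · rwa [Set.union_eq_left.mpr h]
  have hmeas : ∀ S ∈ 𝒯, MeasurableSet S := by
    rintro S (rfl | rfl | ⟨s, -, rfl⟩)
    exacts [MeasurableSet.empty, MeasurableSet.univ, measurableSet_Ioi]
  have hlim : ∀ S ∈ 𝒯, Tendsto (fun n => (μ n).real S) atTop (𝓝 (ν.real S)) := by
    rintro S (rfl | rfl | ⟨s, hs, rfl⟩)
    · simp
    · refine tendsto_const_nhds.congr' ?_
      filter_upwards [hμ] with n hn
      simp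
    · exact h s hs
  -- Differences of half-lines are intervals; they form a π-system that contains arbitrarily small
  -- neighbourhoods of every point of [0, ∞], and this suffices for weak convergence.
  set π : Set (Set ℝ≥0∞) := {D | ∃ S ∈ 𝒯, ∃ T ∈ 𝒯, D = S \ T} with hπ
  have hpi : IsPiSystem π := by
    rintro _ ⟨S, hS, T, hT, rfl⟩ _ ⟨S', hS', T', hT', rfl⟩ -
    refine ⟨S ∩ S', hinter S hS S' hS', T ∪ T', hunion T hT T' hT', ?_⟩
    ext x
    simp only [Set.mem_inter_iff, Set.mem_sdiff, Set.mem_union]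
    tauto
  set p : ℕ → ProbabilityMeasure ℝ≥0∞ := fun n =>
    if hn : IsProbabilityMeasure (μ n) then ⟨μ n, hn⟩ else ⟨ν, inferInstance⟩ with hp
  have hpμ : ∀ᶠ n in atTop, (p n : Measure ℝ≥0∞) = μ n := by
    filter_upwards [hμ] with n hn
    simp [hp, hn]
  have key : Tendsto p atTop (𝓝 (⟨ν, inferInstance⟩ : ProbabilityMeasure ℝ≥0∞)) := by
    refine hpi.tendsto_probabilityMeasure_of_tendsto_of_mem ?_ ?_ ?_
    · rintro _ ⟨S, hS, T, hT, rfl⟩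
      exact (hmeas S hS).diff (hmeas T hT)
    · intro u hu x hx
      have hux := hu.mem_nhds hx
      have hlow : ∃ S ∈ 𝒯, S ∈ 𝓝 x ∧ ∀ y ∈ S, y ≤ x → y ∈ u := by
        rcases eq_or_ne x 0 with rfl | hx0
        · refine ⟨Set.univ, Or.inr (Or.inl rfl), univ_mem, fun y _ hy => ?_⟩
          obtain rfl : y = 0 := le_antisymm hy zero_le
          exact hx
        · obtain ⟨l, hl, hsub⟩ := exists_Ioc_subset_of_mem_nhds hux ⟨0, pos_iff_ne_zero.mpr hx0⟩
          obtain ⟨s, hs1, hs2⟩ := ENNReal.lt_iff_exists_nnreal_btwn.mp hl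
          refine ⟨Set.Ioi (s : ℝ≥0∞), Or.inr (Or.inr ⟨s, ?_, rfl⟩), Ioi_mem_nhds hs2,
            fun y hy hyx => hsub ⟨hs1.trans hy, hyx⟩⟩
          exact_mod_cast (zero_le.trans_lt hs1 : (0 : ℝ≥0∞) < s)
      have hupp : ∃ T ∈ 𝒯, Tᶜ ∈ 𝓝 x ∧ ∀ y ∈ Tᶜ, x ≤ y → y ∈ u := by
        rcases eq_or_ne x ∞ with rfl | hx0
        · refine ⟨∅, Or.inl rfl, by simp, fun y _ hy => ?_⟩
          obtain rfl : y = ∞ := top_le_iff.mp hy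
          exact hx
        · obtain ⟨r, hr, hsub⟩ := exists_Ico_subset_of_mem_nhds hux ⟨∞, lt_top_iff_ne_top.mpr hx0⟩
          obtain ⟨s, hs1, hs2⟩ := ENNReal.lt_iff_exists_nnreal_btwn.mp hr
          refine ⟨Set.Ioi (s : ℝ≥0∞), Or.inr (Or.inr ⟨s, ?_, rfl⟩), ?_,
            fun y hy hyx => hsub ⟨hyx, lt_of_le_of_lt ?_ hs2⟩⟩
          · exact_mod_cast (zero_le.trans_lt hs1 : (0 : ℝ≥0∞) < s)
          · rw [Set.compl_Ioi]
            exact Iic_mem_nhds hs1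
          · simpa using hy
      obtain ⟨S, hS, hSx, hSu⟩ := hlow
      obtain ⟨T, hT, hTx, hTu⟩ := hupp
      refine ⟨S \ T, ⟨S, hS, T, hT, rfl⟩, inter_mem hSx hTx, fun y hy => ?_⟩
      rcases le_total y x with hyx | hyx
      · exact hSu y hy.1 hyx
      · exact hTu y hy.2 hyx
    · rintro _ ⟨S, hS, T, hT, rfl⟩
      have hdiff : ∀ (m : Measure ℝ≥0∞) [IsProbabilityMeasure m],
          m.real (S \ T) = m.real S - m.real (S ∩ T) := fun m _ => by
        rw [← measureReal_inter_add_sdiff (μ := m) (s := S) (hmeas T hT)]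
        ring
      have h1 : Tendsto (fun n => (μ n).real (S \ T)) atTop (𝓝 (ν.real (S \ T))) := by
        rw [hdiff]
        refine ((hlim S hS).sub (hlim _ (hinter S hS T hT))).congr' ?_
        filter_upwards [hμ] with n hn
        exact (hdiff (μ n)).symm
      refine NNReal.tendsto_coe.mp (h1.congr' ?_)
      filter_upwards [hpμ] with n hn
      rw [← hn]
      rfl
  intro f
  refine ((ProbabilityMeasure.tendsto_iff_forall_integral_tendsto.mp key) f).congr' ?_
  filter_upwards [hpμ] with n hn
  rw [hn]

namespace IsLongMemoryModel

variable {Ω : Type*} [MeasurableSpace Ω] {P : Measure Ω} {F : Measure ℝ}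
  {Z : ℤ → Ω → ℝ} {a : ℕ → ℝ} {α : ℝ}
  {Ω' : Type*} [MeasurableSpace Ω'] {Q : Measure Ω'} {B : ℝ≥0 → Ω' → ℝ} {T₀ : Ω' → ℝ}

theorem weaklyConverges_scaledFirstNonOccurrence (M : IsLongMemoryModel P F Z a α) {ε : ℝ}
    (hε : 0 < ε) [IsProbabilityMeasure Q]
    (hB : IsFractionalBrownianMotion (hurstIndex α) B Q) (hT₀ : HasLaw T₀ (expMeasure 1) Q)
    (hBT : IndepFun (fun ω t => B t ω) T₀ Q) :
    WeaklyConverges (fun n : ℕ => (cond P (largeDevEvent (movingAverage a Z) 0 n ε)).map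
        (scaledFirstNonOccurrence (movingAverage a Z) (scalingExponent α) n ε))
      (Q.map (hittingTime α (noiseVariance F) ε B T₀)) := by
  have := M.isProb
  have hτ := M.aemeasurable_hittingTime hε hB hT₀ hBT
  have hI : ∀ n, AEMeasurable
      (scaledFirstNonOccurrence (movingAverage a Z) (scalingExponent α) n ε)
      (cond P (largeDevEvent (movingAverage a Z) 0 n ε)) := fun n =>
    (M.aemeasurable_scaledFirstNonOccurrence ε n).mono_ac cond_absolutelyContinuous
  have := Measure.isProbabilityMeasure_map hτ
  refine weaklyConverges_of_tendsto_Ioi ?_ fun t ht => ?_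
  · filter_upwards [M.eventually_measure_largeDevEvent_ne_zero hε hB hT₀ hBT] with n hn
    have := cond_isProbabilityMeasure hn
    exact Measure.isProbabilityMeasure_map (hI n)
  · have h1 : (Q.map (hittingTime α (noiseVariance F) ε B T₀)).real (Set.Ioi t)
        = Q.real {ω | ∀ u ≤ t, 0 < T₀ ω + limitProc F α ε B u ω} := by
      rw [map_measureReal_apply_of_aemeasurable hτ measurableSet_Ioi]
      refine measureReal_congr (eventuallyEq_set.mpr ?_)
      filter_upwards [M.ae_lt_hittingTime_iff (T₀ := T₀) hε hB] with ω hω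
      exact hω t
    rw [h1]
    refine (M.tendsto_cond_forall_nonneg hε hB hT₀ hBT ht).congr' ?_
    filter_upwards [M.eventually_mem_largeDevEvent_iff hε, eventually_gt_atTop 0] with n h2 hn
    rw [map_measureReal_apply_of_aemeasurable (hI n) measurableSet_Ioi]
    congr 1
    ext ω
    simp only [Set.mem_preimage, Set.mem_Ioi, coe_lt_scaledFirstNonOccurrence_iff hn, h2,
      Set.mem_ofPred_eq]

end IsLongMemoryModel

end LongMemory

theorem theorem2p1
    {Ω Ω' : Type*} [MeasurableSpace Ω] [MeasurableSpace Ω']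
    (P : Measure Ω) [IsProbabilityMeasure P] (Q : Measure Ω') [IsProbabilityMeasure Q]
    -- the noise, its law and the coefficients
    (F : Measure ℝ) (Z : ℤ → Ω → ℝ) (a : ℕ → ℝ) (α : ℝ)
    (hlaw : ∀ k : ℤ, HasLaw (Z k) F P) (hindep : iIndepFun Z P)
    (hnondeg : ∀ c : ℝ, F ≠ Measure.dirac c)
    (hα₀ : 1 / 2 < α) (hα₁ : α < 1)
    (hexp : LongMemory.HasExponentialMoments F)
    (ha : LongMemory.IsPowerType a α)
    (hsmooth : LongMemory.SmoothTiltedCharFun F)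
    (hmom : LongMemory.MatchesGaussianMoments F (LongMemory.kappa α))
    -- the fractional Brownian motion and the exponential variable of the limit
    (B : ℝ≥0 → Ω' → ℝ) (T₀ : Ω' → ℝ)
    (hB : LongMemory.IsFractionalBrownianMotion (LongMemory.hurstIndex α) B Q)
    (hT₀ : HasLaw T₀ (expMeasure 1) Q)
    (hBT : IndepFun (fun ω t => B t ω) T₀ Q)
    (ε : ℝ) (hε : 0 < ε) :
    -- the series defining the process converge almost surely
    (∀ n : ℕ, ∀ᵐ ω ∂P, Tendsto
      (fun N : ℕ => ∑ i ∈ Finset.range N, a i * Z ((n : ℤ) - (i : ℤ)) ω) atTop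
      (𝓝 (LongMemory.movingAverage a Z n ω))) ∧
    -- the conditional law makes sense for all large `n`
    (∀ᶠ n : ℕ in atTop,
      P (LongMemory.largeDevEvent (LongMemory.movingAverage a Z) 0 n ε) ≠ 0) ∧
    (∀ n : ℕ, AEMeasurable (LongMemory.scaledFirstNonOccurrence
      (LongMemory.movingAverage a Z) (LongMemory.scalingExponent α) n ε) P) ∧
    -- the limit is an almost surely finite and strictly positive random variable
    AEMeasurable (LongMemory.hittingTime α (LongMemory.noiseVariance F) ε B T₀) Q ∧
    (∀ᵐ ω ∂Q, 0 < LongMemory.hittingTime α (LongMemory.noiseVariance F) ε B T₀ ω ∧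
      LongMemory.hittingTime α (LongMemory.noiseVariance F) ε B T₀ ω < ∞) ∧
    LongMemory.WeaklyConverges
      (fun n : ℕ =>
        (ProbabilityTheory.cond P
          (LongMemory.largeDevEvent (LongMemory.movingAverage a Z) 0 n ε)).map
        (LongMemory.scaledFirstNonOccurrence
          (LongMemory.movingAverage a Z) (LongMemory.scalingExponent α) n ε))
      (Q.map (LongMemory.hittingTime α (LongMemory.noiseVariance F) ε B T₀)) := by
  have M : LongMemory.IsLongMemoryModel P F Z a α :=
    ⟨inferInstance, hlaw, hindep, hnondeg, hα₀, hα₁, hexp, ha, hmom⟩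
  refine ⟨M.ae_tendsto_movingAverage, M.eventually_measure_largeDevEvent_ne_zero hε hB hT₀ hBT,
    M.aemeasurable_scaledFirstNonOccurrence ε, M.aemeasurable_hittingTime hε hB hT₀ hBT, ?_,
    M.weaklyConverges_scaledFirstNonOccurrence hε hB hT₀ hBT⟩
  filter_upwards [M.ae_hittingTime_pos hε hB hT₀, M.ae_hittingTime_lt_top hε hB] with ω h1 h2
  exact ⟨h1, h2⟩
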